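/- **Setting.** Let $\Gamma$ be a finite graph without edge loops, with vertex set $I$, and let $\Omega$ be an orientation of $\Gamma$ without oriented cycles; $H=\Omega\sqcup\overline\Omega$ is the set of oriented edges, $h\mapsto\bar h$ reverses the orientation, and $\varepsilon=1$ on $\Omega$, $\varepsilon=-1$ on $\overline\Omega$. Let $V_k=\mathbb C^{v_k}$, $W_k=\mathbb C^{w_k}$ $(k\in I)$ with their standard hermitian products, and $$\mathbb M=\mathbb M_\Omega\oplus\mathbb M_{\overline\Omega},\quad \mathbb M_\Omega=\bigoplus_{h\in\Omega}\mathrm{Hom}(V_{out(h)},V_{in(h)})\oplus\bigoplus_k\mathrm{Hom}(W_k,V_k),\quad \mathbb M_{\overline\Omega}=\bigoplus_{h\in\overline\Omega}\mathrm{Hom}(V_{out(h)},V_{in(h)})\oplus\bigoplus_k\mathrm{Hom}(V_k,W_k).$$ Write points as $(B_h,i_k,B_{\bar h},j_k)$ with $h\in\Omega$. The groups $G=\prod_kU(V_k)$ and $G^{\mathbb C}=\prod_kGL(V_k)$ act by $B_h\mapsto g_{in(h)}B_hg_{out(h)}^{-1}$ $(h\in H)$, $i_k\mapsto g_ki_k$,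 $j_k\mapsto j_kg_k^{-1}$; $\mathbb C^\star$ acts by $t\cdot(B_h,i_k,B_{\bar h},j_k)=(B_h,i_k,tB_{\bar h},tj_k)$. Put $$\mu_{\mathbb R}(p)_k=\tfrac{\sqrt{-1}}2\Big(\sum_{h\in H,\,in(h)=k}(B_hB_h^\dagger-B_{\bar h}^\dagger B_{\bar h})+i_ki_k^\dagger-j_k^\dagger j_k\Big),\qquad \mu_{\mathbb C}(p)_k=\sum_{h\in H,\,in(h)=k}\varepsilon(h)B_hB_{\bar h}+i_kj_k,$$ $\mathfrak M_{(\alpha,\beta)}=\big(\mu_{\mathbb R}^{-1}(\alpha)\cap\mu_{\mathbb C}^{-1}(\beta)\big)/G$ with the quotient topology, and for $p=(B,i,j)$, $q=(A,I,J)$ $$l_p^*(q)_k=\sum_{h\in H,\,in(h)=k}(A_hB_h^\dagger-B_{\bar h}^\dagger A_{\bar h})+I_ki_k^\dagger-j_k^\dagger J_k .$$ Fix $\zeta_{\mathbb R}=(\sqrt{-1}\,c_k\,\mathrm{Id})_k$, $c_k\in\mathbb R$, generic: $\sum_kc_k\theta_k\neq0$ for every $\theta\in\mathbb Z_{\ge0}^I\setminus\{0\}$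 with $\theta_k\le v_k$ for all $k$ and ${}^t\theta\mathbf C\theta\le2$, where $\mathbf C=2\,\mathrm{Id}-(\text{adjacency matrix of }\Gamma)$. Fix $\hbar>0$. *Conformal limit.* Let $p\in\mu_{\mathbb R}^{-1}(\zeta_{\mathbb R})\cap\mu_{\mathbb C}^{-1}(0)$. For $R>0$ let $p_R=(B_h,i_k,B_{\bar h},j_k)$ be a point of the $G^{\mathbb C}$-orbit of $R\cdot p$ with $\mu_{\mathbb R}(p_R)=\zeta_{\mathbb R}$, $\mu_{\mathbb C}(p_R)=0$, put $\xi=\hbar R$, and let $F_{R,\hbar}(p)\in\mathfrak M_{(0,-2i\zeta_{\mathbb R})}$ be the class of a point in the $G^{\mathbb C}$-orbit of $$\xi^{-1}\cdot(B_h-\xi B_{\bar h}^\dagger,\ i_k-\xi j_k^\dagger,\ B_{\bar h}+\xi B_h^\dagger,\ j_k+\xi i_k^\dagger).$$ For $m\in\mathbb M$ that is $G^{\mathbb C}$-equivalent to such a $p$, put $\mathcal{CL}_\hbar(m):=\lim_{R\to0^+}F_{R,\hbar}(p)$. *Slice.* Let $p_0\in\mu_{\mathbb R}^{-1}(\zeta_{\mathbb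 R})\cap\mu_{\mathbb C}^{-1}(0)$ represent a $\mathbb C^\star$-fixed point: there are $g_t\in G^{\mathbb C}$ with $g_t\cdot(t\cdot p_0)=p_0$ for all $t\in\mathbb C^\star$. Let $\mathbb M_\Omega^{(1)}$ and $\mathbb M_{\overline\Omega}^{(0)}$ be the sums of the weight spaces, in $\mathbb M_\Omega$ of weight $\ge1$ and in $\mathbb M_{\overline\Omega}$ of weight $\ge0$, for the action of $t\in S^1$ through $g_t$, and $$S^+_{p_0}=\{q\in\mathbb M_\Omega^{(1)}\oplus\mathbb M_{\overline\Omega}^{(0)} : \mu_{\mathbb C}(p_0+q)=0,\ l_{p_0}^*(q)=0\},\qquad A_R=g_R\cdot(R\cdot A)\quad(A\in S^+_{p_0},\ R>0).$$ Call $m\in\mathbb M$ *nilpotent* if $f(m)=f(0)$ for every $G^{\mathbb C}$-invariant polynomial $f$ on $\mathbb M$. **Theorem.** Let $p_0$ represent any $\mathbb C^\star$-fixed point of $\mathfrak M_{(\zeta_{\mathbb R},0)}$ and let $A\in S^+_{p_0}$ be such that $p_0+A$ is not nilpotent. Then the conformal limit $\mathcal{CL}_\hbar(p_0+A_R)\in\mathfrak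 M_{(0,-2i\zeta_{\mathbb R})}$ exists and is unique for every $R>0$, and the line $R\mapsto\mathcal{CL}_\hbar(p_0+A_R)$ leaves every compact subset of $\mathfrak M_{(0,-2i\zeta_{\mathbb R})}$ as $R\to\infty$: for every compact $K$ one has $\mathcal{CL}_\hbar(p_0+A_R)\notin K$ for all sufficiently large $R$. -/

import Mathlib

open scoped Matrix Topology
open Filter

namespace NakajimaQuiver

/-! The vertices are the elements of `I`. The arrows `e : a ⟶ b` of the quiver structure on `I` are the
edges in the chosen orientation `Ω`, with `out e = a` and `in e = b`; each has a reversed edge `ē`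
in `Ω̄`, so that `H = Ω ⊔ Ω̄`. The hermitian spaces are `V k = ℂ^(v k)` and `W k = ℂ^(w k)`. -/

section Space

variable {I : Type*} [Quiver I]

/-- `M_Ω`: the maps `B_e : V_a → V_b` for `e : a ⟶ b` in `Ω`, and the maps `i_k : W_k → V_k`. -/
abbrev MOmega (v w : I → ℕ) :=
  ((a b : I) → (a ⟶ b) → Matrix (Fin (v b)) (Fin (v a)) ℂ) ×
    ((k : I) → Matrix (Fin (v k)) (Fin (w k)) ℂ)

/-- `M_Ω̄`: the maps `B_ē : V_b → V_a` for `e : a ⟶ b` in `Ω`, and the maps `j_k : V_k → W_k`. -/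
abbrev MOmegaBar (v w : I → ℕ) :=
  ((a b : I) → (a ⟶ b) → Matrix (Fin (v a)) (Fin (v b)) ℂ) ×
    ((k : I) → Matrix (Fin (w k)) (Fin (v k)) ℂ)

/-- The representation space `M = M_Ω ⊕ M_Ω̄`. -/
abbrev RepSpace (v w : I → ℕ) := MOmega v w × MOmegaBar v w

/-- `𝔤_v ⊗ ℂ = ⨁ₖ 𝔤𝔩(V_k)`. -/
abbrev LieC (v : I → ℕ) := (k : I) → Matrix (Fin (v k)) (Fin (v k)) ℂ

/-- The complex gauge group `G_v^ℂ = ∏ₖ GL(V_k)`. -/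
abbrev GaugeC (v : I → ℕ) := (k : I) → GL (Fin (v k)) ℂ

/-- Membership in the compact gauge group `G_v = ∏ₖ U(V_k)`. -/
def IsUnitaryGauge {v : I → ℕ} (g : GaugeC v) : Prop :=
  ∀ k, (g k : Matrix (Fin (v k)) (Fin (v k)) ℂ) ∈ Matrix.unitaryGroup (Fin (v k)) ℂ

variable {v w : I → ℕ}

/-- The gauge action on `M_Ω`. -/
def actOmega (g : GaugeC v) (x : MOmega v w) : MOmega v w :=
  (fun a b e => (g b).1 * x.1 a b e * ((g a)⁻¹).1, fun k => (g k).1 * x.2 k)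

/-- The gauge action on `M_Ω̄`. -/
def actOmegaBar (g : GaugeC v) (y : MOmegaBar v w) : MOmegaBar v w :=
  (fun a b e => (g a).1 * y.1 a b e * ((g b)⁻¹).1, fun k => y.2 k * ((g k)⁻¹).1)

/-- The gauge action on `M`. -/
def act (g : GaugeC v) (p : RepSpace v w) : RepSpace v w :=
  (actOmega g p.1, actOmegaBar g p.2)

theorem act_one (p : RepSpace v w) : act 1 p = p := by
  simp [act, actOmega, actOmegaBar]

theorem act_mul (g h : GaugeC v) (p : RepSpace v w) : act (g * h) p = act g (act h p) := by
  simp [act, actOmega, actOmegaBar, Matrix.mul_assoc]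

/-- The scaling `t · (B_h, i_k, B_h̄, j_k) = (B_h, i_k, t B_h̄, t j_k)`. -/
def scale (t : ℂ) (p : RepSpace v w) : RepSpace v w := (p.1, t • p.2)

/-- Hermitian adjoints `M_Ω → M_Ω̄`. -/
def dagger (x : MOmega v w) : MOmegaBar v w :=
  (fun a b e => (x.1 a b e)ᴴ, fun k => (x.2 k)ᴴ)

/-- Hermitian adjoints `M_Ω̄ → M_Ω`. -/
def daggerBar (y : MOmegaBar v w) : MOmega v w :=
  (fun a b e => (y.1 a b e)ᴴ, fun k => (y.2 k)ᴴ)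

/-- The hyperkähler rotation (twistor line)
`(B_h, i, B_h̄, j) ↦ (B_h - ξ B_h̄†, i - ξ j†, B_h̄ + ξ B_h†, j + ξ i†)`, `h ∈ Ω`. -/
def hkRotate (ξ : ℂ) (p : RepSpace v w) : RepSpace v w :=
  (p.1 - ξ • daggerBar p.2, p.2 + ξ • dagger p.1)

/-- The algebra `ℂ[M]` of polynomial functions on `M`. -/
def polyFun (v w : I → ℕ) : Subalgebra ℂ (RepSpace v w → ℂ) :=
  Algebra.adjoin ℂ {f | ∃ l : RepSpace v w →ₗ[ℂ] ℂ, f = fun m => l m}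

/-- `m` is nilpotent if it lies in the null cone of `G_v^ℂ` on `M`, i.e. has the same image as `0`
in the affine quotient `Spec ℂ[M]^{G_v^ℂ}`: every invariant polynomial takes the same value
at `m` as at `0`. -/
def IsNilpotentRep (m : RepSpace v w) : Prop :=
  ∀ f ∈ polyFun v w, (∀ (g : GaugeC v) (q : RepSpace v w), f (act g q) = f q) → f m = f 0

/-- `M_Ω^{(d)}`: the sum of the weight spaces of `M_Ω` of weight at least `d` under the family
`g_t`, `|t| = 1`. -/
def omegaGE (g : ℂ → GaugeC v) (w : I → ℕ) (d : ℤ) : Submodule ℂ (MOmega v w) :=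
  Submodule.span ℂ {x | ∃ m : ℤ, d ≤ m ∧ ∀ t : ℂ, ‖t‖ = 1 → actOmega (g t) x = t ^ m • x}

/-- `M_Ω̄^{(d)}`: the sum of the weight spaces of `M_Ω̄` of weight at least `d` under the family
`g_t`, `|t| = 1`. -/
def omegaBarGE (g : ℂ → GaugeC v) (w : I → ℕ) (d : ℤ) : Submodule ℂ (MOmegaBar v w) :=
  Submodule.span ℂ {y | ∃ m : ℤ, d ≤ m ∧ ∀ t : ℂ, ‖t‖ = 1 → actOmegaBar (g t) y = t ^ m • y}

/-- `g_t · (B_h⁰, i⁰, t B_h̄⁰, t j⁰) = (B_h⁰, i⁰, B_h̄⁰, j⁰)` for all `t ∈ ℂ*`. Such a family exists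
exactly when the `G_v^ℂ`-orbit of `p₀` is fixed by the `ℂ*`-action. The value `g 0` plays no role. -/
def IsFixedBy (p₀ : RepSpace v w) (g : ℂ → GaugeC v) : Prop :=
  ∀ t : ℂ, t ≠ 0 → act (g t) (scale t p₀) = p₀

/-- `A_R = g_R · (A_h, I_k, R A_h̄, R J_k)`. -/
def rescale (g : ℂ → GaugeC v) (R : ℝ) (A : RepSpace v w) : RepSpace v w :=
  act (g (R : ℂ)) (scale (R : ℂ) A)

end Space

section MomentMaps

variable {I : Type*} [Fintype I] [Quiver I] [∀ a b : I, Fintype (a ⟶ b)] {v w : I → ℕ}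

/-- The real moment map. The two sums run over the `h ∈ H` with `in h = k` that lie in `Ω` and
in `Ω̄` respectively. -/
noncomputable def muR (p : RepSpace v w) : LieC v := fun k =>
  (Complex.I / 2) •
    ((∑ a, ∑ e : a ⟶ k, (p.1.1 a k e * (p.1.1 a k e)ᴴ - (p.2.1 a k e)ᴴ * p.2.1 a k e))
      + (∑ b, ∑ e : k ⟶ b, (p.2.1 k b e * (p.2.1 k b e)ᴴ - (p.1.1 k b e)ᴴ * p.1.1 k b e))
      + p.1.2 k * (p.1.2 k)ᴴ - (p.2.2 k)ᴴ * p.2.2 k)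

/-- The complex moment map `∑_{in h = k} ε(h) B_h B_h̄ + i_k j_k`. -/
def muC (p : RepSpace v w) : LieC v := fun k =>
  (∑ a, ∑ e : a ⟶ k, p.1.1 a k e * p.2.1 a k e)
    - (∑ b, ∑ e : k ⟶ b, p.2.1 k b e * p.1.1 k b e) + p.1.2 k * p.2.2 k

/-- The adjoint `l_p^*` of the infinitesimal gauge action at `p`:
`l_p^*(q)_k = ∑_{in h = k} (A_h B_h† - B_h̄† A_h̄) + I_k i_k† - j_k† J_k`
for `p = (B, i, j)` and `q = (A, I, J)`. -/
def lStar (p q : RepSpace v w) : LieC v := fun k =>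
  (∑ a, ∑ e : a ⟶ k, (q.1.1 a k e * (p.1.1 a k e)ᴴ - (p.2.1 a k e)ᴴ * q.2.1 a k e))
    + (∑ b, ∑ e : k ⟶ b, (q.2.1 k b e * (p.2.1 k b e)ᴴ - (p.1.1 k b e)ᴴ * q.1.1 k b e))
    + q.1.2 k * (p.1.2 k)ᴴ - (p.2.2 k)ᴴ * q.2.2 k

/-- The central element `(√-1 c_k Id)_k` of `𝔤_v`. -/
noncomputable def central (v : I → ℕ) (c : I → ℝ) : LieC v := fun k => (Complex.I * (c k : ℂ)) • 1

/-- The generalized Cartan matrix `2 Id - (adjacency matrix of the underlying graph)`. -/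
def cartan (I : Type*) [DecidableEq I] [Quiver I] [∀ a b : I, Fintype (a ⟶ b)] : Matrix I I ℤ :=
  fun a b => (if a = b then 2 else 0) - (Fintype.card (a ⟶ b) : ℤ) - (Fintype.card (b ⟶ a) : ℤ)

/-- Genericity of `(ζ_ℝ, 0)` for `ζ_ℝ = (√-1 c_k Id)_k`: `c` lies on no hyperplane `D_θ` with
`θ ∈ R_+(v)`. -/
def IsGeneric [DecidableEq I] (v : I → ℕ) (c : I → ℝ) : Prop :=
  ∀ θ : I → ℕ, θ ≠ 0 →
    (fun k => (θ k : ℤ)) ⬝ᵥ (cartan I *ᵥ fun k => (θ k : ℤ)) ≤ 2 →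
    (∀ k, θ k ≤ v k) → ∑ k, c k * (θ k : ℝ) ≠ 0

/-- `μ_ℝ⁻¹(ζ_ℝ) ∩ μ_ℂ⁻¹(ζ_ℂ)`. -/
def level (w : I → ℕ) (ζR ζC : LieC v) : Set (RepSpace v w) := {p | muR p = ζR ∧ muC p = ζC}

/-- Two points of a level set are equivalent if they lie in the same `G_v`-orbit. -/
def gaugeSetoid (w : I → ℕ) (ζR ζC : LieC v) : Setoid (level w ζR ζC) where
  r p q := ∃ g : GaugeC v, IsUnitaryGauge g ∧ act g (p : RepSpace v w) = (q : RepSpace v w)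
  iseqv :=
    { refl := fun p => ⟨1, fun _ => one_mem _, act_one _⟩
      symm := by
        rintro p q ⟨g, hg, h⟩
        refine ⟨g⁻¹, fun k => ?_, ?_⟩
        · have h1 : (g k : Matrix (Fin (v k)) (Fin (v k)) ℂ) *
              star (g k : Matrix (Fin (v k)) (Fin (v k)) ℂ) = 1 :=
            Matrix.mem_unitaryGroup_iff.mp (hg k)
          have h2 : ((g⁻¹) k : Matrix (Fin (v k)) (Fin (v k)) ℂ) =
              star (g k : Matrix (Fin (v k)) (Fin (v k)) ℂ) :=
            Units.inv_eq_of_mul_eq_one_right h1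
          rw [h2]
          exact Unitary.star_mem (hg k)
        · rw [← h, ← act_mul, inv_mul_cancel, act_one]
      trans := by
        rintro p q r ⟨g, hg, h⟩ ⟨g', hg', h'⟩
        exact ⟨g' * g, fun k => mul_mem (hg' k) (hg k), by rw [act_mul, h, h']⟩ }

/-- The Nakajima quiver variety `𝔐_(ζ_ℝ, ζ_ℂ)`, with the quotient topology. -/
abbrev QuiverVariety (w : I → ℕ) (ζR ζC : LieC v) := Quotient (gaugeSetoid w ζR ζC)

/-- `𝔐_(0, -2iζ_ℝ)` for `ζ_ℝ = (√-1 c_k Id)_k`. -/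
noncomputable abbrev TargetVariety (v w : I → ℕ) (c : I → ℝ) :=
  QuiverVariety w (0 : LieC v) ((-2 * Complex.I) • central v c)

/-- The Białynicki-Birula slice `S⁺_{p₀}`. -/
def bbSlice (p₀ : RepSpace v w) (g : ℂ → GaugeC v) : Set (RepSpace v w) :=
  {q | q.1 ∈ omegaGE g w 1 ∧ q.2 ∈ omegaBarGE g w 0 ∧ muC (p₀ + q) = 0 ∧ lStar p₀ q = 0}

/-- `q = F_{R,ħ}(p)` in `𝔐_(0,-2iζ_ℝ)`. With `ξ = ħ R`: scale `p` by `R`, move it by a complex gauge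
transformation to a point `p_R` on which `μ_ℝ = ζ_ℝ` and `μ_ℂ = 0`, rotate `p_R` by `ξ`, scale
by `ξ⁻¹`, and move the result by a complex gauge transformation to a point on
which `μ_ℝ = 0` and `μ_ℂ = -2iζ_ℝ`. -/
def IsFamilyPoint (c : I → ℝ) (ħ R : ℝ) (p : RepSpace v w) (q : TargetVariety v w c) : Prop :=
  ∃ pR ∈ level w (central v c) 0, (∃ a : GaugeC v, act a (scale (R : ℂ) p) = pR) ∧
    ∃ r : level w (0 : LieC v) ((-2 * Complex.I) • central v c),
      (∃ b : GaugeC v,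
        act b (scale ((ħ : ℂ) * (R : ℂ))⁻¹ (hkRotate ((ħ : ℂ) * (R : ℂ)) pR)) =
          (r : RepSpace v w)) ∧
      q = Quotient.mk _ r

/-- `q = CL_ħ(m)`: `m` is complex gauge equivalent to a point `p` on which `μ_ℝ = ζ_ℝ` and
`μ_ℂ = 0`, and `q` is the limit of `F_{R,ħ}(p)` as `R → 0⁺`. -/
def IsConformalLimit (c : I → ℝ) (ħ : ℝ) (m : RepSpace v w) (q : TargetVariety v w c) : Prop :=
  ∃ p ∈ level w (central v c) 0, (∃ a : GaugeC v, act a m = p) ∧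
    ∃ F : ℝ → TargetVariety v w c,
      (∀ R : ℝ, 0 < R → IsFamilyPoint c ħ R p (F R)) ∧ Tendsto F (𝓝[>] 0) (𝓝 q)

end MomentMaps

end NakajimaQuiver

open NakajimaQuiver

/-! The proof rests on an explicit formula for the limit. Let `n` be the integer weights of `g_t`.
The action of `t ^ n` combined with the scaling grades the matrix entries: `p₀` lies in degree 0 and
the slice in degrees at least 1. For `z = k · (p₀ + A)`, with `k` of nonnegative degree, the point
`R ^ n · (R · z)` has its moment map conjugate to `lStar (τ z) z`, where `τ = tau n (R ^ 2)`
multiplies degree `e` by `R ^ (2 e)`. Put `S = R ^ 2`. The equation extends to `S = 0`, where `τ`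
sends `p₀ + A` to `p₀`, and `l_{p₀}^*(A) = 0` makes `k = 1` a solution. The linearisation there is
injective, degree by degree (`eq_zero_of_projL_lStar_eq_zero`), so solutions close to 1 exist for
small `R` (`eventually_exists_gauge`). Undoing `R ^ n` turns the rotated point into `twist ħ (τ z)
z`, hence the limit at `p₀ + A` is the class of `twist ħ p₀ (p₀ + A)`.

Passing from orbits to classes is Kempf-Ness theory: a point with `μ_ℂ = 2c` has a representative
with `μ_ℝ = 0`, unique up to unitary gauge and depending continuously on the point (`exists_target`,
`eventually_toTarget_mem`). The input is genericity. There is no nonzero unframed point with `μ_ℂ =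
2c` of dimension at most `v` (`eq_zero_of_muC_eq_twoC`): a simple one would have an isotropic orbit
with one-dimensional stabiliser, so its dimension vector would be a forbidden `θ`. This makes the
Kempf-Ness function proper and the action on the level sets free.

For the escape to infinity, `p₀ + A_R` is `g_R · (R · (p₀ + A))`, and the formula gives a
representative in the orbit of `R · u_R`, where `u_R` tends to `ħ⁻¹ · (p₀ + A)` up to gauge.
Acyclicity makes every invariant constant on `M_Ω`, so a point that is not nilpotent is detected by
an invariant `φ` homogeneous of degree `d > 0` in `M_Ω̄`. Then `|φ|` equals `R ^ d |φ(u_R)|` on the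
line and tends to infinity, while it is bounded on compact sets. -/

set_option linter.unusedSectionVars false
set_option linter.unusedSimpArgs false

namespace NakajimaQuiver

/-! ### Matrix entries, their weights, and the gauge action -/

section Entries

variable {I : Type*} [Quiver I] {v w : I → ℕ}

theorem rep_ext {m m' : RepSpace v w} (h₁ : ∀ a b e, m.1.1 a b e = m'.1.1 a b e)
    (h₂ : ∀ k, m.1.2 k = m'.1.2 k) (h₃ : ∀ a b e, m.2.1 a b e = m'.2.1 a b e)
    (h₄ : ∀ k, m.2.2 k = m'.2.2 k) : m = m' :=
  Prod.ext (Prod.ext (by funext a b e; exact h₁ a b e) (funext h₂))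
    (Prod.ext (by funext a b e; exact h₃ a b e) (funext h₄))

/-- The index set of all matrix entries of a point of `M`. -/
abbrev Ent (v w : I → ℕ) :=
  (Σ a : I, Σ b : I, (a ⟶ b) × Fin (v b) × Fin (v a)) ⊕ (Σ k : I, Fin (v k) × Fin (w k)) ⊕
    (Σ a : I, Σ b : I, (a ⟶ b) × Fin (v a) × Fin (v b)) ⊕ (Σ k : I, Fin (w k) × Fin (v k))

/-- The matrix entry of `m` at a given index. -/
def entry (m : RepSpace v w) : Ent v w → ℂ
  | .inl ⟨a, b, e, i, j⟩ => m.1.1 a b e i j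
  | .inr (.inl ⟨k, i, l⟩) => m.1.2 k i l
  | .inr (.inr (.inl ⟨a, b, e, i, j⟩)) => m.2.1 a b e i j
  | .inr (.inr (.inr ⟨k, l, i⟩)) => m.2.2 k l i

theorem entry_ext {m m' : RepSpace v w} (h : ∀ s, entry m s = entry m' s) : m = m' := by
  refine Prod.ext (Prod.ext ?_ ?_) (Prod.ext ?_ ?_)
  · funext a b e; ext i j; exact h (.inl ⟨a, b, e, i, j⟩)
  · funext k; ext i j; exact h (.inr (.inl ⟨k, i, j⟩))
  · funext a b e; ext i j; exact h (.inr (.inr (.inl ⟨a, b, e, i, j⟩)))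
  · funext k; ext i j; exact h (.inr (.inr (.inr ⟨k, i, j⟩)))

/-- The weight of a matrix entry for the diagonal infinitesimal gauge transformation `l`. -/
def wt {R : Type*} [AddCommGroup R] (l : (k : I) → Fin (v k) → R) : Ent v w → R
  | .inl ⟨a, b, _, i, j⟩ => l b i - l a j
  | .inr (.inl ⟨k, i, _⟩) => l k i
  | .inr (.inr (.inl ⟨a, b, _, i, j⟩)) => l a i - l b j
  | .inr (.inr (.inr ⟨k, _, i⟩)) => - l k i

/-- The degree of a matrix entry in the variables of `M_Ω̄`. -/
def barDeg : Ent v w → ℤ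
  | .inl _ => 0
  | .inr (.inl _) => 0
  | .inr (.inr _) => 1

/-- The two-sided action of a pair of families of endomorphisms. -/
def act₂ (K K' : LieC v) (m : RepSpace v w) : RepSpace v w :=
  ((fun a b e => K b * m.1.1 a b e * K' a, fun k => K k * m.1.2 k),
    (fun a b e => K a * m.2.1 a b e * K' b, fun k => m.2.2 k * K' k))

/-- The infinitesimal gauge action. -/
def lact (X : LieC v) (p : RepSpace v w) : RepSpace v w :=
  ((fun a b e => X b * p.1.1 a b e - p.1.1 a b e * X a, fun k => X k * p.1.2 k),
    (fun a b e => X a * p.2.1 a b e - p.2.1 a b e * X b, fun k => - (p.2.2 k * X k)))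

/-- The diagonal gauge transformation with entries `exp (z λ)`. -/
noncomputable def expG (z : ℂ) (l : (k : I) → Fin (v k) → ℝ) : GaugeC v := fun k =>
  ⟨Matrix.diagonal fun i => Complex.exp (z * l k i),
    Matrix.diagonal fun i => Complex.exp (-(z * l k i)),
    by simp [← Complex.exp_add], by simp [← Complex.exp_add]⟩

theorem entry_act_expG (z : ℂ) (l : (k : I) → Fin (v k) → ℝ) (m : RepSpace v w) (s : Ent v w) :
    entry (act (expG z l) m) s = Complex.exp (z * (wt l s : ℝ)) * entry m s := by
  rcases s with ⟨a, b, e, i, j⟩ | ⟨k, i, j⟩ | ⟨a, b, e, i, j⟩ | ⟨k, i, j⟩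
  all_goals simp [entry, act, actOmega, actOmegaBar, expG, wt, mul_sub, sub_eq_add_neg, Complex.exp_add, mul_add]
  all_goals ring

/-- The diagonal endomorphisms. -/
def diagL (l : (k : I) → Fin (v k) → ℂ) : LieC v := fun k => Matrix.diagonal (l k)

theorem entry_lact_diagL (l : (k : I) → Fin (v k) → ℝ) (m : RepSpace v w) (s : Ent v w) :
    entry (lact (diagL fun k i => (l k i : ℂ)) m) s = ((wt l s : ℝ) : ℂ) * entry m s := by
  rcases s with ⟨a, b, e, i, j⟩ | ⟨k, i, j⟩ | ⟨a, b, e, i, j⟩ | ⟨k, i, j⟩ <;>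
    simp [entry, lact, diagL, wt] <;> ring

theorem entry_scale (t : ℂ) (m : RepSpace v w) (s : Ent v w) :
    entry (scale t m) s = t ^ (barDeg s) * entry m s := by
  rcases s with ⟨a, b, e, i, j⟩ | ⟨k, i, j⟩ | ⟨a, b, e, i, j⟩ | ⟨k, i, j⟩ <;>
    simp [entry, scale, barDeg]

@[simp] theorem entry_add (m m' : RepSpace v w) (s : Ent v w) :
    entry (m + m') s = entry m s + entry m' s := by
  rcases s with ⟨a, b, e, i, j⟩ | ⟨k, i, j⟩ | ⟨a, b, e, i, j⟩ | ⟨k, i, j⟩ <;> rfl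

@[simp] theorem entry_zero (s : Ent v w) : entry (0 : RepSpace v w) s = 0 := by
  rcases s with ⟨a, b, e, i, j⟩ | ⟨k, i, j⟩ | ⟨a, b, e, i, j⟩ | ⟨k, i, j⟩ <;> rfl

theorem continuous_entry (s : Ent v w) : Continuous fun m : RepSpace v w => entry m s := by
  rcases s with ⟨a, b, e, i, j⟩ | ⟨k, i, j⟩ | ⟨a, b, e, i, j⟩ | ⟨k, i, j⟩ <;>
    · simp only [entry]
      fun_prop

theorem act_add (g : GaugeC v) (p q : RepSpace v w) : act g (p + q) = act g p + act g q := by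
  simp only [act, actOmega, actOmegaBar, Prod.fst_add, Prod.snd_add, Pi.add_apply, Matrix.mul_add,
    Matrix.add_mul]
  rfl

theorem act_zero (g : GaugeC v) : act g (0 : RepSpace v w) = 0 := by
  have := act_add g (0 : RepSpace v w) 0
  simpa using this

theorem act_inv_act (g : GaugeC v) (p : RepSpace v w) : act g⁻¹ (act g p) = p := by
  rw [← act_mul, inv_mul_cancel, act_one]

theorem act_act_inv (g : GaugeC v) (p : RepSpace v w) : act g (act g⁻¹ p) = p := by
  rw [← act_mul, mul_inv_cancel, act_one]

theorem act_scale (g : GaugeC v) (t : ℂ) (p : RepSpace v w) :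
    act g (scale t p) = scale t (act g p) := by
  simp only [act, actOmega, actOmegaBar, scale, Prod.snd, Prod.smul_fst, Pi.smul_apply,
    Matrix.mul_smul, Prod.smul_snd, Matrix.smul_mul]
  rfl

theorem scale_scale (s t : ℂ) (p : RepSpace v w) : scale s (scale t p) = scale (s * t) p := by
  simp [scale, mul_smul]

theorem scale_one (p : RepSpace v w) : scale 1 p = p := by simp [scale]

theorem scale_add (t : ℂ) (p q : RepSpace v w) : scale t (p + q) = scale t p + scale t q := by
  simp [scale]

theorem IsUnitaryGauge.inv {g : GaugeC v} (hg : IsUnitaryGauge g) : IsUnitaryGauge g⁻¹ := by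
  intro k
  have h1 : (g k : Matrix (Fin (v k)) (Fin (v k)) ℂ) *
      star (g k : Matrix (Fin (v k)) (Fin (v k)) ℂ) = 1 := Matrix.mem_unitaryGroup_iff.mp (hg k)
  have h2 : ((g⁻¹) k : Matrix (Fin (v k)) (Fin (v k)) ℂ) =
      star (g k : Matrix (Fin (v k)) (Fin (v k)) ℂ) := Units.inv_eq_of_mul_eq_one_right h1
  rw [h2]
  exact Unitary.star_mem (hg k)

theorem IsUnitaryGauge.inv_coe {g : GaugeC v} (hg : IsUnitaryGauge g) (k : I) :
    ((g k)⁻¹ : GL (Fin (v k)) ℂ).1 = (g k).1ᴴ :=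
  Units.inv_eq_of_mul_eq_one_right (Matrix.mem_unitaryGroup_iff.mp (hg k))

theorem IsUnitaryGauge.mul {g h : GaugeC v} (hg : IsUnitaryGauge g) (hh : IsUnitaryGauge h) :
    IsUnitaryGauge (g * h) := fun k => mul_mem (hg k) (hh k)

/-- The gauge transformation attached to a family of unitary matrices. -/
def unitG (u : (k : I) → Matrix.unitaryGroup (Fin (v k)) ℂ) : GaugeC v := fun k =>
  Unitary.toUnits (u k)

theorem isUnitaryGauge_unitG (u : (k : I) → Matrix.unitaryGroup (Fin (v k)) ℂ) :
    IsUnitaryGauge (unitG u) := fun k => (u k).2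

theorem IsUnitaryGauge.exists_unitG {g : GaugeC v} (hg : IsUnitaryGauge g) :
    ∃ u, unitG u = g := ⟨fun k => ⟨(g k).1, hg k⟩, by funext k; exact Units.ext rfl⟩

theorem act_unitG (u : (k : I) → Matrix.unitaryGroup (Fin (v k)) ℂ) (m : RepSpace v w) :
    act (unitG u) m = act₂ (fun k => (u k).1) (fun k => (u k).1ᴴ) m := rfl

theorem hkRotate_act (ξ : ℝ) {u : GaugeC v} (hu : IsUnitaryGauge u) (p : RepSpace v w) :
    hkRotate (ξ : ℂ) (act u p) = act u (hkRotate (ξ : ℂ) p) := by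
  refine rep_ext (fun a b e => ?_) (fun k => ?_) (fun a b e => ?_) (fun k => ?_) <;>
    simp [hkRotate, act, actOmega, actOmegaBar, dagger, daggerBar, hu.inv_coe, Matrix.mul_sub,
      Matrix.sub_mul, Matrix.mul_add, Matrix.add_mul, Matrix.mul_assoc, -Matrix.coe_units_inv]

end Entries

/-! ### Moment maps, adjointness and equivariance -/

section Moment

variable {I : Type*} [Fintype I] [Quiver I] [∀ a b : I, Fintype (a ⟶ b)] {v w : I → ℕ}

/-- The central element `(2 c_k Id)_k`. -/
def twoC (v : I → ℕ) (c : I → ℝ) : LieC v := fun k => (2 * (c k : ℂ)) • 1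

theorem muR_eq (p : RepSpace v w) : muR p = (Complex.I / 2) • lStar p p := rfl

theorem muR_eq_central_iff (c : I → ℝ) (p : RepSpace v w) :
    muR p = central v c ↔ lStar p p = twoC v c := by
  have h : central v c = (Complex.I / 2) • twoC v c := by
    funext k
    simp only [central, twoC, Pi.smul_apply, smul_smul]
    congr 1; ring
  rw [muR_eq, h]
  exact (smul_right_injective _ (by simp)).eq_iff

theorem muR_eq_zero_iff (p : RepSpace v w) : muR p = 0 ↔ lStar p p = 0 := by
  rw [muR_eq]; simp

theorem target_eq (v : I → ℕ) (c : I → ℝ) : (-2 * Complex.I) • central v c = twoC v c := by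
  funext k
  simp only [central, twoC, Pi.smul_apply, smul_smul]
  congr 1
  linear_combination (-2 * (c k : ℂ)) * Complex.I_mul_I

theorem twoC_zero (v : I → ℕ) : twoC v (0 : I → ℝ) = 0 := by
  funext k; simp [twoC]

theorem mem_level_iff (c : I → ℝ) (p : RepSpace v w) :
    p ∈ level w (central v c) 0 ↔ lStar p p = twoC v c ∧ muC p = 0 := by
  simp only [level, Set.mem_ofPred_eq, muR_eq_central_iff]

theorem mem_target_iff (c : I → ℝ) (p : RepSpace v w) :
    p ∈ level w (0 : LieC v) ((-2 * Complex.I) • central v c) ↔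
      lStar p p = 0 ∧ muC p = twoC v c := by
  simp only [level, Set.mem_ofPred_eq, muR_eq_zero_iff, target_eq]

/-- The hermitian product on `M`. -/
noncomputable def dot (p q : RepSpace v w) : ℂ := ∑ s, star (entry p s) * entry q s

theorem trace_conjTranspose_mul_eq {m n : Type*} [Fintype m] [Fintype n] (A B : Matrix m n ℂ) :
    (Aᴴ * B).trace = ∑ x : m × n, star (A x.1 x.2) * B x.1 x.2 := by
  simp only [Matrix.trace, Matrix.diag, Matrix.mul_apply, Matrix.conjTranspose_apply,
    Fintype.sum_prod_type]
  exact Finset.sum_comm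

theorem dot_eq (p q : RepSpace v w) : dot p q =
    (∑ a, ∑ b, ∑ e : a ⟶ b, ((p.1.1 a b e)ᴴ * q.1.1 a b e).trace) +
    ((∑ k, ((p.1.2 k)ᴴ * q.1.2 k).trace) +
    ((∑ a, ∑ b, ∑ e : a ⟶ b, ((p.2.1 a b e)ᴴ * q.2.1 a b e).trace) +
    (∑ k, ((p.2.2 k)ᴴ * q.2.2 k).trace))) := by
  simp only [trace_conjTranspose_mul_eq, dot, Fintype.sum_sum_type, Fintype.sum_sigma,
    Fintype.sum_prod_type, entry]

/-- Adjointness of `lStar p` and the infinitesimal action at `p`. It converts moment map equations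
into statements on weights of entries. -/
theorem sum_trace_lStar (X : LieC v) (p q : RepSpace v w) :
    ∑ k, ((X k)ᴴ * lStar p q k).trace = dot (lact X p) q := by
  have comm : ∀ f : (a b : I) → (a ⟶ b) → ℂ,
      ∑ k, ∑ a, ∑ e : a ⟶ k, f a k e = ∑ a, ∑ b, ∑ e : a ⟶ b, f a b e :=
    fun f => Finset.sum_comm
  rw [dot_eq]
  simp only [lStar, lact, Matrix.mul_add, Matrix.mul_sub, Matrix.mul_sum, Matrix.trace_add,
    Matrix.trace_sub, Matrix.trace_sum, Finset.sum_add_distrib, Finset.sum_sub_distrib,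
    Matrix.conjTranspose_sub, Matrix.conjTranspose_mul, Matrix.sub_mul, Matrix.conjTranspose_neg,
    Matrix.neg_mul, Matrix.trace_neg, Finset.sum_neg_distrib, comm]
  have e1 : ∀ (a b : I) (e : a ⟶ b), ((p.1.1 a b e)ᴴ * ((X b)ᴴ * q.1.1 a b e)).trace =
      ((X b)ᴴ * (q.1.1 a b e * (p.1.1 a b e)ᴴ)).trace := fun a b e => by
    rw [Matrix.trace_mul_comm, Matrix.mul_assoc]
  have e2 : ∀ (a b : I) (e : a ⟶ b), ((p.2.1 a b e)ᴴ * ((X a)ᴴ * q.2.1 a b e)).trace =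
      ((X a)ᴴ * (q.2.1 a b e * (p.2.1 a b e)ᴴ)).trace := fun a b e => by
    rw [Matrix.trace_mul_comm, Matrix.mul_assoc]
  have e3 : ∀ k : I, ((p.1.2 k)ᴴ * ((X k)ᴴ * q.1.2 k)).trace =
      ((X k)ᴴ * (q.1.2 k * (p.1.2 k)ᴴ)).trace := fun k => by
    rw [Matrix.trace_mul_comm, Matrix.mul_assoc]
  simp only [e1, e2, e3, Matrix.mul_assoc]
  ring

theorem conjTranspose_lStar (p q : RepSpace v w) (k : I) : (lStar p q k)ᴴ = lStar q p k := by
  simp only [lStar, Matrix.conjTranspose_add, Matrix.conjTranspose_sub, Matrix.conjTranspose_sum,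
    Matrix.conjTranspose_mul, Matrix.conjTranspose_conjTranspose]

/-- The first argument enters only through adjoints, so it must move by the inverse adjoint of the
transformation of the second. The non-unitary case is needed for the Hermitian elements `R ^ n`. -/
theorem lStar_act {g h : GaugeC v} (hgh : ∀ k, (g k).1ᴴ = ((h k)⁻¹).1) (p q : RepSpace v w)
    (k : I) : lStar (act g p) (act h q) k = (h k).1 * lStar p q k * ((h k)⁻¹).1 := by
  have hgi : ∀ k, ((g k)⁻¹).1ᴴ = (h k).1 := fun k => by
    have h1 : ((g k)⁻¹).1ᴴ * (g k).1ᴴ = 1 := by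
      rw [← Matrix.conjTranspose_mul, ← Units.val_mul, mul_inv_cancel]; simp
    rw [hgh k] at h1
    calc ((g k)⁻¹).1ᴴ = ((g k)⁻¹).1ᴴ * (((h k)⁻¹).1 * (h k).1) := by
          rw [← Units.val_mul, inv_mul_cancel]; simp
      _ = (h k).1 := by rw [← Matrix.mul_assoc, h1, Matrix.one_mul]
  have hh : ∀ (k : I) {n : ℕ} (M : Matrix (Fin (v k)) (Fin n) ℂ),
      ((h k)⁻¹).1 * ((h k).1 * M) = M := fun k n M => by
    rw [← Matrix.mul_assoc, ← Units.val_mul, inv_mul_cancel]; simp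
  simp only [lStar, act, actOmega, actOmegaBar, Matrix.conjTranspose_mul, hgh, hgi,
    Matrix.mul_assoc, hh, Matrix.mul_add, Matrix.mul_sub, Matrix.mul_sum, Matrix.add_mul,
    Matrix.sub_mul, Matrix.sum_mul]

theorem lStar_act_unitary {u : GaugeC v} (hu : IsUnitaryGauge u) (p q : RepSpace v w)
    (k : I) : lStar (act u p) (act u q) k = (u k).1 * lStar p q k * (u k).1ᴴ := by
  rw [lStar_act (fun k => (hu.inv_coe k).symm), hu.inv_coe]

theorem muC_act (g : GaugeC v) (p : RepSpace v w) (k : I) :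
    muC (act g p) k = (g k).1 * muC p k * ((g k)⁻¹).1 := by
  have hh : ∀ (k : I) {n : ℕ} (M : Matrix (Fin (v k)) (Fin n) ℂ),
      ((g k)⁻¹).1 * ((g k).1 * M) = M := fun k n M => by
    rw [← Matrix.mul_assoc, ← Units.val_mul, inv_mul_cancel]; simp
  simp only [muC, act, actOmega, actOmegaBar,
    Matrix.mul_assoc, hh, Matrix.mul_add, Matrix.mul_sub, Matrix.mul_sum, Matrix.add_mul,
    Matrix.sub_mul, Matrix.sum_mul]

theorem conj_twoC (g : GaugeC v) (c : I → ℝ) (k : I) :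
    (g k).1 * twoC v c k * ((g k)⁻¹).1 = twoC v c k := by
  simp only [twoC, Matrix.mul_smul, Matrix.smul_mul, mul_one]
  rw [← Units.val_mul, mul_inv_cancel, Units.val_one]

theorem muC_act_eq_twoC (g : GaugeC v) {c : I → ℝ} {p : RepSpace v w} (h : muC p = twoC v c) :
    muC (act g p) = twoC v c := by
  funext k; rw [muC_act, h, conj_twoC]

theorem muC_act_eq_zero (g : GaugeC v) {p : RepSpace v w} (h : muC p = 0) :
    muC (act g p) = 0 := by
  rw [← twoC_zero] at h ⊢; exact muC_act_eq_twoC g h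

theorem lStar_act_eq_twoC {u : GaugeC v} (hu : IsUnitaryGauge u) {c : I → ℝ} {p : RepSpace v w}
    (h : lStar p p = twoC v c) : lStar (act u p) (act u p) = twoC v c := by
  funext k; rw [lStar_act_unitary hu, h, ← hu.inv_coe, conj_twoC]

theorem muC_scale (t : ℂ) (p : RepSpace v w) : muC (scale t p) = t • muC p := by
  funext k
  simp only [muC, scale, Prod.smul_fst, Prod.smul_snd, Pi.smul_apply, Matrix.mul_smul,
    Matrix.smul_mul, smul_add, smul_sub, Finset.smul_sum]

theorem lStar_scale_right (t : ℂ) (p q : RepSpace v w) :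
    lStar p (scale t q) = lStar (scale (star t) p) q := by
  funext k
  simp only [lStar, scale, Prod.smul_fst, Prod.smul_snd, Pi.smul_apply, Matrix.mul_smul,
    Matrix.smul_mul, Matrix.conjTranspose_smul, star_star]

/-- The mixed terms of the rotation assemble into the real moment map. On the level set the rotation
therefore trades the real parameter for a complex one; `ξ = 1` lets results on the complex level be
used on the real one. -/
theorem muC_hkRotate (ξ : ℝ) (p : RepSpace v w) (k : I) : muC (hkRotate (ξ : ℂ) p) k =
    muC p k + (ξ : ℂ) • lStar p p k - ((ξ : ℂ) ^ 2) • (muC p k)ᴴ := by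
  simp only [muC, lStar, hkRotate, dagger, daggerBar, Prod.fst_sub, Prod.snd_sub, Prod.fst_add,
    Prod.snd_add, Pi.add_apply, Pi.sub_apply, Prod.smul_fst, Prod.smul_snd, Pi.smul_apply,
    Matrix.mul_add, Matrix.add_mul, Matrix.mul_sub, Matrix.sub_mul, Matrix.mul_smul,
    Matrix.smul_mul, Matrix.conjTranspose_add, Matrix.conjTranspose_sub, Matrix.conjTranspose_mul,
    Matrix.conjTranspose_sum, Finset.sum_add_distrib, Finset.sum_sub_distrib, smul_add, smul_sub,
    Finset.smul_sum, smul_smul]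
  ring_nf
  abel

theorem muC_hkRotate_one {c : I → ℝ} {p : RepSpace v w} (hp : p ∈ level w (central v c) 0) :
    muC (hkRotate ((1 : ℝ) : ℂ) p) = twoC v c := by
  obtain ⟨h1, h2⟩ := (mem_level_iff c p).1 hp
  funext k; rw [muC_hkRotate, h1, h2]; simp

theorem muC_scale_hkRotate {c : I → ℝ} {p : RepSpace v w} (hp : p ∈ level w (central v c) 0)
    {ξ : ℝ} (hξ : ξ ≠ 0) : muC (scale (ξ : ℂ)⁻¹ (hkRotate (ξ : ℂ) p)) = twoC v c := by
  obtain ⟨h1, h2⟩ := (mem_level_iff c p).1 hp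
  rw [muC_scale]
  funext k
  have : (ξ : ℂ) ≠ 0 := by exact_mod_cast hξ
  rw [Pi.smul_apply, muC_hkRotate, h1, h2]
  simp only [Pi.zero_apply, zero_add, Matrix.conjTranspose_zero, smul_zero, sub_zero, smul_smul,
    inv_mul_cancel₀ this, one_smul]

theorem act_mem_level {u : GaugeC v} (hu : IsUnitaryGauge u) {c : I → ℝ} {p : RepSpace v w}
    (hp : p ∈ level w (central v c) 0) : act u p ∈ level w (central v c) 0 := by
  rw [mem_level_iff] at hp ⊢
  exact ⟨lStar_act_eq_twoC hu hp.1, muC_act_eq_zero u hp.2⟩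

theorem act_mem_target {u : GaugeC v} (hu : IsUnitaryGauge u) {c : I → ℝ} {p : RepSpace v w}
    (hp : p ∈ level w (0 : LieC v) ((-2 * Complex.I) • central v c)) :
    act u p ∈ level w (0 : LieC v) ((-2 * Complex.I) • central v c) := by
  rw [mem_target_iff] at hp ⊢
  refine ⟨?_, muC_act_eq_twoC u hp.2⟩
  rw [← twoC_zero] at hp ⊢
  exact lStar_act_eq_twoC hu hp.1

/-- The pairing of the diagonal matrices with the character `c`. -/
def charPair (c : I → ℝ) (l : (k : I) → Fin (v k) → ℝ) : ℝ := ∑ k, c k * ∑ i, l k i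

/-- The torus component of the real moment map: pair the level equation with a diagonal matrix. -/
theorem sum_wt_mul_normSq {c : I → ℝ} {p : RepSpace v w} (hp : lStar p p = twoC v c)
    (l : (k : I) → Fin (v k) → ℝ) :
    ∑ s, wt l s * ‖entry p s‖ ^ 2 = 2 * charPair c l := by
  have h := sum_trace_lStar (diagL fun k i => (l k i : ℂ)) p p
  rw [hp] at h
  simp only [dot, entry_lact_diagL] at h
  have h1 : ∀ s : Ent v w, star (((wt l s : ℝ) : ℂ) * entry p s) * entry p s =
      ((wt l s * ‖entry p s‖ ^ 2 : ℝ) : ℂ) := fun s => by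
    have := Complex.conj_mul' (entry p s)
    simp only [star_mul', Complex.star_def, Complex.conj_ofReal]
    push_cast
    rw [mul_assoc, this]
  simp only [h1] at h
  have h2 : ∀ k, ((diagL (fun k i => (l k i : ℂ)) k)ᴴ * twoC v c k).trace =
      ((2 * (c k * ∑ i, l k i) : ℝ) : ℂ) := fun k => by
    simp [diagL, twoC, Matrix.trace, Matrix.diagonal_apply, Finset.mul_sum]
    exact Finset.sum_congr rfl fun i _ => by ring
  simp only [h2] at h
  rw [charPair, Finset.mul_sum]
  exact_mod_cast h.symm

theorem continuous_lStar : Continuous fun x : RepSpace v w × RepSpace v w => lStar x.1 x.2 := by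
  unfold lStar
  fun_prop

theorem continuous_muC : Continuous fun x : RepSpace v w => muC x := by
  unfold muC
  fun_prop

theorem isClosed_target (c : I → ℝ) :
    IsClosed (level w (0 : LieC v) ((-2 * Complex.I) • central v c)) := by
  have : level w (0 : LieC v) ((-2 * Complex.I) • central v c) =
      {p | lStar p p = 0} ∩ {p | muC p = twoC v c} := by
    ext p; exact mem_target_iff c p
  rw [this]
  exact (isClosed_eq (continuous_lStar.comp (continuous_id.prodMk continuous_id))
    continuous_const).inter (isClosed_eq continuous_muC continuous_const)

end Moment

/-! ### Unframed representations and genericity -/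

section Simple

variable {I : Type*} [Fintype I] [Quiver I] [∀ a b : I, Fintype (a ⟶ b)] {v w : I → ℕ}

theorem dot_self (q : RepSpace v w) : dot q q = ((∑ s, ‖entry q s‖ ^ 2 : ℝ) : ℂ) := by
  rw [dot]
  push_cast
  exact Finset.sum_congr rfl fun s _ => Complex.conj_mul' _

theorem eq_zero_of_dot_self {q : RepSpace v w} (h : dot q q = 0) : q = 0 := by
  rw [dot_self] at h
  have h1 : ∑ s, ‖entry q s‖ ^ 2 = 0 := by exact_mod_cast h
  rw [Finset.sum_eq_zero_iff_of_nonneg fun s _ => by positivity] at h1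
  refine entry_ext fun s => ?_
  simpa using h1 s (Finset.mem_univ _)

theorem sum_in_eq {M : Type*} [AddCommMonoid M] (f : (a b : I) → (a ⟶ b) → M) :
    ∑ k, ∑ a, ∑ e : a ⟶ k, f a k e = ∑ a, ∑ b, ∑ e : a ⟶ b, f a b e := Finset.sum_comm

/-- The infinitesimal gauge action as a linear map. -/
def lactL (m : RepSpace v w) : LieC v →ₗ[ℂ] RepSpace v w where
  toFun X := lact X m
  map_add' X Y := by
    refine rep_ext (fun a b e => ?_) (fun k => ?_) (fun a b e => ?_) (fun k => ?_) <;>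
      simp [lact, Matrix.add_mul, Matrix.mul_add] <;> abel
  map_smul' t X := by
    refine rep_ext (fun a b e => ?_) (fun k => ?_) (fun a b e => ?_) (fun k => ?_) <;>
      simp [lact, smul_sub]

/-- The symplectic form on the representations of the double quiver. -/
noncomputable def sympl (v : I → ℕ) : LinearMap.BilinForm ℂ (RepSpace v (0 : I → ℕ)) :=
  LinearMap.mk₂ ℂ (fun q q' => ∑ a, ∑ b, ∑ e : a ⟶ b,
      ((q.1.1 a b e * q'.2.1 a b e).trace - (q'.1.1 a b e * q.2.1 a b e).trace))
    (fun q q' r => by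
      simp only [← Finset.sum_add_distrib]
      refine Finset.sum_congr rfl fun a _ => Finset.sum_congr rfl fun b _ =>
        Finset.sum_congr rfl fun e _ => ?_
      simp [Matrix.add_mul, Matrix.mul_add]; ring)
    (fun t q r => by
      simp only [Finset.smul_sum]
      refine Finset.sum_congr rfl fun a _ => Finset.sum_congr rfl fun b _ =>
        Finset.sum_congr rfl fun e _ => ?_
      simp [mul_sub])
    (fun q q' r => by
      simp only [← Finset.sum_add_distrib]
      refine Finset.sum_congr rfl fun a _ => Finset.sum_congr rfl fun b _ =>
        Finset.sum_congr rfl fun e _ => ?_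
      simp [Matrix.add_mul, Matrix.mul_add]; ring)
    (fun t q r => by
      simp only [Finset.smul_sum]
      refine Finset.sum_congr rfl fun a _ => Finset.sum_congr rfl fun b _ =>
        Finset.sum_congr rfl fun e _ => ?_
      simp [mul_sub])

theorem sympl_apply (q q' : RepSpace v (0 : I → ℕ)) : sympl v q q' = ∑ a, ∑ b, ∑ e : a ⟶ b,
      ((q.1.1 a b e * q'.2.1 a b e).trace - (q'.1.1 a b e * q.2.1 a b e).trace) := rfl

theorem sympl_swap (q q' : RepSpace v (0 : I → ℕ)) : sympl v q q' = - sympl v q' q := by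
  simp only [sympl_apply, ← Finset.sum_neg_distrib, neg_sub]

theorem sympl_separating {q : RepSpace v (0 : I → ℕ)} (h : ∀ q', sympl v q q' = 0) : q = 0 := by
  apply eq_zero_of_dot_self
  rw [← h (-daggerBar q.2, dagger q.1), sympl_apply, dot_eq]
  have h0 : ∀ k, ((q.2.2 k)ᴴ * q.2.2 k).trace = 0 := fun k => by
    have : q.2.2 k = 0 := by ext i; exact i.elim0
    simp [this]
  have h0' : ∀ k, ((q.1.2 k)ᴴ * q.1.2 k).trace = 0 := fun k => by
    have : q.1.2 k = 0 := by ext i j; exact j.elim0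
    simp [this]
  simp only [h0, h0', Finset.sum_const_zero, add_zero, zero_add, ← Finset.sum_add_distrib]
  refine Finset.sum_congr rfl fun a _ => Finset.sum_congr rfl fun b _ =>
    Finset.sum_congr rfl fun e _ => ?_
  simp only [dagger, daggerBar, Prod.fst_neg, Pi.neg_apply, Matrix.neg_mul, Matrix.trace_neg,
    sub_neg_eq_add, Matrix.trace_mul_comm (q.1.1 a b e)]

theorem sympl_nondegenerate (v : I → ℕ) : (sympl v).Nondegenerate :=
  ⟨fun _ h => sympl_separating h, fun _ h => sympl_separating fun q' => by
    rw [sympl_swap, h, neg_zero]⟩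

/-- The value is `∑ tr([X_k, Y_k] μ_ℂ(m)_k)`, and the trace of a commutator against a scalar matrix
vanishes. -/
theorem sympl_lact_lact {c : I → ℝ} {m : RepSpace v (0 : I → ℕ)} (hm : muC m = twoC v c)
    (X Y : LieC v) : sympl v (lact X m) (lact Y m) = 0 := by
  have key : ∀ (a b : I) (e : a ⟶ b),
      (((lact X m).1.1 a b e * (lact Y m).2.1 a b e).trace -
        ((lact Y m).1.1 a b e * (lact X m).2.1 a b e).trace) =
      ((X b * Y b - Y b * X b) * (m.1.1 a b e * m.2.1 a b e)).trace -
        ((X a * Y a - Y a * X a) * (m.2.1 a b e * m.1.1 a b e)).trace := by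
    intro a b e
    simp only [lact]
    generalize m.1.1 a b e = x
    generalize m.2.1 a b e = y
    have c1 : ∀ Z : Matrix (Fin (v b)) (Fin (v b)) ℂ, ∀ Z' : Matrix (Fin (v b)) (Fin (v b)) ℂ,
        (Z * (x * (y * Z'))).trace = (Z' * (Z * (x * y))).trace := fun Z Z' => by
      rw [Matrix.trace_mul_comm Z']; simp only [Matrix.mul_assoc]
    have c2 : ∀ Z : Matrix (Fin (v a)) (Fin (v a)) ℂ, ∀ Z' : Matrix (Fin (v a)) (Fin (v a)) ℂ,
        (x * (Z * (Z' * y))).trace = (Z * (Z' * (y * x))).trace := fun Z Z' => by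
      rw [Matrix.trace_mul_comm x]; simp only [Matrix.mul_assoc]
    have c3 : ∀ Z : Matrix (Fin (v a)) (Fin (v a)) ℂ, ∀ Z' : Matrix (Fin (v b)) (Fin (v b)) ℂ,
        (x * (Z * (y * Z'))).trace = (Z' * (x * (Z * y))).trace := fun Z Z' => by
      rw [Matrix.trace_mul_comm Z']; simp only [Matrix.mul_assoc]
    simp only [Matrix.mul_sub, Matrix.sub_mul, Matrix.trace_sub, Matrix.mul_assoc, c1, c2, c3]
    ring
  have h2 : sympl v (lact X m) (lact Y m) =
      ∑ k, ((X k * Y k - Y k * X k) * muC m k).trace := by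
    rw [sympl_apply]
    simp only [key]
    have hij : ∀ k, m.1.2 k * m.2.2 k = 0 := fun k => by
      ext i j; simp [Matrix.mul_apply]
    simp only [muC, hij, add_zero, Finset.sum_sub_distrib, Matrix.mul_sub, Matrix.trace_sub,
      Matrix.mul_sum, Matrix.trace_sum]
    rw [sum_in_eq fun a b e => ((X b * Y b - Y b * X b) * (m.1.1 a b e * m.2.1 a b e)).trace]
  rw [h2, hm]
  refine Finset.sum_eq_zero fun k _ => ?_
  simp [twoC, Matrix.trace_mul_comm (X k)]

/-- A family of subspaces preserved by all arrows of the double quiver. -/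
def IsSubrep (m : RepSpace v w) (U : (k : I) → Submodule ℂ (Fin (v k) → ℂ)) : Prop :=
  (∀ a b (e : a ⟶ b), ∀ x ∈ U a, m.1.1 a b e *ᵥ x ∈ U b) ∧
    ∀ a b (e : a ⟶ b), ∀ x ∈ U b, m.2.1 a b e *ᵥ x ∈ U a

/-- A representation without proper nonzero subrepresentation. -/
def IsSimpleRep (m : RepSpace v w) : Prop :=
  ∀ U, IsSubrep m U → (∀ k, U k = ⊥) ∨ ∀ k, U k = ⊤

/-- Schur's lemma: for an eigenvalue `t` of one component, the kernels of `X k - t` form a nonzero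
subrepresentation. -/
theorem IsSimpleRep.eq_smul_one {m : RepSpace v (0 : I → ℕ)} (hm : IsSimpleRep m) (hv : v ≠ 0)
    {X : LieC v} (hX : lact X m = 0) : ∃ t : ℂ, X = t • (1 : LieC v) := by
  obtain ⟨k₀, hk₀⟩ := Function.ne_iff.1 hv
  have : Nonempty (Fin (v k₀)) := ⟨⟨0, Nat.pos_of_ne_zero hk₀⟩⟩
  obtain ⟨t, ht⟩ := Module.End.exists_eigenvalue (Matrix.toLin' (X k₀))
  obtain ⟨x, hx⟩ := ht.exists_hasEigenvector
  refine ⟨t, ?_⟩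
  have hU : IsSubrep m fun k => LinearMap.ker (Matrix.toLin' (X k - t • 1)) := by
    constructor
    · intro a b e x hx
      have h : X b * m.1.1 a b e = m.1.1 a b e * X a :=
        sub_eq_zero.1 (congrFun (congrFun (congrFun (congrArg (fun q => q.1.1) hX) a) b) e)
      simp only [LinearMap.mem_ker, Matrix.toLin'_apply, Matrix.sub_mulVec, Matrix.smul_mulVec,
        Matrix.one_mulVec, sub_eq_zero] at hx ⊢
      rw [Matrix.mulVec_mulVec, h, ← Matrix.mulVec_mulVec, hx, Matrix.mulVec_smul]
    · intro a b e x hx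
      have h : X a * m.2.1 a b e = m.2.1 a b e * X b :=
        sub_eq_zero.1 (congrFun (congrFun (congrFun (congrArg (fun q => q.2.1) hX) a) b) e)
      simp only [LinearMap.mem_ker, Matrix.toLin'_apply, Matrix.sub_mulVec, Matrix.smul_mulVec,
        Matrix.one_mulVec, sub_eq_zero] at hx ⊢
      rw [Matrix.mulVec_mulVec, h, ← Matrix.mulVec_mulVec, hx, Matrix.mulVec_smul]
  rcases hm _ hU with h | h
  · exfalso
    have h1 : x ∈ LinearMap.ker (Matrix.toLin' (X k₀ - t • 1)) := by
      have := hx.apply_eq_smul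
      simpa [Matrix.sub_mulVec, Matrix.smul_mulVec, sub_eq_zero] using this
    rw [h k₀] at h1
    exact hx.2 (by simpa using h1)
  · funext k
    have h1 := LinearMap.ker_eq_top.1 (h k)
    have h2 : X k - t • 1 = 0 := Matrix.toLin'.injective (by rw [h1, map_zero])
    exact sub_eq_zero.1 h2

/-- The tangent space of the orbit is isotropic, so it has at most half the dimension. -/
theorem two_mul_finrank_le {c : I → ℝ} {m : RepSpace v (0 : I → ℕ)} (hm : muC m = twoC v c) :
    2 * Module.finrank ℂ (LinearMap.range (lactL m)) ≤
      Module.finrank ℂ (RepSpace v (0 : I → ℕ)) := by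
  have h1 : LinearMap.range (lactL m) ≤ (sympl v).orthogonal (LinearMap.range (lactL m)) := by
    rintro _ ⟨X, rfl⟩ _ ⟨Y, rfl⟩
    exact sympl_lact_lact hm Y X
  have h2 := Submodule.finrank_mono h1
  have h3 := LinearMap.BilinForm.finrank_orthogonal (sympl_nondegenerate v)
    (LinearMap.range (lactL m))
  have h4 := Submodule.finrank_le (LinearMap.range (lactL m))
  omega

/-- The stabiliser is at most a line, so the orbit has dimension at least `∑ v_k ^ 2 - 1`. Isotropy
bounds twice this by the dimension of `M`, and the Tits form is `2 ∑ v_k ^ 2` minus that dimension.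
-/
theorem cartan_le_two [DecidableEq I] {c : I → ℝ} {m : RepSpace v (0 : I → ℕ)}
    (hm : muC m = twoC v c) (hs : IsSimpleRep m) (hv : v ≠ 0) :
    (fun k => (v k : ℤ)) ⬝ᵥ (cartan I *ᵥ fun k => (v k : ℤ)) ≤ 2 := by
  have h1 := two_mul_finrank_le hm
  have h2 := LinearMap.finrank_range_add_finrank_ker (lactL m)
  have h3 : Module.finrank ℂ (LinearMap.ker (lactL m)) ≤ 1 := by
    refine (Submodule.finrank_mono (t := ℂ ∙ (1 : LieC v)) ?_).trans
      ((finrank_span_le_card _).trans (by simp))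
    intro X hX
    obtain ⟨t, rfl⟩ := hs.eq_smul_one hv (X := X) hX
    exact Submodule.smul_mem _ _ (Submodule.mem_span_singleton_self _)
  have h4 : Module.finrank ℂ (LieC v) = ∑ k, v k * v k := by
    simp [LieC, Module.finrank_pi_fintype, Module.finrank_matrix]
  have h5 : Module.finrank ℂ (RepSpace v (0 : I → ℕ)) =
      (∑ a, ∑ b, Fintype.card (a ⟶ b) * (v b * v a)) +
        ∑ a, ∑ b, Fintype.card (a ⟶ b) * (v a * v b) := by
    simp [Module.finrank_prod, Module.finrank_pi_fintype, Module.finrank_matrix]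
  have h6 : (fun k => (v k : ℤ)) ⬝ᵥ (cartan I *ᵥ fun k => (v k : ℤ)) =
      2 * (∑ k, (v k : ℤ) * v k) - ((∑ a, ∑ b, (Fintype.card (a ⟶ b) : ℤ) * (v b * v a)) +
        ∑ a, ∑ b, (Fintype.card (a ⟶ b) : ℤ) * (v a * v b)) := by
    have h7 : ∑ a, ∑ b, (Fintype.card (a ⟶ b) : ℤ) * (v a * v b) =
        ∑ a, ∑ b, (Fintype.card (b ⟶ a) : ℤ) * (v a * v b) := by
      rw [Finset.sum_comm]
      exact Finset.sum_congr rfl fun a _ => Finset.sum_congr rfl fun b _ => by ring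
    rw [h7]
    simp only [dotProduct, Matrix.mulVec, cartan, sub_mul, Finset.sum_sub_distrib, ite_mul,
      zero_mul, Finset.sum_ite_eq, Finset.mem_univ, if_true, mul_sub, Finset.mul_sum]
    rw [sub_sub]
    congr 1
    · exact Finset.sum_congr rfl fun a _ => by ring
    · congr 1 <;>
        exact Finset.sum_congr rfl fun a _ => Finset.sum_congr rfl fun b _ => by ring
  rw [h6]
  have h7 : 2 * (∑ k, v k * v k) ≤ 2 + ((∑ a, ∑ b, Fintype.card (a ⟶ b) * (v b * v a)) +
        ∑ a, ∑ b, Fintype.card (a ⟶ b) * (v a * v b)) := by omega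
  have h8 : (2 : ℤ) * (∑ k, (v k : ℤ) * v k) ≤ 2 +
      ((∑ a, ∑ b, (Fintype.card (a ⟶ b) : ℤ) * (v b * v a)) +
        ∑ a, ∑ b, (Fintype.card (a ⟶ b) : ℤ) * (v a * v b)) := by exact_mod_cast h7
  linarith

/-- Without framing, `μ_ℂ` is a sum of terms `xy - yx`, whose total trace is zero. -/
theorem sum_charPair_eq_zero {c : I → ℝ} {m : RepSpace v (0 : I → ℕ)} (hm : muC m = twoC v c) :
    ∑ k, c k * (v k : ℝ) = 0 := by
  have h1 : ∑ k, (muC m k).trace = 0 := by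
    have hij : ∀ k, m.1.2 k * m.2.2 k = 0 := fun k => by
      ext i j; simp [Matrix.mul_apply]
    simp only [muC, hij, add_zero, Matrix.trace_sub, Matrix.trace_sum, Finset.sum_sub_distrib]
    rw [sum_in_eq fun a b e => (m.1.1 a b e * m.2.1 a b e).trace, sub_eq_zero]
    exact Finset.sum_congr rfl fun a _ => Finset.sum_congr rfl fun b _ =>
      Finset.sum_congr rfl fun e _ => Matrix.trace_mul_comm _ _
  rw [hm] at h1
  have h2 : ∀ k, (twoC v c k).trace = ((2 * (c k * (v k : ℝ)) : ℝ) : ℂ) := fun k => by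
    simp [twoC]; ring
  simp only [h2] at h1
  have h3 : ∑ k, 2 * (c k * (v k : ℝ)) = 0 := by exact_mod_cast h1
  rw [← Finset.mul_sum] at h3
  linarith

/-- Without framing, `μ_ℂ` is built from compositions of arrows only, so it restricts to an
invariant family of subspaces and keeps its scalar value. -/
theorem exists_restrict {c : I → ℝ} {m : RepSpace v (0 : I → ℕ)} (hm : muC m = twoC v c)
    {U : (k : I) → Submodule ℂ (Fin (v k) → ℂ)} (hU : IsSubrep m U) :
    ∃ m' : RepSpace (fun k => Module.finrank ℂ (U k)) (0 : I → ℕ), muC m' = twoC _ c := by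
  -- A basis of `U k` gives an inclusion `ι` with left inverse `π`; `ι π` is the identity on maps
  -- with values in `U k`.
  have h1 : ∀ k, ∃ (ι : Matrix (Fin (v k)) (Fin (Module.finrank ℂ (U k))) ℂ)
      (π : Matrix (Fin (Module.finrank ℂ (U k))) (Fin (v k)) ℂ), π * ι = 1 ∧
      (∀ x, ι *ᵥ x ∈ U k) ∧ ∀ (n : ℕ) (M : Matrix (Fin (v k)) (Fin n) ℂ),
        (∀ x, M *ᵥ x ∈ U k) → ι * (π * M) = M := by
    intro k
    let b := Module.finBasis ℂ (U k)
    let f : (Fin (Module.finrank ℂ (U k)) → ℂ) →ₗ[ℂ] (Fin (v k) → ℂ) :=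
      (U k).subtype ∘ₗ b.equivFun.symm.toLinearMap
    have hf : LinearMap.ker f = ⊥ := by
      rw [LinearMap.ker_eq_bot]
      exact (Subtype.val_injective).comp b.equivFun.symm.injective
    obtain ⟨g, hg⟩ := f.exists_leftInverse_of_injective hf
    have hfg : ∀ x ∈ U k, f (g x) = x := by
      intro x hx
      have : x = f (b.equivFun ⟨x, hx⟩) := by simp [f]
      rw [this, ← LinearMap.comp_apply g f, hg, LinearMap.id_apply]
    refine ⟨LinearMap.toMatrix' f, LinearMap.toMatrix' g, ?_, ?_, ?_⟩
    · rw [← LinearMap.toMatrix'_comp, hg, LinearMap.toMatrix'_id]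
    · intro x
      rw [LinearMap.toMatrix'_mulVec]
      exact (b.equivFun.symm x).2
    · intro n M hM
      apply Matrix.toLin'.injective
      refine LinearMap.ext fun x => ?_
      simp only [Matrix.toLin'_mul, Matrix.toLin'_toMatrix', LinearMap.comp_apply]
      exact hfg _ (hM _)
  choose ι π hπι hιU hM using h1
  refine ⟨((fun a b e => π b * (m.1.1 a b e * ι a), 0),
    (fun a b e => π a * (m.2.1 a b e * ι b), 0)), ?_⟩
  have hx : ∀ a b (e : a ⟶ b), ι b * (π b * (m.1.1 a b e * ι a)) = m.1.1 a b e * ι a :=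
    fun a b e => hM _ _ _ fun x => by
      rw [← Matrix.mulVec_mulVec]; exact hU.1 a b e _ (hιU a x)
  have hy : ∀ a b (e : a ⟶ b), ι a * (π a * (m.2.1 a b e * ι b)) = m.2.1 a b e * ι b :=
    fun a b e => hM _ _ _ fun x => by
      rw [← Matrix.mulVec_mulVec]; exact hU.2 a b e _ (hιU b x)
  funext k
  have h2 : π k * (muC m k * ι k) = twoC (fun k => Module.finrank ℂ (U k)) c k := by
    rw [hm]; simp [twoC, hπι]
  have hij : m.1.2 k * m.2.2 k = 0 := by ext i j; simp [Matrix.mul_apply]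
  rw [← h2]
  simp only [muC, Matrix.mul_assoc, hx, hy, hij, add_zero, Matrix.sub_mul, Matrix.mul_sub,
    Matrix.sum_mul, Matrix.mul_sum]
  exact (congrArg _ (Matrix.zero_mul _)).trans (add_zero _)

theorem IsGeneric.mono [DecidableEq I] {c : I → ℝ} (hc : IsGeneric v c) {θ : I → ℕ}
    (h : ∀ k, θ k ≤ v k) : IsGeneric θ c :=
  fun θ' h1 h2 h3 => hc θ' h1 h2 fun k => (h3 k).trans (h k)

/-- Induction on the total dimension. A simple representation violates genericity by the Tits form
bound and the trace identity. Otherwise a proper nonzero subrepresentation has smaller dimension and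
the same moment value, which the induction excludes. -/
theorem eq_zero_of_muC_eq_twoC [DecidableEq I] {c : I → ℝ} :
    ∀ (n : ℕ) (v : I → ℕ), ∑ k, v k = n → IsGeneric v c →
      ∀ m : RepSpace v (0 : I → ℕ), muC m = twoC v c → v = 0 := by
  intro n
  induction n using Nat.strong_induction_on with
  | _ n ih =>
    intro v hn hc m hm
    by_contra hv
    by_cases hs : IsSimpleRep m
    · exact hc v hv (cartan_le_two hm hs hv) (fun _ => le_rfl) (sum_charPair_eq_zero hm)
    · simp only [IsSimpleRep, not_forall, not_or] at hs
      obtain ⟨U, hU, ⟨k₁, hk₁⟩, ⟨k₂, hk₂⟩⟩ := hs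
      obtain ⟨m', hm'⟩ := exists_restrict hm hU
      have hle : ∀ k, Module.finrank ℂ (U k) ≤ v k := fun k => by
        simpa using Submodule.finrank_le (U k)
      have hlt : Module.finrank ℂ (U k₂) < v k₂ := by
        simpa using Submodule.finrank_lt hk₂
      have h0 := ih (∑ k, Module.finrank ℂ (U k))
        (hn ▸ Finset.sum_lt_sum (fun k _ => hle k) ⟨k₂, Finset.mem_univ _, hlt⟩)
        _ rfl (hc.mono hle) m' hm'
      exact hk₁ (Submodule.finrank_eq_zero.1 (congrFun h0 k₁))

end Simple

/-! ### Numerical stability from genericity -/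

section Stability

variable {I : Type*} [Fintype I] [Quiver I] [∀ a b : I, Fintype (a ⟶ b)] {v w : I → ℕ}

/-- The numerical stability condition of `m` for the character `c`: the Kempf-Ness function of `m`
tends to infinity along every geodesic ray. -/
def StabAt (c : I → ℝ) (m : RepSpace v w) : Prop :=
  ∀ V : GaugeC v, IsUnitaryGauge V → ∀ l : (k : I) → Fin (v k) → ℝ,
    (∀ s, 0 < wt l s → entry (act V m) s = 0) → 0 ≤ charPair c l → l = 0

/-- By the vanishing products, two-step paths from `S` to `S` through the complement or the framing
do not contribute, so the `S`-blocks form an unframed point with the same `μ_ℂ`. Asking this only of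
products covers both the top and the bottom weight space. -/
theorem eq_empty_of_splitting [DecidableEq I] {c : I → ℝ} (hc : IsGeneric v c)
    {m : RepSpace v w} (hm : muC m = twoC v c) (S : (k : I) → Finset (Fin (v k)))
    (h₁ : ∀ a b (e : a ⟶ b), ∀ i ∈ S b, ∀ j ∈ S b, ∀ l ∉ S a,
      m.1.1 a b e i l * m.2.1 a b e l j = 0)
    (h₂ : ∀ a b (e : a ⟶ b), ∀ i ∈ S a, ∀ j ∈ S a, ∀ l ∉ S b,
      m.2.1 a b e i l * m.1.1 a b e l j = 0)
    (h₃ : ∀ k, ∀ i ∈ S k, ∀ j ∈ S k, ∀ l, m.1.2 k i l * m.2.2 k l j = 0) :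
    ∀ k, S k = ∅ := by
  let f : (k : I) → Fin (S k).card → Fin (v k) := fun k t => ((S k).equivFin.symm t).1
  have hf : ∀ k t, f k t ∈ S k := fun k t => ((S k).equivFin.symm t).2
  have hinj : ∀ k, Function.Injective (f k) := fun k =>
    Subtype.val_injective.comp (S k).equivFin.symm.injective
  have hsum : ∀ k (F : Fin (v k) → ℂ), (∀ l ∉ S k, F l = 0) → ∑ l, F l = ∑ t, F (f k t) := by
    intro k F hF
    rw [← Finset.sum_subset (Finset.subset_univ (S k)) fun l _ hl => hF l hl,
      ← Finset.sum_coe_sort, ← Equiv.sum_comp (S k).equivFin.symm]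
  let m' : RepSpace (fun k => (S k).card) (0 : I → ℕ) :=
    ((fun a b e => (m.1.1 a b e).submatrix (f b) (f a), 0),
      (fun a b e => (m.2.1 a b e).submatrix (f a) (f b), 0))
  have hm' : muC m' = twoC _ c := by
    funext k
    ext i j
    have hk : (twoC (fun k => (S k).card) c k) i j = muC m k (f k i) (f k j) := by
      rw [hm]
      simp [twoC, Matrix.one_apply, (hinj k).eq_iff]
    rw [hk]
    simp only [muC, Matrix.add_apply, Matrix.sub_apply, Matrix.sum_apply, Matrix.mul_apply]
    congr 1
    · congr 1
      · refine Finset.sum_congr rfl fun a _ => Finset.sum_congr rfl fun e _ => ?_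
        exact (hsum a _ fun l hl => h₁ a k e _ (hf k i) _ (hf k j) l hl).symm
      · refine Finset.sum_congr rfl fun b _ => Finset.sum_congr rfl fun e _ => ?_
        exact (hsum b _ fun l hl => h₂ k b e _ (hf k i) _ (hf k j) l hl).symm
    · rw [Finset.sum_eq_zero fun l _ => h₃ k _ (hf k i) _ (hf k j) l]
      exact Finset.sum_eq_zero fun l _ => l.elim0
  have h0 := eq_zero_of_muC_eq_twoC _ (fun k => (S k).card) rfl
    (hc.mono fun k => by simpa using (S k).card_le_univ) m' hm'
  exact fun k => Finset.card_eq_zero.1 (congrFun h0 k)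

/-- An extreme nonzero weight space would split off an unframed point, which genericity forbids. -/
theorem weight_eq_zero [DecidableEq I] {c : I → ℝ} (hc : IsGeneric v c)
    {m : RepSpace v w} (hm : muC m = twoC v c) (l : (k : I) → Fin (v k) → ℝ)
    (hl : ∀ s, 0 < wt l s → entry m s = 0) : l = 0 := by
  classical
  have hx : ∀ a b (e : a ⟶ b) i j, l a j < l b i → m.1.1 a b e i j = 0 :=
    fun a b e i j h => hl (.inl ⟨a, b, e, i, j⟩) (by simpa [wt] using h)
  have hy : ∀ a b (e : a ⟶ b) i j, l b j < l a i → m.2.1 a b e i j = 0 :=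
    fun a b e i j h => hl (.inr (.inr (.inl ⟨a, b, e, i, j⟩))) (by simpa [wt] using h)
  have hi : ∀ k i j, 0 < l k i → m.1.2 k i j = 0 :=
    fun k i j h => hl (.inr (.inl ⟨k, i, j⟩)) (by simpa [wt] using h)
  have hj : ∀ k i j, l k j < 0 → m.2.2 k i j = 0 :=
    fun k i j h => hl (.inr (.inr (.inr ⟨k, i, j⟩))) (by simpa [wt] using h)
  by_contra hne
  obtain ⟨k₀, hk₀⟩ := Function.ne_iff.1 hne
  obtain ⟨i₀, hi₀⟩ := Function.ne_iff.1 hk₀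
  have : Nonempty (Σ k : I, Fin (v k)) := ⟨⟨k₀, i₀⟩⟩
  obtain ⟨⟨k₁, i₁⟩, h₁⟩ := Finite.exists_max fun x : Σ k : I, Fin (v k) => l x.1 x.2
  obtain ⟨⟨k₂, i₂⟩, h₂⟩ := Finite.exists_min fun x : Σ k : I, Fin (v k) => l x.1 x.2
  -- If the maximum is positive, use the top weight space, on which `i` vanishes. Otherwise the
  -- minimum is negative because `l ≠ 0`, and `j` vanishes on the bottom weight space.
  by_cases hpos : 0 < l k₁ i₁
  · have := eq_empty_of_splitting hc hm (fun k => Finset.univ.filter fun i => l k i = l k₁ i₁)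
      (fun a b e i hi' j _ x hx' => ?_) (fun a b e i hi' j _ x hx' => ?_)
      (fun k i hi' j _ x => ?_) k₁
    · exact Finset.notMem_empty i₁ (this ▸ by simp)
    · have h3 := h₁ ⟨a, x⟩
      simp only [Finset.mem_filter, Finset.mem_univ, true_and] at hi' hx'
      rw [hx a b e i x (hi' ▸ lt_of_le_of_ne h3 hx'), zero_mul]
    · have h3 := h₁ ⟨b, x⟩
      simp only [Finset.mem_filter, Finset.mem_univ, true_and] at hi' hx'
      rw [hy a b e i x (hi' ▸ lt_of_le_of_ne h3 hx'), zero_mul]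
    · simp only [Finset.mem_filter, Finset.mem_univ, true_and] at hi'
      rw [hi k i x (hi' ▸ hpos), zero_mul]
  · have hneg : l k₂ i₂ < 0 := by
      have h3 := h₁ ⟨k₀, i₀⟩
      have h4 := h₂ ⟨k₀, i₀⟩
      simp only at h3 h4
      refine lt_of_le_of_lt h4 (lt_of_le_of_ne (h3.trans (not_lt.1 hpos)) hi₀)
    have := eq_empty_of_splitting hc hm (fun k => Finset.univ.filter fun i => l k i = l k₂ i₂)
      (fun a b e i _ j hj' x hx' => ?_) (fun a b e i _ j hj' x hx' => ?_)
      (fun k i _ j hj' x => ?_) k₂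
    · exact Finset.notMem_empty i₂ (this ▸ by simp)
    · have h3 := h₂ ⟨a, x⟩
      simp only [Finset.mem_filter, Finset.mem_univ, true_and] at hj' hx'
      rw [hy a b e x j (hj' ▸ lt_of_le_of_ne h3 (Ne.symm hx')), mul_zero]
    · have h3 := h₂ ⟨b, x⟩
      simp only [Finset.mem_filter, Finset.mem_univ, true_and] at hj' hx'
      rw [hx a b e x j (hj' ▸ lt_of_le_of_ne h3 (Ne.symm hx')), mul_zero]
    · simp only [Finset.mem_filter, Finset.mem_univ, true_and] at hj'
      rw [hj k x j (hj' ▸ hneg), mul_zero]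

theorem stabAt_of_muC [DecidableEq I] {c : I → ℝ} (hc : IsGeneric v c)
    {m : RepSpace v w} (hm : muC m = twoC v c) (c' : I → ℝ) : StabAt c' m :=
  fun V _ l hl _ => weight_eq_zero hc (muC_act_eq_twoC V hm) l hl

/-- Adjoint entries have opposite weight, so a point supported in weight zero stays so under the
rotation with `ξ = 1`, which lands in the complex level. -/
theorem weight_eq_zero_of_level [DecidableEq I] {c : I → ℝ} (hc : IsGeneric v c)
    {p : RepSpace v w} (hp : p ∈ level w (central v c) 0) (l : (k : I) → Fin (v k) → ℝ)
    (hl : ∀ s, wt l s ≠ 0 → entry p s = 0) : l = 0 := by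
  refine weight_eq_zero hc (muC_hkRotate_one hp) l fun s hs => ?_
  rcases s with ⟨a, b, e, i, j⟩ | ⟨k, i, j⟩ | ⟨a, b, e, i, j⟩ | ⟨k, i, j⟩
  · have h1 := hl (.inl ⟨a, b, e, i, j⟩) hs.ne'
    have h2 := hl (.inr (.inr (.inl ⟨a, b, e, j, i⟩))) (by simp [wt] at hs ⊢; linarith)
    simp only [entry] at h1 h2
    simp [entry, hkRotate, daggerBar, h1, h2]
  · have h1 := hl (.inr (.inl ⟨k, i, j⟩)) hs.ne'
    have h2 := hl (.inr (.inr (.inr ⟨k, j, i⟩))) (by simp [wt] at hs ⊢; linarith)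
    simp only [entry] at h1 h2
    simp [entry, hkRotate, daggerBar, h1, h2]
  · have h1 := hl (.inr (.inr (.inl ⟨a, b, e, i, j⟩))) hs.ne'
    have h2 := hl (.inl ⟨a, b, e, j, i⟩) (by simp [wt] at hs ⊢; linarith)
    simp only [entry] at h1 h2
    simp [entry, hkRotate, dagger, h1, h2]
  · have h1 := hl (.inr (.inr (.inr ⟨k, i, j⟩))) hs.ne'
    have h2 := hl (.inr (.inl ⟨k, j, i⟩)) (by simp [wt] at hs ⊢; linarith)
    simp only [entry] at h1 h2
    simp [entry, hkRotate, dagger, h1, h2]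

/-- The weighted sum of squares equals `2 * charPair c l ≥ 0` while no term is positive; hence all
terms vanish and the support has weight zero. -/
theorem stabAt_of_level [DecidableEq I] {c : I → ℝ} (hc : IsGeneric v c)
    {p : RepSpace v w} (hp : p ∈ level w (central v c) 0) : StabAt c p := by
  intro V hV l hl hpos
  have hp' := act_mem_level hV hp
  have h1 := sum_wt_mul_normSq ((mem_level_iff c _).1 hp').1 l
  refine weight_eq_zero_of_level hc hp' l fun s hs => ?_
  have h2 : ∀ s ∈ Finset.univ, wt l s * ‖entry (act V p) s‖ ^ 2 ≤ 0 := fun s _ => by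
    rcases lt_or_ge 0 (wt l s) with h | h
    · simp [hl s h]
    · exact mul_nonpos_of_nonpos_of_nonneg h (by positivity)
  have h3 := (Finset.sum_eq_zero_iff_of_nonpos h2).1
    (le_antisymm (Finset.sum_nonpos h2) (by rw [h1]; linarith)) s (Finset.mem_univ s)
  simpa [hs] using h3

theorem StabAt.scale {c : I → ℝ} {m : RepSpace v w} (hm : StabAt c m) {t : ℂ} (ht : t ≠ 0) :
    StabAt c (scale t m) := by
  intro V hV l hl hpos
  refine hm V hV l (fun s hs => ?_) hpos
  have := hl s hs
  rw [act_scale, entry_scale] at this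
  exact (mul_eq_zero.1 this).resolve_left (zpow_ne_zero _ ht)

end Stability

/-! ### Polar decomposition of invertible matrices -/

section Polar

theorem exists_unitary_diagonal {n : ℕ} {A : Matrix (Fin n) (Fin n) ℂ} (hA : A.IsHermitian) :
    ∃ (U : Matrix (Fin n) (Fin n) ℂ) (d : Fin n → ℝ), U ∈ Matrix.unitaryGroup (Fin n) ℂ ∧
      A = U * Matrix.diagonal (fun i => (d i : ℂ)) * Uᴴ ∧ d = hA.eigenvalues :=
  ⟨hA.eigenvectorUnitary, hA.eigenvalues, hA.eigenvectorUnitary.2, by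
    conv_lhs => rw [hA.spectral_theorem, Unitary.conjStarAlgAut_apply]
    rfl, rfl⟩

-- Diagonalise `g† g = U diag(d) U†` and take `l = (log d) / 2`; then `g U diag(exp (-l))` is
-- unitary.
open scoped ComplexOrder in
theorem GL_eq_unitary_mul_diagonal_mul_unitary {n : ℕ} (g : GL (Fin n) ℂ) :
    ∃ (U₁ U₂ : Matrix (Fin n) (Fin n) ℂ) (l : Fin n → ℝ), U₁ ∈ Matrix.unitaryGroup (Fin n) ℂ ∧
      U₂ ∈ Matrix.unitaryGroup (Fin n) ℂ ∧
      g.1 = U₁ * Matrix.diagonal (fun i => Complex.exp (l i : ℂ)) * U₂ := by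
  have hinj : Function.Injective g.1.mulVec :=
    Matrix.mulVec_injective_of_isUnit g.isUnit
  have hpd : (g.1ᴴ * g.1).PosDef := Matrix.PosDef.conjTranspose_mul_self g.1 hinj
  obtain ⟨U, d, hU, hA, hd⟩ := exists_unitary_diagonal hpd.1
  have hpos : ∀ i, 0 < d i := fun i => hd ▸ hpd.eigenvalues_pos i
  have hU1 : Uᴴ * U = 1 := Matrix.mem_unitaryGroup_iff'.1 hU
  have hU2 : U * Uᴴ = 1 := Matrix.mem_unitaryGroup_iff.1 hU
  have hexp : ∀ i, Complex.exp ((Real.log (d i) / 2 : ℝ) : ℂ) *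
      Complex.exp ((Real.log (d i) / 2 : ℝ) : ℂ) = (d i : ℂ) := fun i => by
    rw [← Complex.exp_add, ← Complex.ofReal_add, add_halves, ← Complex.ofReal_exp,
      Real.exp_log (hpos i)]
  refine ⟨g.1 * U * Matrix.diagonal fun i => (Complex.exp ((Real.log (d i) / 2 : ℝ) : ℂ))⁻¹, Uᴴ,
    fun i => Real.log (d i) / 2, ?_, Unitary.star_mem hU, ?_⟩
  · rw [Matrix.mem_unitaryGroup_iff', Matrix.star_eq_conjTranspose, Matrix.conjTranspose_mul,
      Matrix.conjTranspose_mul, Matrix.diagonal_conjTranspose]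
    have h1 : Uᴴ * (g.1ᴴ * g.1) * U = Matrix.diagonal fun i => (d i : ℂ) := by
      rw [hA]
      calc Uᴴ * (U * Matrix.diagonal (fun i => (d i : ℂ)) * Uᴴ) * U
          = (Uᴴ * U) * Matrix.diagonal (fun i => (d i : ℂ)) * (Uᴴ * U) := by
            simp only [Matrix.mul_assoc]
        _ = _ := by rw [hU1, Matrix.one_mul, Matrix.mul_one]
    set E : Matrix (Fin n) (Fin n) ℂ :=
      Matrix.diagonal fun i => (Complex.exp ((Real.log (d i) / 2 : ℝ) : ℂ))⁻¹ with hE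
    set E' : Matrix (Fin n) (Fin n) ℂ :=
      Matrix.diagonal (star fun i => (Complex.exp ((Real.log (d i) / 2 : ℝ) : ℂ))⁻¹) with hE'
    calc E' * (Uᴴ * g.1ᴴ) * (g.1 * U * E) = E' * (Uᴴ * (g.1ᴴ * g.1) * U) * E := by
          simp only [Matrix.mul_assoc]
      _ = 1 := by
          rw [h1, hE, hE', Matrix.diagonal_mul_diagonal, Matrix.diagonal_mul_diagonal,
            ← Matrix.diagonal_one]
          congr 1
          funext i
          have h2 := hexp i
          have h3 := Complex.exp_ne_zero ((Real.log (d i) / 2 : ℝ) : ℂ)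
          have h4 : (starRingEnd ℂ) (Complex.exp ((Real.log (d i) / 2 : ℝ) : ℂ)) =
              Complex.exp ((Real.log (d i) / 2 : ℝ) : ℂ) := by
            rw [← Complex.exp_conj, Complex.conj_ofReal]
          simp only [Pi.star_apply, star_inv₀, Complex.star_def, h4, ← h2]
          field_simp
  · rw [Matrix.mul_assoc _ (Matrix.diagonal _) (Matrix.diagonal _), Matrix.diagonal_mul_diagonal]
    simp only [inv_mul_cancel₀ (Complex.exp_ne_zero _)]
    rw [Matrix.diagonal_one, Matrix.mul_one, Matrix.mul_assoc, hU2, Matrix.mul_one]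

end Polar

/-! ### The Kempf-Ness function and its properness -/

section KempfNess

variable {I : Type*} [Fintype I] [Quiver I] [∀ a b : I, Fintype (a ⟶ b)] {v w : I → ℕ}

theorem exists_polar (g : GaugeC v) : ∃ (u₁ u₂ : GaugeC v) (l : (k : I) → Fin (v k) → ℝ),
    IsUnitaryGauge u₁ ∧ IsUnitaryGauge u₂ ∧ g = u₁ * expG 1 l * u₂ := by
  choose U₁ U₂ l h₁ h₂ h₃ using fun k => GL_eq_unitary_mul_diagonal_mul_unitary (g k)
  refine ⟨unitG fun k => ⟨U₁ k, h₁ k⟩, unitG fun k => ⟨U₂ k, h₂ k⟩, l, fun k => h₁ k,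
    fun k => h₂ k, ?_⟩
  funext k
  refine Units.ext ?_
  rw [h₃ k]
  simp [unitG, expG]

/-- The squared norm of a point of `M`. -/
noncomputable def nsq (m : RepSpace v w) : ℝ := ∑ s, ‖entry m s‖ ^ 2

theorem nsq_act {u : GaugeC v} (hu : IsUnitaryGauge u) (m : RepSpace v w) :
    nsq (act u m) = nsq m := by
  have key : ∀ q q' : RepSpace v w, dot (act u q) (act u q') = dot q q' := by
    intro q q'
    have hh : ∀ (k : I) {n : ℕ} (M : Matrix (Fin (v k)) (Fin n) ℂ),
        (u k).1ᴴ * ((u k).1 * M) = M := fun k n M => by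
      rw [← Matrix.mul_assoc, ← Matrix.star_eq_conjTranspose, Matrix.mem_unitaryGroup_iff'.1 (hu k),
        Matrix.one_mul]
    simp only [dot_eq, act, actOmega, actOmegaBar, hu.inv_coe, Matrix.conjTranspose_mul,
      Matrix.conjTranspose_conjTranspose, Matrix.mul_assoc, hh]
    have c1 : ∀ (k : I) {n : ℕ} (A : Matrix (Fin (v k)) (Fin n) ℂ)
        (B : Matrix (Fin n) (Fin (v k)) ℂ),
        ((u k).1 * (A * (B * (u k).1ᴴ))).trace = (A * B).trace := fun k n A B => by
      rw [Matrix.trace_mul_comm]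
      simp only [Matrix.mul_assoc, Matrix.mem_unitaryGroup_iff'.1 (hu k)]
      rw [← Matrix.star_eq_conjTranspose, Matrix.mem_unitaryGroup_iff'.1 (hu k), Matrix.mul_one]
    simp only [c1]
  have h := key m m
  rw [dot_self, dot_self] at h
  exact_mod_cast h

/-- The Kempf-Ness function along a diagonal geodesic. -/
noncomputable def psi (c : I → ℝ) (l : (k : I) → Fin (v k) → ℝ) (m : RepSpace v w) : ℝ :=
  nsq (act (expG 1 l) m) - 4 * charPair c l

theorem psi_eq (c : I → ℝ) (l : (k : I) → Fin (v k) → ℝ) (m : RepSpace v w) :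
    psi c l m = ∑ s, Real.exp (2 * wt l s) * ‖entry m s‖ ^ 2 - 4 * charPair c l := by
  rw [psi, nsq]
  congr 1
  refine Finset.sum_congr rfl fun s _ => ?_
  rw [entry_act_expG, norm_mul, mul_pow, one_mul, Complex.norm_exp_ofReal, ← Real.exp_nat_mul]
  norm_num

theorem wt_smul (t : ℝ) (l : (k : I) → Fin (v k) → ℝ) (s : Ent v w) :
    wt (t • l) s = t * wt l s := by
  rcases s with ⟨a, b, e, i, j⟩ | ⟨k, i, j⟩ | ⟨a, b, e, i, j⟩ | ⟨k, i, j⟩ <;>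
    simp [wt, mul_sub]

theorem charPair_smul (c : I → ℝ) (t : ℝ) (l : (k : I) → Fin (v k) → ℝ) :
    charPair c (t • l) = t * charPair c l := by
  simp only [charPair, Pi.smul_apply, smul_eq_mul, ← Finset.mul_sum, Finset.mul_sum]
  exact Finset.sum_congr rfl fun k _ => Finset.sum_congr rfl fun i _ => by ring

theorem psi_zero (c : I → ℝ) (m : RepSpace v w) : psi c 0 m = nsq m := by
  have h1 : ∀ s : Ent v w, wt (0 : (k : I) → Fin (v k) → ℝ) s = 0 := fun s => by
    have := wt_smul 0 0 s (v := v) (w := w); simpa using this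
  have h2 : charPair c (0 : (k : I) → Fin (v k) → ℝ) = 0 := by simp [charPair]
  simp [psi_eq, nsq, h1, h2]

/-- Convexity of the exponential along the ray. -/
theorem psi_smul_le (c : I → ℝ) (l : (k : I) → Fin (v k) → ℝ) (m : RepSpace v w) {t : ℝ}
    (h0 : 0 ≤ t) (h1 : t ≤ 1) : psi c (t • l) m ≤ (1 - t) * nsq m + t * psi c l m := by
  rw [psi_eq, psi_eq, nsq, charPair_smul]
  have h : ∀ s : Ent v w, Real.exp (2 * wt (t • l) s) * ‖entry m s‖ ^ 2 ≤
      (1 - t) * ‖entry m s‖ ^ 2 + t * (Real.exp (2 * wt l s) * ‖entry m s‖ ^ 2) := fun s => by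
    have h2 := convexOn_exp.2 (Set.mem_univ 0) (Set.mem_univ (2 * wt l s)) (sub_nonneg.2 h1) h0
      (by ring)
    simp only [smul_eq_mul, mul_zero, zero_add, Real.exp_zero, mul_one] at h2
    rw [wt_smul, ← mul_assoc t, ← add_mul, show 2 * (t * wt l s) = t * (2 * wt l s) by ring]
    exact mul_le_mul_of_nonneg_right h2 (by positivity)
  have h3 := Finset.sum_le_sum fun s (_ : s ∈ Finset.univ) => h s
  rw [Finset.sum_add_distrib, ← Finset.mul_sum, ← Finset.mul_sum] at h3
  linarith

/-- A convex function that has risen above its value at 0 remains above it. -/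
theorem nsq_lt_psi_of_le {c : I → ℝ} {l : (k : I) → Fin (v k) → ℝ} {m : RepSpace v w} {s t : ℝ}
    (hs : 0 < s) (hst : s ≤ t) (h : nsq m < psi c (s • l) m) : nsq m < psi c (t • l) m := by
  have ht : 0 < t := hs.trans_le hst
  have h1 := psi_smul_le c (t • l) m (t := s / t) (by positivity) ((div_le_one ht).2 hst)
  rw [smul_smul, div_mul_cancel₀ _ ht.ne'] at h1
  by_contra h2
  push Not at h2
  have : s / t * psi c (t • l) m ≤ s / t * nsq m := mul_le_mul_of_nonneg_left h2 (by positivity)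
  linarith

/-- Either some nonzero entry has positive weight and the norm grows exponentially, or `charPair c l
< 0` and the linear term grows. -/
theorem StabAt.exists_nsq_lt_psi {c : I → ℝ} {m : RepSpace v w} (hm : StabAt c m)
    {V : GaugeC v} (hV : IsUnitaryGauge V) {l : (k : I) → Fin (v k) → ℝ} (hl : l ≠ 0) :
    ∃ s : ℝ, 0 < s ∧ nsq (act V m) < psi c (s • l) (act V m) := by
  have hn : 0 ≤ nsq (act V m) := Finset.sum_nonneg fun s _ => by positivity
  by_cases hc : 0 ≤ charPair c l
  · have : ∃ s : Ent v w, 0 < wt l s ∧ entry (act V m) s ≠ 0 := by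
      by_contra! h
      exact hl (hm V hV l h hc)
    obtain ⟨e, he, hne⟩ := this
    set a := ‖entry (act V m) e‖ ^ 2 with ha
    have hapos : 0 < a := by positivity
    set x := wt l e with hx
    set N := nsq (act V m) with hN
    set C := charPair c l with hC
    have hax : 0 < 2 * a * x ^ 2 := by positivity
    -- From `exp y ≥ y ^ 2 / 2` at `y = 2 s x`, the entry contributes at least `2 a x ^ 2 s ^ 2`;
    -- this `s` makes that exceed `4 s C + N`.
    refine ⟨1 + (4 * C + N) / (2 * a * x ^ 2), by positivity, ?_⟩
    set s := 1 + (4 * C + N) / (2 * a * x ^ 2) with hs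
    have hs1 : 1 ≤ s := by
      have : 0 ≤ (4 * C + N) / (2 * a * x ^ 2) := by positivity
      linarith
    have hs2 : s * (2 * a * x ^ 2) = 2 * a * x ^ 2 + (4 * C + N) := by
      rw [hs, add_mul, div_mul_cancel₀ _ hax.ne', one_mul]
    rw [psi_eq, charPair_smul]
    have h1 : Real.exp (2 * wt (s • l) e) * a ≤
        ∑ e, Real.exp (2 * wt (s • l) e) * ‖entry (act V m) e‖ ^ 2 :=
      Finset.single_le_sum (f := fun e => Real.exp (2 * wt (s • l) e) * ‖entry (act V m) e‖ ^ 2)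
        (fun e _ => by positivity) (Finset.mem_univ e)
    have h2 := Real.quadratic_le_exp_of_nonneg (x := 2 * wt (s • l) e)
      (by rw [wt_smul]; positivity)
    rw [wt_smul] at h1 h2
    rw [← hx] at h1 h2
    have h3 : 2 * a * x ^ 2 * s ^ 2 ≤ Real.exp (2 * (s * x)) * a := by
      have h4 : 0 ≤ 2 * (s * x) := by positivity
      nlinarith
    have h5 : 2 * a * x ^ 2 * s ^ 2 = s * (2 * a * x ^ 2) + s * (4 * C + N) := by
      linear_combination s * hs2
    have h6 : N ≤ s * N := le_mul_of_one_le_left hn hs1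
    have h7 : 0 < s * (2 * a * x ^ 2) := by positivity
    linarith
  · push Not at hc
    set N := nsq (act V m) with hN
    set C := charPair c l with hC
    -- With this value the linear term alone equals `N + 1`.
    refine ⟨(N + 1) / (-4 * C), div_pos (by linarith) (by linarith), ?_⟩
    rw [psi_eq, charPair_smul]
    have h1 : 0 ≤ ∑ e, Real.exp (2 * wt (((N + 1) / (-4 * C)) • l) e) *
        ‖entry (act V m) e‖ ^ 2 := Finset.sum_nonneg fun s _ => by positivity
    have h2 : (N + 1) / (-4 * C) * (-4 * C) = N + 1 := div_mul_cancel₀ _ (by linarith)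
    linarith

/-- The compact gauge group as a product of unitary groups. -/
abbrev UnitaryGauge (v : I → ℕ) := (k : I) → Matrix.unitaryGroup (Fin (v k)) ℂ

instance compactSpace_unitaryGroup (n : ℕ) : CompactSpace (Matrix.unitaryGroup (Fin n) ℂ) := by
  refine isCompact_iff_compactSpace.1
    (?_ : IsCompact (Matrix.unitaryGroup (Fin n) ℂ : Set (Matrix (Fin n) (Fin n) ℂ)))
  have h1 : IsCompact (Set.pi Set.univ fun _ : Fin n => Set.pi Set.univ fun _ : Fin n =>
      Metric.closedBall (0 : ℂ) 1) :=
    isCompact_univ_pi fun _ => isCompact_univ_pi fun _ => isCompact_closedBall _ _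
  refine IsCompact.of_isClosed_subset h1 ?_ ?_
  · exact isClosed_unitary (R := Matrix (Fin n) (Fin n) ℂ)
  · intro U hU i _ j _
    simpa using entry_norm_bound_of_unitary hU i j

theorem continuous_wt (s : Ent v w) :
    Continuous fun l : (k : I) → Fin (v k) → ℝ => wt l s := by
  rcases s with ⟨a, b, e, i, j⟩ | ⟨k, i, j⟩ | ⟨a, b, e, i, j⟩ | ⟨k, i, j⟩ <;>
    · simp only [wt]
      fun_prop

theorem continuous_act_unitG {X : Type*} [TopologicalSpace X] {f : X → UnitaryGauge v}
    {g : X → RepSpace v w} (hf : Continuous f) (hg : Continuous g) :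
    Continuous fun x => act (unitG (f x)) (g x) := by
  simp only [act_unitG, act₂]
  fun_prop

theorem continuous_nsq : Continuous (nsq (v := v) (w := w)) := by
  unfold nsq
  exact continuous_finsetSum _ fun s _ => ((continuous_entry s).norm).pow 2

theorem continuous_psi {X : Type*} [TopologicalSpace X] (c : I → ℝ)
    {f : X → (k : I) → Fin (v k) → ℝ} {g : X → RepSpace v w} (hf : Continuous f)
    (hg : Continuous g) : Continuous fun x => psi c (f x) (g x) := by
  simp only [psi_eq]
  refine (continuous_finsetSum _ fun s _ => ?_).sub ?_
  · have h1 := (continuous_wt s).comp hf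
    have h2 := (continuous_entry s).comp hg
    exact (Real.continuous_exp.comp (continuous_const.mul h1)).mul (h2.norm.pow 2)
  · unfold charPair
    fun_prop

theorem eventually_nsq_lt_psi_of_lt {c : I → ℝ} {m₀ : RepSpace v w} {u : UnitaryGauge v}
    {l : (k : I) → Fin (v k) → ℝ} {s : ℝ} (h : nsq m₀ < psi c (s • l) (act (unitG u) m₀)) :
    ∃ B ∈ 𝓝 (u, l), ∀ᶠ m in 𝓝 m₀, ∀ x ∈ B, nsq m < psi c (s • x.2) (act (unitG x.1) m) := by
  have hcont : Continuous fun y : RepSpace v w × (UnitaryGauge v × ((k : I) → Fin (v k) → ℝ)) =>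
      psi c (s • y.2.2) (act (unitG y.2.1) y.1) :=
    continuous_psi c (continuous_snd.snd.const_smul s)
      (continuous_act_unitG continuous_snd.fst continuous_fst)
  have hn : Continuous fun y : RepSpace v w × (UnitaryGauge v × ((k : I) → Fin (v k) → ℝ)) =>
      nsq y.1 := continuous_nsq.comp continuous_fst
  have hev : ∀ᶠ y : RepSpace v w × (UnitaryGauge v × ((k : I) → Fin (v k) → ℝ)) in
      𝓝 (m₀, (u, l)), nsq y.1 < psi c (s • y.2.2) (act (unitG y.2.1) y.1) :=
    hn.continuousAt.eventually_lt hcont.continuousAt h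
  rw [nhds_prod_eq, Filter.eventually_prod_iff] at hev
  obtain ⟨pa, ha, pb, hb, hab⟩ := hev
  exact ⟨{x | pb x}, hb, ha.mono fun m hm x hx => hab hm hx⟩

/-- The strict inequality at a finite time is open in the base point, the frame and the direction.
Frames and unit directions form a compact set, and later times inherit the inequality, so one `S`
serves all. Uniformity in `m` is what gives continuity of the quotient map. -/
theorem StabAt.eventually_nsq_lt_psi {c : I → ℝ} {m₀ : RepSpace v w} (hm : StabAt c m₀) :
    ∃ S : ℝ, 0 < S ∧ ∀ᶠ m in 𝓝 m₀, ∀ (V : GaugeC v), IsUnitaryGauge V →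
      ∀ l : (k : I) → Fin (v k) → ℝ, S ≤ ‖l‖ → nsq m < psi c l (act V m) := by
  have hK : IsCompact ((Set.univ : Set (UnitaryGauge v)) ×ˢ
      Metric.sphere (0 : (k : I) → Fin (v k) → ℝ) 1) :=
    isCompact_univ.prod (isCompact_sphere _ _)
  have key := hK.induction_on (p := fun T => ∃ S : ℝ, 0 < S ∧ ∀ᶠ m in 𝓝 m₀, ∀ x ∈ T,
    nsq m < psi c (S • x.2) (act (unitG x.1) m)) ⟨1, one_pos, by simp⟩
    (fun T T' hTT' ⟨S, hS, h⟩ => ⟨S, hS, h.mono fun m hm x hx => hm x (hTT' hx)⟩)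
    (fun T T' ⟨S, hS, h⟩ ⟨S', hS', h'⟩ => ⟨max S S', lt_max_of_lt_left hS, by
      filter_upwards [h, h'] with m hm hm' x hx
      have hu := nsq_act (isUnitaryGauge_unitG x.1) m
      rw [← hu]
      rcases hx with hx | hx
      · exact nsq_lt_psi_of_le hS (le_max_left _ _) (hu.symm ▸ hm x hx)
      · exact nsq_lt_psi_of_le hS' (le_max_right _ _) (hu.symm ▸ hm' x hx)⟩)
    (by
      rintro ⟨u, l⟩ ⟨-, hl⟩
      have hl0 : l ≠ 0 := by
        rintro rfl
        simp at hl
      obtain ⟨s, hs, h⟩ := hm.exists_nsq_lt_psi (isUnitaryGauge_unitG u) hl0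
      rw [nsq_act (isUnitaryGauge_unitG u)] at h
      obtain ⟨B, hB, h'⟩ := eventually_nsq_lt_psi_of_lt h
      exact ⟨B, mem_nhdsWithin_of_mem_nhds hB, s, hs, h'⟩)
  obtain ⟨S, hS, h⟩ := key
  refine ⟨S, hS, ?_⟩
  filter_upwards [h] with m hm V hV l hl
  obtain ⟨u, rfl⟩ := hV.exists_unitG
  have hl0 : 0 < ‖l‖ := hS.trans_le hl
  have h1 := hm (u, ‖l‖⁻¹ • l) ⟨Set.mem_univ _, by
    simp [norm_smul, hl0.ne']⟩
  have h2 := nsq_lt_psi_of_le hS hl ((nsq_act (isUnitaryGauge_unitG u) m).symm ▸ h1)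
  rw [nsq_act (isUnitaryGauge_unitG u), smul_smul, mul_inv_cancel₀ hl0.ne', one_smul] at h2
  exact h2

end KempfNess

/-! ### Existence and uniqueness of solutions of the real moment map equation -/

section KempfNessTheorem

variable {I : Type*} [Fintype I] [Quiver I] [∀ a b : I, Fintype (a ⟶ b)] {v w : I → ℕ}

theorem norm_det_of_unitary {u : GaugeC v} (hu : IsUnitaryGauge u) (k : I) :
    ‖(u k).1.det‖ = 1 :=
  CStarRing.norm_of_mem_unitary (Matrix.det_of_mem_unitary (hu k))

theorem norm_det_expG (l : (k : I) → Fin (v k) → ℝ) (k : I) :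
    ‖(expG 1 l k).1.det‖ = Real.exp (∑ i, l k i) := by
  simp only [expG, Matrix.det_diagonal, one_mul]
  rw [← Complex.exp_sum, ← Complex.ofReal_sum, Complex.norm_exp_ofReal]

/-- Compare absolute values of determinants; the unitary factors contribute 1. -/
theorem sum_eq_of_mul_eq {u₁ u₂ u₃ u₄ : GaugeC v} (h₁ : IsUnitaryGauge u₁)
    (h₂ : IsUnitaryGauge u₂) (h₃ : IsUnitaryGauge u₃) (h₄ : IsUnitaryGauge u₄)
    {l l' l'' : (k : I) → Fin (v k) → ℝ}
    (h : expG 1 l * u₃ * (expG 1 l' * u₄) = u₁ * expG 1 l'' * u₂) (k : I) :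
    ∑ i, l'' k i = ∑ i, l k i + ∑ i, l' k i := by
  have h5 := congrArg (fun g : GaugeC v => ‖(g k).1.det‖) h
  simp only [Pi.mul_apply, Units.val_mul, Matrix.det_mul, norm_mul, norm_det_of_unitary h₁,
    norm_det_of_unitary h₂, norm_det_of_unitary h₃, norm_det_of_unitary h₄, norm_det_expG,
    mul_one, one_mul, ← Real.exp_add] at h5
  exact (Real.exp_injective h5).symm

theorem charPair_eq_of_mul_eq (c : I → ℝ) {u₁ u₂ u₃ u₄ : GaugeC v} (h₁ : IsUnitaryGauge u₁)
    (h₂ : IsUnitaryGauge u₂) (h₃ : IsUnitaryGauge u₃) (h₄ : IsUnitaryGauge u₄)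
    {l l' l'' : (k : I) → Fin (v k) → ℝ}
    (h : expG 1 l * u₃ * (expG 1 l' * u₄) = u₁ * expG 1 l'' * u₂) :
    charPair c l'' = charPair c l + charPair c l' := by
  simp only [charPair, sum_eq_of_mul_eq h₁ h₂ h₃ h₄ h, mul_add, Finset.sum_add_distrib]

/-- At a minimum the Hermitian matrix `lStar r r k` has diagonal entries `2 c k` in every unitary
frame, in particular in a frame of eigenvectors. -/
theorem lStar_eq_twoC_of_minimal {c : I → ℝ} {r : RepSpace v w}
    (h : ∀ V : GaugeC v, IsUnitaryGauge V → ∀ l, nsq r ≤ psi c l (act V r)) :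
    lStar r r = twoC v c := by
  classical
  -- the derivative of the Kempf-Ness function vanishes in all directions
  have h1 : ∀ V : GaugeC v, IsUnitaryGauge V → ∀ l : (k : I) → Fin (v k) → ℝ,
      ∑ s, wt l s * ‖entry (act V r) s‖ ^ 2 = 2 * charPair c l := by
    intro V hV l
    set q := act V r
    have hd : HasDerivAt (fun t : ℝ => psi c (t • l) q)
        (∑ s, (2 * wt l s) * ‖entry q s‖ ^ 2 - 4 * charPair c l) 0 := by
      simp only [psi_eq, wt_smul, charPair_smul]
      refine HasDerivAt.sub (HasDerivAt.fun_sum fun s _ => HasDerivAt.mul_const ?_ _) ?_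
      · have h2 : HasDerivAt (fun t : ℝ => 2 * (t * wt l s)) (2 * wt l s) 0 := by
          simpa using ((hasDerivAt_id (0 : ℝ)).mul_const (wt l s)).const_mul 2
        simpa using h2.exp
      · simpa using ((hasDerivAt_id (0 : ℝ)).mul_const (charPair c l)).const_mul 4
    have hmin : IsLocalMin (fun t : ℝ => psi c (t • l) q) 0 := by
      refine Filter.Eventually.of_forall fun t => ?_
      simp only [zero_smul, psi_zero]
      rw [nsq_act hV]
      exact h V hV _
    have h2 := hmin.hasDerivAt_eq_zero hd
    have h3 : ∑ s, (2 * wt l s) * ‖entry q s‖ ^ 2 = 2 * ∑ s, wt l s * ‖entry q s‖ ^ 2 := by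
      rw [Finset.mul_sum]; exact Finset.sum_congr rfl fun s _ => by ring
    linarith
  have h2 : ∀ V : GaugeC v, IsUnitaryGauge V → ∀ k i,
      lStar (act V r) (act V r) k i i = 2 * (c k : ℂ) := by
    intro V hV k i
    set q := act V r with hq
    let l : (k : I) → Fin (v k) → ℝ := Pi.single k (Pi.single i 1)
    have h3 := sum_trace_lStar (diagL fun k i => (l k i : ℂ)) q q
    have h4 : dot (lact (diagL fun k i => (l k i : ℂ)) q) q =
        ((∑ s, wt l s * ‖entry q s‖ ^ 2 : ℝ) : ℂ) := by
      simp only [dot, entry_lact_diagL]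
      push_cast
      refine Finset.sum_congr rfl fun s _ => ?_
      simp only [star_mul', Complex.star_def, Complex.conj_ofReal]
      rw [mul_assoc, Complex.conj_mul']
    rw [h4, h1 V hV l] at h3
    have h5 : charPair c l = c k := by
      rw [charPair, Finset.sum_eq_single k (fun k' _ hk' => by simp [l, hk']) (by simp)]
      simp [l]
    have h6 : ∑ k', ((diagL (fun k i => (l k i : ℂ)) k')ᴴ * lStar q q k').trace =
        lStar q q k i i := by
      rw [Finset.sum_eq_single k (fun k' _ hk' => ?_) (by simp)]
      · simp only [diagL, Matrix.trace, Matrix.diag, Matrix.diagonal_conjTranspose,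
          Matrix.diagonal_mul]
        rw [Finset.sum_eq_single i (fun i' _ hi' => by simp [l, hi']) (by simp)]
        simp [l]
      · simp [diagL, Matrix.trace, Matrix.diagonal_conjTranspose, l, hk']
    rw [h6, h5] at h3
    rw [h3]; push_cast; ring
  have hherm : ∀ k, (lStar r r k).IsHermitian := fun k => conjTranspose_lStar r r k
  choose U d hU hA hd using fun k => exists_unitary_diagonal (hherm k)
  have hUu : IsUnitaryGauge (unitG fun k => ⟨U k, hU k⟩ : GaugeC v) := fun k => hU k
  have hUi : ∀ k, (((unitG fun k => ⟨U k, hU k⟩ : GaugeC v)⁻¹) k).1 = (U k)ᴴ := fun k =>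
    hUu.inv_coe k
  funext k
  have h7 : Matrix.diagonal (fun i => (d k i : ℂ)) = twoC v c k := by
    have hU1 : (U k)ᴴ * U k = 1 := Matrix.mem_unitaryGroup_iff'.1 (hU k)
    have h8 : lStar (act (unitG fun k => ⟨U k, hU k⟩)⁻¹ r) (act (unitG fun k => ⟨U k, hU k⟩)⁻¹ r) k
        = Matrix.diagonal (fun i => (d k i : ℂ)) := by
      rw [lStar_act_unitary hUu.inv, hUi, Matrix.conjTranspose_conjTranspose, hA k]
      calc (U k)ᴴ * (U k * Matrix.diagonal (fun i => (d k i : ℂ)) * (U k)ᴴ) * U k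
          = ((U k)ᴴ * U k) * Matrix.diagonal (fun i => (d k i : ℂ)) * ((U k)ᴴ * U k) := by
            simp only [Matrix.mul_assoc]
        _ = _ := by rw [hU1, Matrix.one_mul, Matrix.mul_one]
    rw [twoC, Matrix.smul_one_eq_diagonal]
    congr 1
    funext i
    have := h2 _ hUu.inv k i
    rwa [h8, Matrix.diagonal_apply_eq] at this
  rw [hA k, h7, twoC, Matrix.mul_smul, Matrix.smul_mul, Matrix.mul_one]
  congr 1
  exact Matrix.mem_unitaryGroup_iff.1 (hU k)

/-- Properness reduces the minimisation to a compact set of polar data; the minimiser is a critical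
point. -/
theorem StabAt.exists_lStar_eq {c : I → ℝ} {m : RepSpace v w} (hm : StabAt c m) :
    ∃ g : GaugeC v, lStar (act g m) (act g m) = twoC v c := by
  obtain ⟨S, hS, hev⟩ := hm.eventually_nsq_lt_psi
  have hev := hev.self_of_nhds
  have hK : IsCompact ((Set.univ : Set (UnitaryGauge v)) ×ˢ
      Metric.closedBall (0 : (k : I) → Fin (v k) → ℝ) S) :=
    isCompact_univ.prod (isCompact_closedBall _ _)
  have hcont : Continuous fun x : UnitaryGauge v × ((k : I) → Fin (v k) → ℝ) =>
      psi c x.2 (act (unitG x.1) m) :=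
    continuous_psi c continuous_snd (continuous_act_unitG continuous_fst continuous_const)
  obtain ⟨⟨u, l⟩, -, hmin⟩ := hK.exists_isMinOn ⟨(1, 0), Set.mem_univ _, by simp [hS.le]⟩
    hcont.continuousOn
  have hu := isUnitaryGauge_unitG u
  have hglob : ∀ (V : GaugeC v), IsUnitaryGauge V → ∀ l', psi c l (act (unitG u) m) ≤
      psi c l' (act V m) := by
    intro V hV l'
    rcases le_or_gt ‖l'‖ S with h | h
    · obtain ⟨u', rfl⟩ := hV.exists_unitG
      exact hmin (a := (u', l')) ⟨Set.mem_univ _, by simpa using h⟩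
    · have h0 : psi c l (act (unitG u) m) ≤ psi c 0 (act (unitG u) m) :=
        hmin (a := (u, 0)) ⟨Set.mem_univ _, by simp [hS.le]⟩
      rw [psi_zero, nsq_act hu] at h0
      exact h0.trans (hev V hV l' h.le).le
  refine ⟨expG 1 l * unitG u, lStar_eq_twoC_of_minimal fun V hV l' => ?_⟩
  -- A further move from the minimiser is put in polar form again. The left unitary factor preserves
  -- the norm and `charPair` is additive, so minimality among polar data starting at `m` gives
  -- minimality at the new point.
  obtain ⟨u₁, u₂, l'', h₁, h₂, h⟩ := exists_polar (expG 1 l' * V * (expG 1 l * unitG u))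
  have h3 := hglob u₂ h₂ l''
  have h4 := charPair_eq_of_mul_eq c h₁ h₂ hV hu h
  have h5 : nsq (act (expG 1 l') (act V (act (expG 1 l * unitG u) m))) =
      nsq (act (expG 1 l'') (act u₂ m)) := by
    rw [← act_mul, ← act_mul, h, act_mul, act_mul, nsq_act h₁]
  rw [psi, h5]
  rw [psi, psi, ← act_mul] at h3
  linarith

/-- Conversely a critical point is a minimum along each ray, by `1 + x ≤ exp x`. -/
theorem nsq_le_psi {c : I → ℝ} {r : RepSpace v w} (hr : lStar r r = twoC v c)
    (l : (k : I) → Fin (v k) → ℝ) : nsq r ≤ psi c l r := by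
  have h1 := sum_wt_mul_normSq hr l
  have h2 : ∀ s ∈ Finset.univ, ‖entry r s‖ ^ 2 + 2 * (wt l s * ‖entry r s‖ ^ 2) ≤
      Real.exp (2 * wt l s) * ‖entry r s‖ ^ 2 := fun s _ => by
    have := Real.add_one_le_exp (2 * wt l s)
    nlinarith [sq_nonneg ‖entry r s‖]
  have h3 := Finset.sum_le_sum h2
  rw [Finset.sum_add_distrib, ← Finset.mul_sum] at h3
  rw [psi_eq, nsq]
  linarith

/-- Strict convexity: subtracting the level equations at the two ends, paired with `l`, leaves `∑ wt
(exp (2 wt) - 1) |entry| ^ 2 = 0`, whose terms are nonnegative and positive on entries of nonzero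
weight. -/
theorem exists_polar_of_lStar_eq {c : I → ℝ} {p : RepSpace v w} (hp : lStar p p = twoC v c)
    {g : GaugeC v} (hg : lStar (act g p) (act g p) = twoC v c) :
    ∃ (u₁ u₂ : GaugeC v) (l : (k : I) → Fin (v k) → ℝ), IsUnitaryGauge u₁ ∧ IsUnitaryGauge u₂ ∧
      g = u₁ * expG 1 l * u₂ ∧ ∀ s, wt l s ≠ 0 → entry (act u₂ p) s = 0 := by
  obtain ⟨u₁, u₂, l, h₁, h₂, rfl⟩ := exists_polar g
  refine ⟨u₁, u₂, l, h₁, h₂, rfl, ?_⟩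
  have h3 := sum_wt_mul_normSq (lStar_act_eq_twoC h₂ hp) l
  have h4 := lStar_act_eq_twoC h₁.inv hg
  rw [mul_assoc, act_mul u₁, act_inv_act, act_mul] at h4
  have h5 := sum_wt_mul_normSq h4 l
  set q := act u₂ p
  have h6 : ∑ s, (wt l s * (Real.exp (2 * wt l s) - 1)) * ‖entry q s‖ ^ 2 = 0 := by
    rw [← sub_eq_zero.2 (h5.trans h3.symm), ← Finset.sum_sub_distrib]
    refine Finset.sum_congr rfl fun s _ => ?_
    rw [entry_act_expG, norm_mul, mul_pow, one_mul, Complex.norm_exp_ofReal, ← Real.exp_nat_mul]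
    push_cast
    ring
  have hnn : ∀ s : Ent v w, wt l s ≠ 0 → 0 < wt l s * (Real.exp (2 * wt l s) - 1) := by
    intro s hs
    rcases lt_or_gt_of_ne hs with h | h
    · refine mul_pos_of_neg_of_neg h ?_
      have : Real.exp (2 * wt l s) < 1 := by
        rw [← Real.exp_zero]; exact Real.exp_lt_exp.2 (by linarith)
      linarith
    · refine mul_pos h ?_
      have : 1 < Real.exp (2 * wt l s) := Real.one_lt_exp_iff.2 (by linarith)
      linarith
  intro s hs
  have h7 := (Finset.sum_eq_zero_iff_of_nonneg fun s _ => ?_).1 h6 s (Finset.mem_univ s)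
  · simpa [(hnn s hs).ne'] using h7
  · rcases eq_or_ne (wt l s) 0 with h | h
    · simp [h]
    · exact mul_nonneg (hnn s h).le (by positivity)

theorem exists_unitary_of_lStar_eq {c : I → ℝ} {p : RepSpace v w} (hp : lStar p p = twoC v c)
    {g : GaugeC v} (hg : lStar (act g p) (act g p) = twoC v c) :
    ∃ u : GaugeC v, IsUnitaryGauge u ∧ act u p = act g p := by
  obtain ⟨u₁, u₂, l, h₁, h₂, rfl, h⟩ := exists_polar_of_lStar_eq hp hg
  refine ⟨u₁ * u₂, h₁.mul h₂, ?_⟩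
  rw [act_mul, act_mul, act_mul]
  congr 1
  refine entry_ext fun s => ?_
  rw [entry_act_expG]
  rcases eq_or_ne (wt l s) 0 with h0 | h0
  · simp [h0]
  · simp [h s h0]

theorem expG_zero (z : ℂ) : expG z (0 : (k : I) → Fin (v k) → ℝ) = 1 := by
  funext k
  refine Units.ext ?_
  simp [expG]

theorem isUnitaryGauge_of_level [DecidableEq I] {c : I → ℝ} (hc : IsGeneric v c)
    {p : RepSpace v w} (hp : p ∈ level w (central v c) 0) {g : GaugeC v}
    (hg : lStar (act g p) (act g p) = twoC v c) : IsUnitaryGauge g := by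
  obtain ⟨u₁, u₂, l, h₁, h₂, rfl, h⟩ :=
    exists_polar_of_lStar_eq ((mem_level_iff c p).1 hp).1 hg
  rw [weight_eq_zero_of_level hc (act_mem_level h₂ hp) l h, expG_zero, mul_one]
  exact h₁.mul h₂

end KempfNessTheorem

/-! ### Diagonalisation of unitary matrices -/

section Stabilizer

/-- The Cayley transform at a point `β` of the circle outside the spectrum is Hermitian, and the
spectral theorem applies to it. -/
theorem exists_unitary_diagonalize {n : ℕ} {g : Matrix (Fin n) (Fin n) ℂ}
    (hg : g ∈ Matrix.unitaryGroup (Fin n) ℂ) :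
    ∃ (U : Matrix (Fin n) (Fin n) ℂ) (l : Fin n → ℝ), U ∈ Matrix.unitaryGroup (Fin n) ℂ ∧
      (∀ i, l i ∈ Set.Ioc (-Real.pi) Real.pi) ∧
      g = U * Matrix.diagonal (fun i => Complex.exp (Complex.I * l i)) * Uᴴ := by
  have hg1 : gᴴ * g = 1 := Matrix.mem_unitaryGroup_iff'.1 hg
  have hg2 : g * gᴴ = 1 := Matrix.mem_unitaryGroup_iff.1 hg
  -- a point of the unit circle which is not an eigenvalue
  obtain ⟨β, hβ, hdet⟩ : ∃ β : ℂ, ‖β‖ = 1 ∧ (β • (1 : Matrix (Fin n) (Fin n) ℂ) - g).det ≠ 0 := by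
    by_contra! h
    have hsub : Metric.sphere (0 : ℂ) 1 ⊆ (g.charpoly.roots.toFinset : Set ℂ) := by
      intro β hβ
      have h1 := h β (by simpa using hβ)
      simp only [Finset.mem_coe, Multiset.mem_toFinset]
      rw [Polynomial.mem_roots g.charpoly_monic.ne_zero, Polynomial.IsRoot, Matrix.eval_charpoly,
        Matrix.scalar_apply, ← Matrix.smul_one_eq_diagonal]
      exact h1
    -- The points `exp (m i)`, `m ∈ ℕ`, are distinct because `π` is irrational.
    have hinf : (Metric.sphere (0 : ℂ) 1).Infinite := by
      refine Set.infinite_of_injective_forall_mem (f := fun m : ℕ => Complex.exp (m * Complex.I))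
        (fun a b hab => ?_) fun m => ?_
      · obtain ⟨k, hk⟩ := Complex.exp_eq_exp_iff_exists_int.1 hab
        have h1 : (a : ℝ) = b + k * (2 * Real.pi) := by
          have := congrArg Complex.im hk
          simpa using this
        by_contra hne
        have hk0 : (k : ℝ) ≠ 0 := by
          rintro h0
          rw [h0] at h1
          exact hne (by exact_mod_cast (by linarith : (a : ℝ) = b))
        refine irrational_pi ⟨((a : ℚ) - b) / (k * 2), ?_⟩
        push_cast
        rw [h1]
        field_simp
        ring
      · simpa using Complex.norm_exp_ofReal_mul_I (m : ℝ)
    exact hinf ((Finset.finite_toSet _).subset hsub)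
  have hββ : star β * β = 1 := by
    rw [Complex.star_def, Complex.conj_mul', hβ]; simp
  set M := β • (1 : Matrix (Fin n) (Fin n) ℂ) - g with hM
  have hu : IsUnit M.det := isUnit_iff_ne_zero.2 hdet
  have hMM : M⁻¹ * M = 1 := Matrix.nonsing_inv_mul M hu
  have hMM' : M * M⁻¹ = 1 := Matrix.mul_nonsing_inv M hu
  set P := β • (1 : Matrix (Fin n) (Fin n) ℂ) + g with hP
  -- the Cayley transform
  set Z := Complex.I • (P * M⁻¹) with hZ
  have hZM : Z * M = Complex.I • P := by
    rw [hZ, Matrix.smul_mul, Matrix.mul_assoc, hMM, Matrix.mul_one]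
  have hherm : Z.IsHermitian := by
    have h1 : Mᴴ * P = -(Pᴴ * M) := by
      simp only [hP, hM, Matrix.conjTranspose_sub, Matrix.conjTranspose_add,
        Matrix.conjTranspose_smul, Matrix.conjTranspose_one, Matrix.mul_sub, Matrix.mul_add,
        Matrix.add_mul, Matrix.sub_mul, Matrix.smul_mul, Matrix.mul_smul, Matrix.one_mul,
        Matrix.mul_one, smul_add, smul_sub, smul_smul, hg1, mul_comm β, hββ, one_smul]
      abel
    have h2 : (M⁻¹)ᴴ * Mᴴ = 1 := by
      rw [← Matrix.conjTranspose_mul, hMM', Matrix.conjTranspose_one]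
    have h3 : (M⁻¹)ᴴ * Pᴴ = -(P * M⁻¹) := by
      calc (M⁻¹)ᴴ * Pᴴ = (M⁻¹)ᴴ * (Pᴴ * M) * M⁻¹ := by
            rw [Matrix.mul_assoc, Matrix.mul_assoc, hMM', Matrix.mul_one]
        _ = -((M⁻¹)ᴴ * (Mᴴ * P) * M⁻¹) := by
            rw [h1]; simp
        _ = -(P * M⁻¹) := by
            rw [← Matrix.mul_assoc (M⁻¹)ᴴ, h2, Matrix.one_mul]
    rw [Matrix.IsHermitian, hZ, Matrix.conjTranspose_smul, Matrix.conjTranspose_mul, h3]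
    simp
  obtain ⟨U, d, hU, hA, -⟩ := exists_unitary_diagonal hherm
  have hU1 : Uᴴ * U = 1 := Matrix.mem_unitaryGroup_iff'.1 hU
  have hU2 : U * Uᴴ = 1 := Matrix.mem_unitaryGroup_iff.1 hU
  have hdi : ∀ i, (d i : ℂ) + Complex.I ≠ 0 := fun i h => by
    have := congrArg Complex.im h
    simp at this
  -- The inverse Cayley transform: solve `d = i (β + e) / (β - e)` for `e`.
  let e : Fin n → ℂ := fun i => β * ((d i : ℂ) - Complex.I) / ((d i : ℂ) + Complex.I)
  have he : ∀ i, ‖e i‖ = 1 := fun i => by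
    have h1 : ‖(d i : ℂ) - Complex.I‖ = ‖(d i : ℂ) + Complex.I‖ := by
      rw [← Complex.norm_conj]; simp [sub_eq_add_neg]
    simp only [e]
    rw [norm_div, norm_mul, hβ, h1, one_mul, div_self (norm_ne_zero_iff.2 (hdi i))]
  have hge : g = U * Matrix.diagonal e * Uᴴ := by
    have h1 : (Z + Complex.I • 1) * g = β • (Z - Complex.I • 1) := by
      have h2 : Z * M = β • Z - Z * g := by
        rw [hM, Matrix.mul_sub, Matrix.mul_smul, Matrix.mul_one]
      rw [h2, hP] at hZM
      have h3 : Z * g = β • Z - Complex.I • (β • (1 : Matrix (Fin n) (Fin n) ℂ) + g) := by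
        rw [← hZM]; abel
      rw [Matrix.add_mul, h3, Matrix.smul_mul, Matrix.one_mul]
      module
    have h4 : Matrix.diagonal (fun i => (d i : ℂ) + Complex.I) * (Uᴴ * g * U) =
        Matrix.diagonal (fun i => β * ((d i : ℂ) - Complex.I)) := by
      have e1 : Matrix.diagonal (fun i => (d i : ℂ) + Complex.I) =
          Uᴴ * (Z + Complex.I • 1) * U := by
        rw [hA, Matrix.mul_add, Matrix.add_mul, Matrix.mul_smul, Matrix.smul_mul, Matrix.mul_one,
          hU1, Matrix.smul_one_eq_diagonal]
        have : Uᴴ * (U * Matrix.diagonal (fun i => (d i : ℂ)) * Uᴴ) * U =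
            (Uᴴ * U) * Matrix.diagonal (fun i => (d i : ℂ)) * (Uᴴ * U) := by
          simp only [Matrix.mul_assoc]
        rw [this, hU1, Matrix.one_mul, Matrix.mul_one, Matrix.diagonal_add]
      have e2 : Matrix.diagonal (fun i => β * ((d i : ℂ) - Complex.I)) =
          Uᴴ * (β • (Z - Complex.I • 1)) * U := by
        rw [hA, Matrix.mul_smul, Matrix.smul_mul, Matrix.mul_sub, Matrix.sub_mul, Matrix.mul_smul,
          Matrix.smul_mul, Matrix.mul_one, hU1, Matrix.smul_one_eq_diagonal]
        have : Uᴴ * (U * Matrix.diagonal (fun i => (d i : ℂ)) * Uᴴ) * U =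
            (Uᴴ * U) * Matrix.diagonal (fun i => (d i : ℂ)) * (Uᴴ * U) := by
          simp only [Matrix.mul_assoc]
        rw [this, hU1, Matrix.one_mul, Matrix.mul_one, Matrix.diagonal_sub,
          ← Matrix.diagonal_smul]
        rfl
      rw [e1, e2, ← h1]
      calc Uᴴ * (Z + Complex.I • 1) * U * (Uᴴ * g * U)
          = Uᴴ * (Z + Complex.I • 1) * (U * Uᴴ) * g * U := by simp only [Matrix.mul_assoc]
        _ = Uᴴ * ((Z + Complex.I • 1) * g) * U := by
            rw [hU2, Matrix.mul_one]; simp only [Matrix.mul_assoc]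
    have h5 : Uᴴ * g * U = Matrix.diagonal e := by
      ext i j
      have h6 := congrFun (congrFun h4 i) j
      rw [Matrix.diagonal_mul] at h6
      rw [Matrix.diagonal_apply] at h6 ⊢
      split_ifs with hij
      · rw [if_pos hij] at h6
        simp only [e]
        rw [eq_div_iff (hdi i), mul_comm, h6]
      · rw [if_neg hij] at h6
        exact (mul_eq_zero.1 h6).resolve_left (hdi i)
    rw [← h5]
    calc g = (U * Uᴴ) * g * (U * Uᴴ) := by rw [hU2, Matrix.one_mul, Matrix.mul_one]
      _ = _ := by simp only [Matrix.mul_assoc]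
  refine ⟨U, fun i => Complex.arg (e i), hU,
    fun i => ⟨Complex.neg_pi_lt_arg _, Complex.arg_le_pi _⟩, ?_⟩
  rw [hge]
  congr 3
  funext i
  have := Complex.norm_mul_exp_arg_mul_I (e i)
  rw [he, Complex.ofReal_one, one_mul, mul_comm] at this
  exact this.symm

end Stabilizer

/-! ### Freeness of the action and integrality of the weights at a fixed point -/

section FixedPoint

variable {I : Type*} [Fintype I] [Quiver I] [∀ a b : I, Fintype (a ⟶ b)] {v w : I → ℕ}

theorem IsUnitaryGauge.exists_diagonalize {g : GaugeC v} (hg : IsUnitaryGauge g) :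
    ∃ (V : GaugeC v) (l : (k : I) → Fin (v k) → ℝ), IsUnitaryGauge V ∧
      (∀ k i, l k i ∈ Set.Ioc (-Real.pi) Real.pi) ∧ g = V * expG Complex.I l * V⁻¹ := by
  choose U l hU hl hA using fun k => exists_unitary_diagonalize (hg k)
  refine ⟨unitG fun k => ⟨U k, hU k⟩, l, fun k => hU k, hl, ?_⟩
  funext k
  refine Units.ext ?_
  rw [hA k]
  rfl

/-- Angles in a half-open interval of length `2π` differ by less than `2π`, so no nonzero weight is
a multiple of `2π`. -/
theorem wt_two_pi_eq_zero {l : (k : I) → Fin (v k) → ℝ}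
    (hl : ∀ k i, l k i ∈ Set.Ioc (-Real.pi) Real.pi) {s : Ent v w} {z : ℤ}
    (h : wt l s = z * (2 * Real.pi)) : wt l s = 0 := by
  have hpi := Real.pi_pos
  have hlt : |wt l s| < 2 * Real.pi := by
    rw [abs_lt]
    rcases s with ⟨a, b, e, i, j⟩ | ⟨k, i, j⟩ | ⟨a, b, e, i, j⟩ | ⟨k, i, j⟩
    · have := hl b i; have := hl a j; simp only [wt, Set.mem_Ioc] at *; constructor <;> linarith
    · have := hl k i; simp only [wt, Set.mem_Ioc] at *; constructor <;> linarith
    · have := hl a i; have := hl b j; simp only [wt, Set.mem_Ioc] at *; constructor <;> linarith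
    · have := hl k j; simp only [wt, Set.mem_Ioc] at *; constructor <;> linarith
  have hz : z = 0 := by
    rw [h, abs_mul, abs_of_pos (by positivity : 0 < 2 * Real.pi)] at hlt
    have h1 : |(z : ℝ)| < 1 := by
      by_contra h2
      push Not at h2
      have := mul_le_mul_of_nonneg_right h2 (by positivity : 0 ≤ 2 * Real.pi)
      linarith
    have h2 : |z| < 1 := by exact_mod_cast h1
    exact Int.abs_lt_one_iff.1 h2
  rw [h, hz]; simp

theorem exp_I_mul_eq_one {x : ℝ} (h : Complex.exp (Complex.I * x) = 1) :
    ∃ z : ℤ, x = z * (2 * Real.pi) := by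
  obtain ⟨z, hz⟩ := Complex.exp_eq_one_iff.1 h
  refine ⟨z, ?_⟩
  have := congrArg Complex.im hz
  simpa using this

/-- A stabilising element is unitary, hence diagonalisable with such angles. The point is then
supported in weight zero, which by genericity forces all angles to vanish. -/
theorem eq_one_of_act_eq_self [DecidableEq I] {c : I → ℝ} (hc : IsGeneric v c)
    {p : RepSpace v w} (hp : p ∈ level w (central v c) 0) {g : GaugeC v} (hg : act g p = p) :
    g = 1 := by
  have hu : IsUnitaryGauge g :=
    isUnitaryGauge_of_level hc hp (by rw [hg]; exact ((mem_level_iff c p).1 hp).1)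
  obtain ⟨V, l, hV, hl, rfl⟩ := hu.exists_diagonalize
  have h1 : act (expG Complex.I l) (act V⁻¹ p) = act V⁻¹ p := by
    conv_rhs => rw [← hg]
    rw [act_mul, act_mul, act_inv_act]
  have h2 := weight_eq_zero_of_level hc (act_mem_level hV.inv hp) l fun s hs => by
    by_contra hne
    have h3 := congrArg (fun q => entry q s) h1
    simp only [entry_act_expG] at h3
    obtain ⟨z, hz⟩ := exp_I_mul_eq_one (mul_right_cancel₀ hne (h3.trans (one_mul _).symm))
    exact hs (wt_two_pi_eq_zero hl hz)
  rw [h2, expG_zero, mul_one, mul_inv_cancel]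

/-- For small `t ≠ 0` the element `1 + t X` is invertible and fixes `p`, so it equals 1. -/
theorem eq_zero_of_lact_eq_zero [DecidableEq I] {c : I → ℝ} (hc : IsGeneric v c)
    {p : RepSpace v w} (hp : p ∈ level w (central v c) 0) {X : LieC v} (hX : lact X p = 0) :
    X = 0 := by
  have h1 : ∀ k, ∀ᶠ t : ℂ in 𝓝[≠] 0, (1 + t • X k).det ≠ 0 := fun k => by
    have hc : Continuous fun t : ℂ => (1 + t • X k).det :=
      Continuous.matrix_det (by fun_prop)
    have := (hc.tendsto 0).eventually_ne (b₂ := 0) (by simp)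
    exact this.filter_mono nhdsWithin_le_nhds
  have h2 := (Filter.eventually_all.2 h1).and (self_mem_nhdsWithin (a := (0 : ℂ)) (s := {0}ᶜ))
  obtain ⟨t, ht, ht0⟩ := h2.exists
  let g : GaugeC v := fun k => Matrix.GeneralLinearGroup.mkOfDetNeZero (1 + t • X k) (ht k)
  have hgv : ∀ k, (g k).1 = 1 + t • X k := fun k => rfl
  have hinv : ∀ (k : I) {n : ℕ} (M : Matrix (Fin n) (Fin (v k)) ℂ),
      M * (g k).1 * ((g k)⁻¹).1 = M := fun k n M => by
    rw [Matrix.mul_assoc, ← Units.val_mul, mul_inv_cancel, Units.val_one, Matrix.mul_one]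
  have hgp : act g p = p := by
    refine rep_ext (fun a b e => ?_) (fun k => ?_) (fun a b e => ?_) (fun k => ?_)
    · have h3 : X b * p.1.1 a b e - p.1.1 a b e * X a = 0 :=
        congrFun (congrFun (congrFun (congrArg (fun q => q.1.1) hX) a) b) e
      have h4 : (g b).1 * p.1.1 a b e = p.1.1 a b e * (g a).1 := by
        rw [hgv, hgv, Matrix.add_mul, Matrix.mul_add, Matrix.smul_mul, sub_eq_zero.1 h3]
        simp
      exact (congrArg (· * ((g a)⁻¹).1) h4).trans (hinv a _)
    · have h3 : X k * p.1.2 k = 0 := congrFun (congrArg (fun q => q.1.2) hX) k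
      change (g k).1 * p.1.2 k = p.1.2 k
      rw [hgv, Matrix.add_mul, Matrix.smul_mul, h3]; simp
    · have h3 : X a * p.2.1 a b e - p.2.1 a b e * X b = 0 :=
        congrFun (congrFun (congrFun (congrArg (fun q => q.2.1) hX) a) b) e
      have h4 : (g a).1 * p.2.1 a b e = p.2.1 a b e * (g b).1 := by
        rw [hgv, hgv, Matrix.add_mul, Matrix.mul_add, Matrix.smul_mul, sub_eq_zero.1 h3]
        simp
      exact (congrArg (· * ((g b)⁻¹).1) h4).trans (hinv b _)
    · have h3 : -(p.2.2 k * X k) = 0 := congrFun (congrArg (fun q => q.2.2) hX) k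
      have h4 : p.2.2 k * (g k).1 = p.2.2 k := by
        rw [hgv, Matrix.mul_add, Matrix.mul_smul, neg_eq_zero.1 h3]; simp
      change p.2.2 k * ((g k)⁻¹).1 = p.2.2 k
      conv_lhs => rw [← h4]
      exact hinv k _
  have h5 := eq_one_of_act_eq_self hc hp hgp
  funext k
  have h6 : (g k).1 = 1 := by rw [h5]; rfl
  rw [hgv, add_eq_left, smul_eq_zero] at h6
  exact h6.resolve_left ht0

theorem scale_mem_level {c : I → ℝ} {p : RepSpace v w} (hp : p ∈ level w (central v c) 0) {t : ℂ}
    (ht : ‖t‖ = 1) : scale t p ∈ level w (central v c) 0 := by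
  rw [mem_level_iff] at hp ⊢
  refine ⟨?_, by rw [muC_scale, hp.2, smul_zero]⟩
  rw [lStar_scale_right, scale_scale, Complex.star_def, Complex.conj_mul', ht]
  simp [scale_one, hp.1]

theorem wt_intCast (n : (k : I) → Fin (v k) → ℤ) (s : Ent v w) :
    wt (fun k i => (n k i : ℝ)) s = (wt n s : ℤ) := by
  rcases s with ⟨a, b, e, i, j⟩ | ⟨k, i, j⟩ | ⟨a, b, e, i, j⟩ | ⟨k, i, j⟩ <;> simp [wt]

/-- The one-parameter group `t ↦ t ^ n` of diagonal gauge transformations. -/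
noncomputable def powG (n : (k : I) → Fin (v k) → ℤ) (t : ℂ) : GaugeC v :=
  expG (Complex.log t) fun k i => (n k i : ℝ)

theorem entry_act_powG (n : (k : I) → Fin (v k) → ℤ) {t : ℂ} (ht : t ≠ 0) (m : RepSpace v w)
    (s : Ent v w) : entry (act (powG n t) m) s = t ^ (wt n s) * entry m s := by
  rw [powG, entry_act_expG, wt_intCast, Complex.ofReal_intCast, mul_comm (Complex.log t),
    Complex.exp_int_mul, Complex.exp_log ht]

theorem int_eq_zero_of_eq_mul_two_pi {a z : ℤ} (h : (a : ℝ) = z * (2 * Real.pi)) : a = 0 := by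
  rcases eq_or_ne z 0 with rfl | hz
  · simpa using h
  · exfalso
    have hz' : (z : ℝ) ≠ 0 := by exact_mod_cast hz
    refine irrational_pi ⟨(a : ℚ) / (z * 2), ?_⟩
    push_cast
    rw [h]
    field_simp

/-- No regularity of `t ↦ g t` is given. The single element `t₀ = exp i`, not a root of unity,
determines the weights, and freeness then identifies every `g t`. -/
theorem exists_weights [DecidableEq I] {c : I → ℝ} (hc : IsGeneric v c) {p₀ : RepSpace v w}
    (hp₀ : p₀ ∈ level w (central v c) 0) {g : ℂ → GaugeC v} (hg : IsFixedBy p₀ g) :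
    ∃ (V : GaugeC v) (n : (k : I) → Fin (v k) → ℤ), IsUnitaryGauge V ∧
      (∀ t : ℂ, t ≠ 0 → g t = V⁻¹ * powG n t * V) ∧
      ∀ s, wt n s + barDeg s ≠ 0 → entry (act V p₀) s = 0 := by
  classical
  have hp₁ := (mem_level_iff c p₀).1 hp₀
  set t₀ : ℂ := Complex.exp Complex.I with ht₀
  have ht₀n : ‖t₀‖ = 1 := by simpa using Complex.norm_exp_ofReal_mul_I 1
  have ht₀0 : t₀ ≠ 0 := Complex.exp_ne_zero _
  have hu : IsUnitaryGauge (g t₀) :=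
    isUnitaryGauge_of_level hc (scale_mem_level hp₀ ht₀n) (by rw [hg t₀ ht₀0]; exact hp₁.1)
  obtain ⟨W, l, hW, hl, hgW⟩ := hu.exists_diagonalize
  set q := act W⁻¹ p₀ with hq
  have hql : q ∈ level w (central v c) 0 := act_mem_level hW.inv hp₀
  have h1 : act (expG Complex.I l) (scale t₀ q) = q := by
    have h2 := hg t₀ ht₀0
    rw [hgW, act_mul, act_mul, act_scale, ← hq] at h2
    conv_rhs => rw [hq, ← h2, act_inv_act]
  have h3 : ∀ s, entry q s ≠ 0 → ∃ z : ℤ, wt l s + barDeg s = z * (2 * Real.pi) := by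
    intro s hs
    have h4 := congrArg (fun q => entry q s) h1
    simp only [entry_act_expG, entry_scale] at h4
    rw [← mul_assoc, ht₀, ← Complex.exp_int_mul, ← Complex.exp_add] at h4
    refine exp_I_mul_eq_one (mul_right_cancel₀ hs (Eq.trans ?_ (one_mul _).symm))
    rw [← h4]
    congr 2
    push_cast
    ring
  -- Each weight of a nonzero entry is an integer plus a multiple of `2π`; the aim is to show that
  -- every angle has this form.
  let L : AddSubgroup ℝ := AddSubgroup.closure {1, 2 * Real.pi}
  have hL1 : ∀ z : ℤ, (z : ℝ) ∈ L := fun z => by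
    have := L.zsmul_mem (AddSubgroup.subset_closure (by simp : (1 : ℝ) ∈ _)) z
    simpa using this
  have hL2 : ∀ z : ℤ, (z : ℝ) * (2 * Real.pi) ∈ L := fun z => by
    have := L.zsmul_mem
      (AddSubgroup.subset_closure (by simp : 2 * Real.pi ∈ ({1, 2 * Real.pi} : Set ℝ))) z
    simpa using this
  have hwL : ∀ s, entry q s ≠ 0 → wt l s ∈ L := fun s hs => by
    obtain ⟨z, hz⟩ := h3 s hs
    rw [show wt l s = z * (2 * Real.pi) - (barDeg s : ℤ) by rw [← hz]; simp]
    exact L.sub_mem (hL2 z) (hL1 _)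
  have hall : ∀ k i, l k i ∈ L := by
    -- The indicator of angles outside `L` has weight zero on all nonzero entries: arrows join
    -- angles in the same class, and the framing meets only angles in `L`. Genericity makes the
    -- indicator vanish.
    have h5 := weight_eq_zero_of_level hc hql
      (fun k i => if l k i ∈ L then (0 : ℝ) else 1) fun s hs => by
        by_contra hne
        have h6 := hwL s hne
        apply hs
        rcases s with ⟨a, b, e, i, j⟩ | ⟨k, i, j⟩ | ⟨a, b, e, i, j⟩ | ⟨k, i, j⟩
        · simp only [wt] at h6 ⊢
          have : l b i ∈ L ↔ l a j ∈ L := by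
            constructor <;> intro h7
            · simpa using L.sub_mem h7 h6
            · simpa using L.add_mem h6 h7
          simp [this]
        · simp only [wt] at h6 ⊢
          simp [h6]
        · simp only [wt] at h6 ⊢
          have : l a i ∈ L ↔ l b j ∈ L := by
            constructor <;> intro h7
            · simpa using L.sub_mem h7 h6
            · simpa using L.add_mem h6 h7
          simp [this]
        · simp only [wt] at h6 ⊢
          simp [L.neg_mem_iff.1 h6]
    intro k i
    have h6 := congrFun (congrFun h5 k) i
    by_contra h7
    simp [h7] at h6
  have hnm : ∀ k i, ∃ a b : ℤ, (a : ℝ) + b * (2 * Real.pi) = l k i := fun k i => by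
    obtain ⟨a, b, h⟩ := AddSubgroup.mem_closure_pair.1 (hall k i)
    exact ⟨a, b, by simpa using h⟩
  choose n m hnm using hnm
  have hwt : ∀ s : Ent v w, wt l s = (wt n s : ℤ) + (wt m s : ℤ) * (2 * Real.pi) := by
    intro s
    rcases s with ⟨a, b, e, i, j⟩ | ⟨k, i, j⟩ | ⟨a, b, e, i, j⟩ | ⟨k, i, j⟩ <;>
      simp [wt, ← hnm] <;> ring
  have hsupp : ∀ s, wt n s + barDeg s ≠ 0 → entry q s = 0 := fun s hs => by
    by_contra hne
    obtain ⟨z, hz⟩ := h3 s hne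
    -- Irrationality of `π` separates the integer part from the multiple of `2π`.
    refine hs (int_eq_zero_of_eq_mul_two_pi (z := z - wt m s) ?_)
    rw [hwt] at hz
    push_cast
    linarith
  refine ⟨W⁻¹, n, hW.inv, fun t ht => ?_, hsupp⟩
  have h5 : act (powG n t) (scale t q) = q := by
    refine entry_ext fun s => ?_
    rw [entry_act_powG n ht, entry_scale, ← mul_assoc, ← zpow_add₀ ht]
    by_cases h6 : wt n s + barDeg s = 0
    · rw [h6, zpow_zero, one_mul]
    · rw [hsupp s h6, mul_zero]
  have h6 : act (W * powG n t * W⁻¹) (scale t p₀) = p₀ := by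
    rw [act_mul, act_mul, act_scale, ← hq, h5, hq, act_act_inv]
  have h7 : act (g t * (W * powG n t * W⁻¹)⁻¹) p₀ = p₀ := by
    conv_lhs => rw [← h6]
    rw [act_mul, act_inv_act, hg t ht]
  have h8 := eq_one_of_act_eq_self hc hp₀ h7
  rw [inv_inv]
  exact mul_inv_eq_one.1 h8

end FixedPoint

/-! ### Topology of the target variety -/

section Target

variable {I : Type*} [Fintype I] [Quiver I] [∀ a b : I, Fintype (a ⟶ b)] {v w : I → ℕ}

/-- The level set whose quotient is the target variety. -/
abbrev TargetLevel (v w : I → ℕ) (c : I → ℝ) : Set (RepSpace v w) :=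
  level w (0 : LieC v) ((-2 * Complex.I) • central v c)

/-- The class of a point of the target level set. -/
noncomputable def toTarget {c : I → ℝ} (r : TargetLevel v w c) : TargetVariety v w c := Quotient.mk _ r

theorem toTarget_eq_iff {c : I → ℝ} {r r' : TargetLevel v w c} :
    toTarget r = toTarget r' ↔ ∃ g : GaugeC v, IsUnitaryGauge g ∧ act g r.1 = r'.1 :=
  Quotient.eq (r := gaugeSetoid w (0 : LieC v) ((-2 * Complex.I) • central v c))

theorem toTarget_surjective {c : I → ℝ} (q : TargetVariety v w c) :
    ∃ r : TargetLevel v w c, toTarget r = q := Quotient.exists_rep q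

theorem isOpen_toTarget_preimage_iff {c : I → ℝ} {N : Set (TargetVariety v w c)} :
    IsOpen (toTarget ⁻¹' N) ↔ IsOpen N := Iff.rfl

theorem toTarget_eq_of_orbit {c : I → ℝ} {r r' : TargetLevel v w c} {g : GaugeC v}
    (h : act g r.1 = r'.1) : toTarget r = toTarget r' := by
  have h1 := (mem_target_iff c _).1 r.2
  have h2 := (mem_target_iff c _).1 r'.2
  rw [← twoC_zero] at h1 h2
  obtain ⟨u, hu, hur⟩ := exists_unitary_of_lStar_eq h1.1 (g := g) (by rw [h]; exact h2.1)
  exact toTarget_eq_iff.2 ⟨u, hu, hur.trans h⟩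

/-- The tube lemma for the compact gauge group: the points whose whole orbit lies in `O` form an
open set. -/
theorem isOpen_saturated {c : I → ℝ} {O : Set (RepSpace v w)} (hO : IsOpen O) :
    IsOpen {q : TargetVariety v w c | ∀ r : TargetLevel v w c, toTarget r = q → r.1 ∈ O} := by
  rw [← isOpen_toTarget_preimage_iff]
  have h1 : toTarget ⁻¹' {q : TargetVariety v w c |
      ∀ r : TargetLevel v w c, toTarget r = q → r.1 ∈ O} =
      {r : TargetLevel v w c | ∀ u ∈ (Set.univ : Set (UnitaryGauge v)),
        act (unitG u) r.1 ∈ O} := by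
    ext r
    constructor
    · intro h u _
      exact h ⟨act (unitG u) r.1, act_mem_target (isUnitaryGauge_unitG u) r.2⟩
        (toTarget_eq_iff.2 ⟨unitG u, isUnitaryGauge_unitG u, rfl⟩).symm
    · intro h r' hr'
      obtain ⟨g, hg, hgr⟩ := toTarget_eq_iff.1 hr'.symm
      obtain ⟨u, rfl⟩ := hg.exists_unitG
      rw [← hgr]
      exact h u (Set.mem_univ _)
  rw [h1, isOpen_iff_eventually]
  intro r hr
  refine isCompact_univ.eventually_forall_of_forall_eventually fun u hu => ?_
  have hcont : Continuous fun y : TargetLevel v w c × UnitaryGauge v =>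
      act (unitG y.2) y.1.1 :=
    continuous_act_unitG continuous_snd (continuous_subtype_val.comp continuous_fst)
  exact (hO.preimage hcont).mem_nhds (hr u hu)

/-- Compact orbits have disjoint open neighbourhoods in `M`, and these shrink to saturated ones.
Hausdorffness gives uniqueness of the conformal limit. -/
instance t2Space_target (c : I → ℝ) : T2Space (TargetVariety v w c) := by
  refine ⟨fun q q' hne => ?_⟩
  obtain ⟨r, rfl⟩ := toTarget_surjective q
  obtain ⟨r', rfl⟩ := toTarget_surjective q'
  have hcpt : ∀ r : TargetLevel v w c,
      IsCompact (Set.range fun u : UnitaryGauge v => act (unitG u) r.1) := fun r =>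
    isCompact_range (continuous_act_unitG continuous_id continuous_const)
  have hdisj : Disjoint (Set.range fun u : UnitaryGauge v => act (unitG u) r.1)
      (Set.range fun u : UnitaryGauge v => act (unitG u) r'.1) := by
    rw [Set.disjoint_left]
    rintro _ ⟨u, rfl⟩ ⟨u', hu'⟩
    simp only at hu'
    refine hne (toTarget_eq_iff.2 ⟨(unitG u')⁻¹ * unitG u,
      (isUnitaryGauge_unitG u').inv.mul (isUnitaryGauge_unitG u), ?_⟩)
    rw [act_mul, ← hu', act_inv_act]
  obtain ⟨O, O', hO, hO', hrO, hrO', hOO'⟩ :=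
    SeparatedNhds.of_isCompact_isCompact (hcpt r) (hcpt r') hdisj
  have hmem : ∀ (r : TargetLevel v w c) (O : Set (RepSpace v w)),
      (Set.range fun u : UnitaryGauge v => act (unitG u) r.1) ⊆ O →
      toTarget r ∈ {q : TargetVariety v w c | ∀ r : TargetLevel v w c, toTarget r = q → r.1 ∈ O} := by
    intro r O h r₁ hr₁
    obtain ⟨g, hg, hgr⟩ := toTarget_eq_iff.1 hr₁.symm
    obtain ⟨u, rfl⟩ := hg.exists_unitG
    exact h ⟨u, hgr⟩
  refine ⟨_, _, isOpen_saturated hO, isOpen_saturated hO', hmem r O hrO, hmem r' O' hrO', ?_⟩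
  rw [Set.disjoint_left]
  intro q hq hq'
  obtain ⟨r₁, hr₁⟩ := toTarget_surjective q
  exact Set.disjoint_left.1 hOO' (hq r₁ hr₁) (hq' r₁ hr₁)

theorem continuous_act_expG {X : Type*} [TopologicalSpace X] {f : X → (k : I) → Fin (v k) → ℝ}
    {g : X → RepSpace v w} (hf : Continuous f) (hg : Continuous g) :
    Continuous fun x => act (expG 1 (f x)) (g x) := by
  simp only [act, actOmega, actOmegaBar, expG]
  have h1 : ∀ k, Continuous fun x =>
      (Matrix.diagonal fun i => Complex.exp (1 * (f x k i : ℂ)) :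
        Matrix (Fin (v k)) (Fin (v k)) ℂ) := fun k => by
    refine Continuous.matrix_diagonal ?_
    fun_prop
  have h2 : ∀ k, Continuous fun x =>
      (Matrix.diagonal fun i => Complex.exp (-(1 * (f x k i : ℂ))) :
        Matrix (Fin (v k)) (Fin (v k)) ℂ) := fun k => by
    refine Continuous.matrix_diagonal ?_
    fun_prop
  refine Continuous.prodMk (Continuous.prodMk ?_ ?_) (Continuous.prodMk ?_ ?_)
  · refine continuous_pi fun a => continuous_pi fun b => continuous_pi fun e => ?_
    exact ((h1 b).matrix_mul (by fun_prop)).matrix_mul (h2 a)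
  · refine continuous_pi fun k => ?_
    exact (h1 k).matrix_mul (by fun_prop)
  · refine continuous_pi fun a => continuous_pi fun b => continuous_pi fun e => ?_
    exact ((h1 a).matrix_mul (by fun_prop)).matrix_mul (h2 b)
  · refine continuous_pi fun k => ?_
    exact Continuous.matrix_mul (by fun_prop) (h2 k)

/-- Continuity of the map from the complex level to the target. Uniform properness confines the
polar data of all normalisations of nearby points to one compact set, on which closedness of the
target level and openness of `O` can be combined. -/
theorem eventually_toTarget_mem [DecidableEq I] {c : I → ℝ} (hc : IsGeneric v c)
    {m₀ : RepSpace v w} (hm₀ : muC m₀ = twoC v c) {r₀ : TargetLevel v w c} {b₀ : GaugeC v}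
    (hb₀ : act b₀ m₀ = r₀.1) {N : Set (TargetVariety v w c)} (hN : N ∈ 𝓝 (toTarget r₀)) :
    ∀ᶠ m in 𝓝 m₀, ∀ r : TargetLevel v w c, (∃ b : GaugeC v, act b m = r.1) → toTarget r ∈ N := by
  obtain ⟨N', hN'N, hN'o, hrN'⟩ := mem_nhds_iff.1 hN
  obtain ⟨O, hO, hON'⟩ := isOpen_induced_iff.1 (isOpen_toTarget_preimage_iff.2 hN'o)
  obtain ⟨S, hS, hev⟩ := (stabAt_of_muC hc hm₀ 0).eventually_nsq_lt_psi
  have hK : IsCompact ((Set.univ : Set (UnitaryGauge v)) ×ˢ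
      Metric.closedBall (0 : (k : I) → Fin (v k) → ℝ) S) :=
    isCompact_univ.prod (isCompact_closedBall _ _)
  have hcont : Continuous fun y : RepSpace v w × (UnitaryGauge v × ((k : I) → Fin (v k) → ℝ)) =>
      act (expG 1 y.2.2) (act (unitG y.2.1) y.1) :=
    continuous_act_expG continuous_snd.snd (continuous_act_unitG continuous_snd.fst continuous_fst)
  have hev' : ∀ᶠ m in 𝓝 m₀, ∀ x ∈ (Set.univ : Set (UnitaryGauge v)) ×ˢ
      Metric.closedBall (0 : (k : I) → Fin (v k) → ℝ) S,
      act (expG 1 x.2) (act (unitG x.1) m) ∈ TargetLevel v w c →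
        act (expG 1 x.2) (act (unitG x.1) m) ∈ O := by
    refine hK.eventually_forall_of_forall_eventually ?_
    rintro ⟨u, l⟩ -
    -- Either the moved point is a normalisation of `m₀`, hence in the class of `r₀` and in the open
    -- set, or it misses the closed target level, as do nearby points.
    by_cases h : act (expG 1 l) (act (unitG u) m₀) ∈ TargetLevel v w c
    · have h1 : toTarget ⟨_, h⟩ = toTarget r₀ :=
        toTarget_eq_of_orbit (g := b₀ * (expG 1 l * unitG u)⁻¹) (by
          change act _ (act (expG 1 l) (act (unitG u) m₀)) = _
          rw [← act_mul (expG 1 l), act_mul b₀, act_inv_act, hb₀])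
      have h2 : (⟨_, h⟩ : TargetLevel v w c) ∈ toTarget ⁻¹' N' := by
        rw [Set.mem_preimage, h1]; exact hrN'
      rw [← hON'] at h2
      filter_upwards [(hO.preimage hcont).mem_nhds
        (x := (m₀, (u, l))) h2] with y hy _
      exact hy
    · filter_upwards [((isClosed_target c).isOpen_compl.preimage hcont).mem_nhds
        (x := (m₀, (u, l))) h] with y hy hy'
      exact absurd hy' hy
  filter_upwards [hev, hev'] with m hm hm' r hr
  obtain ⟨b, hb⟩ := hr
  obtain ⟨u₁, u₂, l, h₁, h₂, rfl⟩ := exists_polar b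
  have hr1 : act u₁⁻¹ r.1 = act (expG 1 l) (act u₂ m) := by
    rw [← hb, mul_assoc, act_mul u₁, act_inv_act, act_mul]
  have hr2 : act u₁⁻¹ r.1 ∈ TargetLevel v w c := act_mem_target h₁.inv r.2
  -- A point with `μ_ℝ = 0` minimises the norm in its orbit, so its norm cannot exceed that of `m`,
  -- as properness would require for larger `l`.
  have hl : ‖l‖ ≤ S := by
    by_contra hlt
    push Not at hlt
    have h3 := hm u₂ h₂ l hlt.le
    have h4 : psi 0 l (act u₂ m) = nsq (act u₁⁻¹ r.1) := by
      rw [psi, hr1]; simp [charPair]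
    have h5 := ((mem_target_iff c _).1 hr2).1
    rw [← twoC_zero] at h5
    have h6 := nsq_le_psi h5 (-l)
    have h7 : act (expG 1 (-l)) (act u₁⁻¹ r.1) = act u₂ m := by
      rw [hr1]
      refine entry_ext fun s => ?_
      have h8 : wt (-l) s = - wt l s := by
        have := wt_smul (-1) l s; simpa using this
      rw [entry_act_expG, entry_act_expG, ← mul_assoc, ← Complex.exp_add, h8]
      simp
    rw [psi, h7, nsq_act h₂] at h6
    have h9 : charPair (0 : I → ℝ) (-l) = 0 := by simp [charPair]
    rw [h9] at h6
    rw [h4] at h3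
    linarith
  obtain ⟨u, rfl⟩ := h₂.exists_unitG
  have h3 := hm' (u, l) ⟨Set.mem_univ _, by simpa using hl⟩ (by rw [← hr1]; exact hr2)
  rw [← hr1] at h3
  have h4 : (⟨_, hr2⟩ : TargetLevel v w c) ∈ toTarget ⁻¹' N' := by rw [← hON']; exact h3
  have h5 : toTarget ⟨_, hr2⟩ = toTarget r := toTarget_eq_iff.2 ⟨u₁, h₁, act_act_inv _ _⟩
  rw [← h5]
  exact hN'N h4

end Target

/-! ### Computing conformal limits from suitable representatives -/

section ConformalLimit

variable {I : Type*} [Fintype I] [DecidableEq I] [Quiver I] [∀ a b : I, Fintype (a ⟶ b)]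
  {v w : I → ℕ}

theorem exists_target {c : I → ℝ} (hc : IsGeneric v c) {m : RepSpace v w}
    (hm : muC m = twoC v c) :
    ∃ (b : GaugeC v) (r : TargetLevel v w c), act b m = r.1 := by
  obtain ⟨b, hb⟩ := (stabAt_of_muC hc hm 0).exists_lStar_eq
  exact ⟨b, ⟨act b m, (mem_target_iff c _).2 ⟨by rw [hb, twoC_zero], muC_act_eq_twoC b hm⟩⟩, rfl⟩

theorem exists_level_scale {c : I → ℝ} (hc : IsGeneric v c) {p : RepSpace v w}
    (hp : p ∈ level w (central v c) 0) {t : ℂ} (ht : t ≠ 0) :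
    ∃ a : GaugeC v, act a (scale t p) ∈ level w (central v c) 0 := by
  obtain ⟨a, ha⟩ := ((stabAt_of_level hc hp).scale ht).exists_lStar_eq
  refine ⟨a, (mem_level_iff c _).2 ⟨ha, muC_act_eq_zero a ?_⟩⟩
  rw [muC_scale, ((mem_level_iff c p).1 hp).2, smul_zero]

theorem exists_isFamilyPoint {c : I → ℝ} (hc : IsGeneric v c) {ħ R : ℝ} (hħ : 0 < ħ) (hR : 0 < R)
    {p : RepSpace v w} (hp : p ∈ level w (central v c) 0) :
    ∃ q : TargetVariety v w c, IsFamilyPoint c ħ R p q := by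
  obtain ⟨a, ha⟩ := exists_level_scale hc hp (t := (R : ℂ)) (by exact_mod_cast hR.ne')
  have h1 := muC_scale_hkRotate ha (mul_pos hħ hR).ne'
  push_cast at h1
  obtain ⟨b, r, hr⟩ := exists_target hc h1
  exact ⟨toTarget r, _, ha, ⟨a, rfl⟩, r, ⟨b, hr⟩, rfl⟩

/-- It suffices to find, for small `R`, some normalisation of `R · m` whose rotated and rescaled
point has an orbit representative near `m₀`. Other choices differ by unitary gauge, which commutes
with the rotation, and the class depends continuously on the representative. -/
theorem isConformalLimit_iff {c : I → ℝ} (hc : IsGeneric v c) {ħ : ℝ} (hħ : 0 < ħ)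
    {m m₀ : RepSpace v w} (hm₀ : muC m₀ = twoC v c) {r₀ : TargetLevel v w c} {b₀ : GaugeC v}
    (hb₀ : act b₀ m₀ = r₀.1)
    (h : ∀ U ∈ 𝓝 m₀, ∀ᶠ R : ℝ in 𝓝[>] 0, ∃ a : GaugeC v,
      act a (scale (R : ℂ) m) ∈ level w (central v c) 0 ∧ ∃ d : GaugeC v,
        act d (scale ((ħ : ℂ) * (R : ℂ))⁻¹
          (hkRotate ((ħ : ℂ) * (R : ℂ)) (act a (scale (R : ℂ) m)))) ∈ U)
    (q : TargetVariety v w c) : IsConformalLimit c ħ m q ↔ q = toTarget r₀ := by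
  have key : ∀ p ∈ level w (central v c) 0, (∃ a : GaugeC v, act a m = p) →
      ∀ F : ℝ → TargetVariety v w c, (∀ R : ℝ, 0 < R → IsFamilyPoint c ħ R p (F R)) →
        Tendsto F (𝓝[>] 0) (𝓝 (toTarget r₀)) := by
    rintro p hp ⟨a₀, rfl⟩ F hF
    intro N hN
    rw [Filter.mem_map]
    have h1 := h _ (eventually_toTarget_mem hc hm₀ hb₀ hN)
    filter_upwards [h1, self_mem_nhdsWithin] with R hR hR0
    obtain ⟨a, ha, d, hd⟩ := hR
    obtain ⟨pR, hpR, ⟨a', ha'⟩, r, ⟨b, hb⟩, hFR⟩ := hF R hR0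
    rw [Set.mem_preimage, hFR]
    refine hd r ?_
    -- the two normalisations of the scaled point differ by a unitary gauge transformation
    have h2 : act (a' * a₀ * a⁻¹) (act a (scale (R : ℂ) m)) = pR := by
      rw [act_mul, act_inv_act, act_mul, act_scale a₀, ha']
    obtain ⟨u, hu, hua⟩ := exists_unitary_of_lStar_eq ((mem_level_iff c _).1 ha).1
      (g := a' * a₀ * a⁻¹) (by rw [h2]; exact ((mem_level_iff c _).1 hpR).1)
    rw [h2] at hua
    refine ⟨b * u * d⁻¹, ?_⟩
    rw [act_mul, act_inv_act, act_mul, act_scale, ← hb, ← hua]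
    have h3 := hkRotate_act (ħ * R) hu (act a (scale (R : ℂ) m))
    push_cast at h3
    rw [h3]
  constructor
  · rintro ⟨p, hp, hap, F, hF, hlim⟩
    exact tendsto_nhds_unique hlim (key p hp hap F hF)
  · rintro rfl
    -- A representative of `m` itself on the level set comes from one radius `R`, by undoing the
    -- scaling and normalising again.
    obtain ⟨R, ⟨a, ha, -⟩, hR⟩ :=
      ((h _ Filter.univ_mem).and self_mem_nhdsWithin).exists
    have hR0 : (R : ℂ) ≠ 0 := by exact_mod_cast (ne_of_gt hR)
    obtain ⟨a', ha'⟩ := exists_level_scale hc ha (inv_ne_zero hR0)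
    have h1 : act a' (scale (R : ℂ)⁻¹ (act a (scale (R : ℂ) m))) = act (a' * a) m := by
      rw [← act_scale, scale_scale, inv_mul_cancel₀ hR0, scale_one, act_mul]
    rw [h1] at ha'
    have hex : ∀ R : ℝ, ∃ q : TargetVariety v w c, 0 < R → IsFamilyPoint c ħ R (act (a' * a) m) q :=
      fun R => by
        by_cases hR : 0 < R
        · obtain ⟨q, hq⟩ := exists_isFamilyPoint hc hħ hR ha'
          exact ⟨q, fun _ => hq⟩
        · exact ⟨toTarget r₀, fun h => absurd h hR⟩
    choose F hF using hex
    exact ⟨_, ha', ⟨_, rfl⟩, F, hF, key _ ha' ⟨_, rfl⟩ F hF⟩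

theorem isConformalLimit_act (c : I → ℝ) (ħ : ℝ) (g : GaugeC v) (m : RepSpace v w)
    (q : TargetVariety v w c) : IsConformalLimit c ħ (act g m) q ↔ IsConformalLimit c ħ m q := by
  constructor
  · rintro ⟨p, hp, ⟨a, ha⟩, h⟩
    exact ⟨p, hp, ⟨a * g, by rw [act_mul, ha]⟩, h⟩
  · rintro ⟨p, hp, ⟨a, ha⟩, h⟩
    exact ⟨p, hp, ⟨a * g⁻¹, by rw [act_mul, act_inv_act, ha]⟩, h⟩

end ConformalLimit

/-! ### The grading by the weights of a fixed point -/

section Graded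

variable {I : Type*} [Quiver I] {v w : I → ℕ}

/-- The degree of a matrix entry for the action of `t` through `t ^ n` composed with the scaling. -/
def tdeg (n : (k : I) → Fin (v k) → ℤ) (s : Ent v w) : ℤ := wt n s + barDeg s

/-- The point of `M` with given matrix entries. -/
def ofEntry (f : Ent v w → ℂ) : RepSpace v w :=
  ((fun a b e => Matrix.of fun i j => f (.inl ⟨a, b, e, i, j⟩),
    fun k => Matrix.of fun i j => f (.inr (.inl ⟨k, i, j⟩))),
   (fun a b e => Matrix.of fun i j => f (.inr (.inr (.inl ⟨a, b, e, i, j⟩))),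
    fun k => Matrix.of fun i j => f (.inr (.inr (.inr ⟨k, i, j⟩)))))

@[simp] theorem entry_ofEntry (f : Ent v w → ℂ) (s : Ent v w) : entry (ofEntry f) s = f s := by
  rcases s with ⟨a, b, e, i, j⟩ | ⟨k, i, j⟩ | ⟨a, b, e, i, j⟩ | ⟨k, i, j⟩ <;> rfl

/-- The grading action, extended to `S = 0` on elements of nonnegative degree. -/
noncomputable def tau (n : (k : I) → Fin (v k) → ℤ) (S : ℝ) (q : RepSpace v w) : RepSpace v w :=
  ofEntry fun s => (S : ℂ) ^ (tdeg n s).toNat * entry q s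

theorem entry_tau (n : (k : I) → Fin (v k) → ℤ) (S : ℝ) (q : RepSpace v w) (s : Ent v w) :
    entry (tau n S q) s = (S : ℂ) ^ (tdeg n s).toNat * entry q s := entry_ofEntry _ _

/-- All entries of `z` have nonnegative degree. -/
def IsNonneg (n : (k : I) → Fin (v k) → ℤ) (z : RepSpace v w) : Prop :=
  ∀ s, tdeg n s < 0 → entry z s = 0

/-- `X` has no component of degree less than `d`. -/
def DegGE (n : (k : I) → Fin (v k) → ℤ) (d : ℤ) (X : LieC v) : Prop :=
  ∀ k i j, n k i - n k j < d → X k i j = 0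

/-- Degrees add under products. As `X` starts in degree `d` and `m` in degree 0, up to degree `d`
only their lowest parts `Z` and `p` contribute. -/
theorem entry_lact_of_le {n : (k : I) → Fin (v k) → ℤ} {d : ℤ} {X Z : LieC v}
    (hX : DegGE n d X) (hZ : ∀ k i j, Z k i j = if n k i - n k j = d then X k i j else 0)
    {m p : RepSpace v w} (hm : IsNonneg n m)
    (hp : ∀ s, entry p s = if tdeg n s = 0 then entry m s else 0) {s : Ent v w}
    (hs : tdeg n s ≤ d) : entry (lact X m) s = entry (lact Z p) s := by
  have key : ∀ k i j s', n k i - n k j + tdeg n s' ≤ d →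
      X k i j * entry m s' = Z k i j * entry p s' := by
    intro k i j s' h
    rw [hZ, hp]
    rcases lt_trichotomy (n k i - n k j) d with h1 | h1 | h1
    · rw [hX k i j h1, if_neg h1.ne, zero_mul, zero_mul]
    · rw [if_pos h1]
      rcases lt_or_eq_of_le (show tdeg n s' ≤ 0 by omega) with h2 | h2
      · rw [hm s' h2]; simp
      · rw [if_pos h2]
    · rw [hm s' (by omega)]; simp
  rcases s with ⟨a, b, e, i, j⟩ | ⟨k, i, j⟩ | ⟨a, b, e, i, j⟩ | ⟨k, i, j⟩
  · simp only [entry, lact, Matrix.sub_apply, Matrix.mul_apply, tdeg, wt, barDeg] at hs ⊢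
    congr 1
    · exact Finset.sum_congr rfl fun l _ => key b i l (.inl ⟨a, b, e, l, j⟩)
        (by simp only [tdeg, wt, barDeg]; omega)
    · refine Finset.sum_congr rfl fun l _ => ?_
      rw [mul_comm, mul_comm (p.1.1 a b e i l)]
      exact key a l j (.inl ⟨a, b, e, i, l⟩) (by simp only [tdeg, wt, barDeg]; omega)
  · simp only [entry, lact, Matrix.mul_apply, tdeg, wt, barDeg] at hs ⊢
    exact Finset.sum_congr rfl fun l _ => key k i l (.inr (.inl ⟨k, l, j⟩))
        (by simp only [tdeg, wt, barDeg]; omega)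
  · simp only [entry, lact, Matrix.sub_apply, Matrix.mul_apply, tdeg, wt, barDeg] at hs ⊢
    congr 1
    · exact Finset.sum_congr rfl fun l _ => key a i l (.inr (.inr (.inl ⟨a, b, e, l, j⟩)))
        (by simp only [tdeg, wt, barDeg]; omega)
    · refine Finset.sum_congr rfl fun l _ => ?_
      rw [mul_comm, mul_comm (p.2.1 a b e i l)]
      exact key b l j (.inr (.inr (.inl ⟨a, b, e, i, l⟩)))
        (by simp only [tdeg, wt, barDeg]; omega)
  · simp only [entry, lact, Matrix.neg_apply, Matrix.mul_apply, tdeg, wt, barDeg] at hs ⊢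
    congr 1
    refine Finset.sum_congr rfl fun l _ => ?_
    rw [mul_comm, mul_comm (p.2.2 k i l)]
    exact key k l j (.inr (.inr (.inr ⟨k, i, l⟩))) (by simp only [tdeg, wt, barDeg]; omega)

theorem entry_lact_of_ne {n : (k : I) → Fin (v k) → ℤ} {d : ℤ} {Z : LieC v}
    (hZ : ∀ k i j, n k i - n k j ≠ d → Z k i j = 0) {p : RepSpace v w}
    (hp : ∀ s, tdeg n s ≠ 0 → entry p s = 0) {s : Ent v w}
    (hs : tdeg n s ≠ d) : entry (lact Z p) s = 0 := by
  have key : ∀ k i j s', n k i - n k j + tdeg n s' ≠ d → Z k i j * entry p s' = 0 := by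
    intro k i j s' h
    by_cases h1 : n k i - n k j = d
    · rw [hp s' (by omega), mul_zero]
    · rw [hZ k i j h1, zero_mul]
  rcases s with ⟨a, b, e, i, j⟩ | ⟨k, i, j⟩ | ⟨a, b, e, i, j⟩ | ⟨k, i, j⟩
  · simp only [entry, lact, Matrix.sub_apply, Matrix.mul_apply, tdeg, wt, barDeg] at hs ⊢
    refine (congrArg₂ (· - ·) (Finset.sum_eq_zero fun l _ => key b i l (.inl ⟨a, b, e, l, j⟩)
        (by simp only [tdeg, wt, barDeg]; omega)) (Finset.sum_eq_zero fun l _ => ?_)).trans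
      (sub_zero 0)
    rw [mul_comm]
    exact key a l j (.inl ⟨a, b, e, i, l⟩) (by simp only [tdeg, wt, barDeg]; omega)
  · simp only [entry, lact, Matrix.mul_apply, tdeg, wt, barDeg] at hs ⊢
    exact Finset.sum_eq_zero fun l _ => key k i l (.inr (.inl ⟨k, l, j⟩))
        (by simp only [tdeg, wt, barDeg]; omega)
  · simp only [entry, lact, Matrix.sub_apply, Matrix.mul_apply, tdeg, wt, barDeg] at hs ⊢
    refine (congrArg₂ (· - ·) (Finset.sum_eq_zero fun l _ =>
      key a i l (.inr (.inr (.inl ⟨a, b, e, l, j⟩))) (by simp only [tdeg, wt, barDeg]; omega))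
      (Finset.sum_eq_zero fun l _ => ?_)).trans (sub_zero 0)
    rw [mul_comm]
    exact key b l j (.inr (.inr (.inl ⟨a, b, e, i, l⟩))) (by simp only [tdeg, wt, barDeg]; omega)
  · simp only [entry, lact, Matrix.neg_apply, Matrix.mul_apply, tdeg, wt, barDeg] at hs ⊢
    rw [neg_eq_zero]
    refine Finset.sum_eq_zero fun l _ => ?_
    rw [mul_comm]
    exact key k l j (.inr (.inr (.inr ⟨k, i, l⟩))) (by simp only [tdeg, wt, barDeg]; omega)

theorem IsNonneg.act₂ {n : (k : I) → Fin (v k) → ℤ} {K K' : LieC v} (hK : DegGE n 0 K)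
    (hK' : DegGE n 0 K') {m : RepSpace v w} (hm : IsNonneg n m) : IsNonneg n (act₂ K K' m) := by
  have key : ∀ k i j s', n k i - n k j + tdeg n s' < 0 → K k i j * entry m s' = 0 := by
    intro k i j s' h
    rcases lt_or_ge (n k i - n k j) 0 with h1 | h1
    · rw [hK k i j h1, zero_mul]
    · rw [hm s' (by omega), mul_zero]
  have key' : ∀ k i j s', n k i - n k j + tdeg n s' < 0 → entry m s' * K' k i j = 0 := by
    intro k i j s' h
    rcases lt_or_ge (n k i - n k j) 0 with h1 | h1
    · rw [hK' k i j h1, mul_zero]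
    · rw [hm s' (by omega), zero_mul]
  intro s hs
  rcases s with ⟨a, b, e, i, j⟩ | ⟨k, i, j⟩ | ⟨a, b, e, i, j⟩ | ⟨k, i, j⟩
  · simp only [entry, NakajimaQuiver.act₂, Matrix.mul_apply, tdeg, wt, barDeg] at hs ⊢
    refine Finset.sum_eq_zero fun l' _ => ?_
    rcases lt_or_ge (n a l' - n a j) 0 with h | h
    · rw [hK' a l' j h, mul_zero]
    · exact (congrArg (· * _) (Finset.sum_eq_zero fun l _ => key b i l (.inl ⟨a, b, e, l, l'⟩)
        (by simp only [tdeg, wt, barDeg]; omega))).trans (zero_mul _)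
  · simp only [entry, NakajimaQuiver.act₂, Matrix.mul_apply, tdeg, wt, barDeg] at hs ⊢
    exact Finset.sum_eq_zero fun l _ => key k i l (.inr (.inl ⟨k, l, j⟩))
        (by simp only [tdeg, wt, barDeg]; omega)
  · simp only [entry, NakajimaQuiver.act₂, Matrix.mul_apply, tdeg, wt, barDeg] at hs ⊢
    refine Finset.sum_eq_zero fun l' _ => ?_
    rcases lt_or_ge (n b l' - n b j) 0 with h | h
    · rw [hK' b l' j h, mul_zero]
    · exact (congrArg (· * _) (Finset.sum_eq_zero fun l _ =>
        key a i l (.inr (.inr (.inl ⟨a, b, e, l, l'⟩)))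
        (by simp only [tdeg, wt, barDeg]; omega))).trans (zero_mul _)
  · simp only [entry, NakajimaQuiver.act₂, Matrix.mul_apply, tdeg, wt, barDeg] at hs ⊢
    exact Finset.sum_eq_zero fun l _ => key' k l j (.inr (.inr (.inr ⟨k, i, l⟩)))
        (by simp only [tdeg, wt, barDeg]; omega)

end Graded

/-! ### The rescaled real moment map equation -/

section GradedMoment

variable {I : Type*} [Fintype I] [Quiver I] [∀ a b : I, Fintype (a ⟶ b)] {v w : I → ℕ}

theorem act_powG_scale_eq_tau {n : (k : I) → Fin (v k) → ℤ} {R : ℝ} (hR : 0 < R)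
    {z : RepSpace v w} (hz : IsNonneg n z) :
    act (powG n (R : ℂ)) (scale (R : ℂ) z) = tau n R z := by
  have hR0 : (R : ℂ) ≠ 0 := by exact_mod_cast hR.ne'
  refine entry_ext fun s => ?_
  rw [entry_act_powG n hR0, entry_scale, entry_tau, ← mul_assoc, ← zpow_add₀ hR0]
  rcases lt_or_ge (tdeg n s) 0 with h | h
  · rw [hz s h]; simp
  · rw [← zpow_natCast, Int.toNat_of_nonneg h, tdeg]

theorem scale_act_powG_eq_tau_sq {n : (k : I) → Fin (v k) → ℤ} {R : ℝ} (hR : 0 < R)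
    {z : RepSpace v w} (hz : IsNonneg n z) :
    scale (R : ℂ) (act (powG n (R : ℂ)) (act (powG n (R : ℂ)) (scale (R : ℂ) z))) =
      tau n (R ^ 2) z := by
  have hR0 : (R : ℂ) ≠ 0 := by exact_mod_cast hR.ne'
  refine entry_ext fun s => ?_
  simp only [entry_act_powG n hR0, entry_scale, entry_tau]
  rcases lt_or_ge (tdeg n s) 0 with h | h
  · rw [hz s h]; simp
  · obtain ⟨t, ht⟩ := Int.eq_ofNat_of_zero_le h
    have h2 : (R : ℂ) ^ barDeg s * ((R : ℂ) ^ wt n s * ((R : ℂ) ^ wt n s *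
        ((R : ℂ) ^ barDeg s * entry z s))) = ((R : ℂ) ^ tdeg n s) ^ 2 * entry z s := by
      rw [tdeg, zpow_add₀ hR0]; ring
    rw [h2, ht]
    push_cast
    rw [Int.toNat_natCast, zpow_natCast, ← pow_mul, ← pow_mul, mul_comm 2]

theorem conjTranspose_powG (n : (k : I) → Fin (v k) → ℤ) {R : ℝ} (hR : 0 < R) (k : I) :
    (powG n (R : ℂ) k).1ᴴ = (powG n (R : ℂ) k).1 := by
  simp only [powG, expG, Matrix.diagonal_conjTranspose]
  congr 1
  funext i
  rw [Pi.star_apply, ← Complex.ofReal_log hR.le, ← Complex.ofReal_mul, ← Complex.ofReal_exp]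
  exact Complex.conj_ofReal _

theorem conjTranspose_powG_inv (n : (k : I) → Fin (v k) → ℤ) {R : ℝ} (hR : 0 < R) (k : I) :
    (((powG n (R : ℂ))⁻¹) k).1ᴴ = ((powG n (R : ℂ) k)⁻¹).1 := by
  have h1 : (((powG n (R : ℂ))⁻¹) k).1 =
    Matrix.diagonal fun i => Complex.exp (-(Complex.log R * ((n k i : ℝ) : ℂ))) := rfl
  have h2 : ((powG n (R : ℂ) k)⁻¹).1 =
    Matrix.diagonal fun i => Complex.exp (-(Complex.log R * ((n k i : ℝ) : ℂ))) := rfl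
  rw [h1, h2, Matrix.diagonal_conjTranspose]
  congr 1
  funext i
  rw [Pi.star_apply, ← Complex.ofReal_log hR.le, ← Complex.ofReal_mul, ← Complex.ofReal_neg,
    ← Complex.ofReal_exp]
  exact Complex.conj_ofReal _

/-- Since `R ^ n` is Hermitian, the first argument should move by `R ^ (-n)`; compensating this, and
moving the scaling across, multiplies its degree `e` part by `R ^ (2 e)`. Only nonnegative powers
occur, so the right factor makes sense at `R = 0`. -/
theorem lStar_act_powG {n : (k : I) → Fin (v k) → ℤ} {R : ℝ} (hR : 0 < R) {z : RepSpace v w}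
    (hz : IsNonneg n z) (q : RepSpace v w) (k : I) :
    lStar (act (powG n (R : ℂ)) (scale (R : ℂ) z)) (act (powG n (R : ℂ)) (scale (R : ℂ) q)) k =
      (powG n (R : ℂ) k).1 * lStar (tau n (R ^ 2) z) q k * ((powG n (R : ℂ) k)⁻¹).1 := by
  have h1 : act (powG n (R : ℂ)) (scale (R : ℂ) z) = act (powG n (R : ℂ))⁻¹
      (act (powG n (R : ℂ)) (act (powG n (R : ℂ)) (scale (R : ℂ) z))) := (act_inv_act _ _).symm
  rw [h1, lStar_act (conjTranspose_powG_inv n hR), lStar_scale_right, Complex.star_def,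
    Complex.conj_ofReal, scale_act_powG_eq_tau_sq hR hz]

/-- The projection onto the real subspace of matrices of nonnegative degree with hermitian
component of degree zero. -/
noncomputable def projL (n : (k : I) → Fin (v k) → ℤ) : LieC v →ₗ[ℝ] LieC v where
  toFun X k := Matrix.of fun i j => if n k j < n k i then X k i j else
    if n k i = n k j then (X k i j + star (X k j i)) / 2 else 0
  map_add' X Y := by
    funext k; ext i j
    simp only [Matrix.of_apply, Pi.add_apply, Matrix.add_apply, star_add]
    split_ifs <;> ring
  map_smul' t X := by
    funext k; ext i j
    simp only [Matrix.of_apply, Pi.smul_apply, Matrix.smul_apply, RingHom.id_apply,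
      Complex.real_smul, star_mul', Complex.star_def, Complex.conj_ofReal]
    split_ifs <;> ring

theorem projL_apply (n : (k : I) → Fin (v k) → ℤ) (X : LieC v) (k : I) (i j : Fin (v k)) :
    projL n X k i j = if n k j < n k i then X k i j else
      if n k i = n k j then (X k i j + star (X k j i)) / 2 else 0 := rfl

theorem projL_projL (n : (k : I) → Fin (v k) → ℤ) (X : LieC v) :
    projL n (projL n X) = projL n X := by
  funext k; ext i j
  simp only [projL_apply]
  by_cases h1 : n k j < n k i
  · simp [h1]
  · by_cases h2 : n k i = n k j
    · simp [h2]
      ring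
    · simp [h1, h2]

theorem degGE_projL (n : (k : I) → Fin (v k) → ℤ) (X : LieC v) : DegGE n 0 (projL n X) := by
  intro k i j h
  rw [projL_apply, if_neg (by omega), if_neg (by omega)]

/-- Conjugation by `R ^ n` rescales each degree separately. The moment map of the moved point is
Hermitian, so its negative degrees follow from the positive ones and half of the equations suffice.
-/
theorem lStar_eq_twoC_of_projL {n : (k : I) → Fin (v k) → ℤ} {R : ℝ} (hR : 0 < R)
    {c : I → ℝ} {z : RepSpace v w} (hz : IsNonneg n z)
    (h : projL n (lStar (tau n (R ^ 2) z) z - twoC v c) = 0) :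
    lStar (act (powG n (R : ℂ)) (scale (R : ℂ) z)) (act (powG n (R : ℂ)) (scale (R : ℂ) z)) =
      twoC v c := by
  have hR0 : (R : ℂ) ≠ 0 := by exact_mod_cast hR.ne'
  set P := act (powG n (R : ℂ)) (scale (R : ℂ) z)
  set L := lStar (tau n (R ^ 2) z) z with hL
  have h1 : ∀ k i j, lStar P P k i j = (R : ℂ) ^ (n k i - n k j) * L k i j := by
    intro k i j
    rw [lStar_act_powG hR hz]
    have e1 : (powG n (R : ℂ) k).1 = Matrix.diagonal fun i => (R : ℂ) ^ n k i := by
      simp only [powG, expG]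
      congr 1; funext i
      rw [Complex.ofReal_intCast, mul_comm, Complex.exp_int_mul, Complex.exp_log hR0]
    have e2 : ((powG n (R : ℂ) k)⁻¹).1 = Matrix.diagonal fun i => ((R : ℂ) ^ n k i)⁻¹ := by
      have : ((powG n (R : ℂ) k)⁻¹).1 =
        Matrix.diagonal fun i => Complex.exp (-(Complex.log R * ((n k i : ℝ) : ℂ))) := rfl
      rw [this]
      congr 1; funext i
      rw [Complex.exp_neg, Complex.ofReal_intCast, mul_comm, Complex.exp_int_mul,
        Complex.exp_log hR0]
    rw [e1, e2, Matrix.mul_diagonal, Matrix.diagonal_mul, zpow_sub₀ hR0]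
    ring
  have h2 : ∀ k i j, star (lStar P P k j i) = lStar P P k i j := fun k i j =>
    congrFun (congrFun (conjTranspose_lStar P P k) i) j
  have htw : ∀ k i j, i ≠ j → twoC v c k i j = 0 := fun k i j hij => by
    simp [twoC, Matrix.one_apply_ne hij]
  have h3 : ∀ k i j, n k j < n k i → lStar P P k i j = 0 := by
    intro k i j hij
    have h4 := congrFun (congrFun (congrFun h k) i) j
    rw [projL_apply, if_pos hij] at h4
    have h5 : L k i j - twoC v c k i j = 0 := h4
    rw [htw k i j (by rintro rfl; exact lt_irrefl _ hij), sub_zero] at h5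
    rw [h1, h5, mul_zero]
  funext k
  ext i j
  rcases lt_trichotomy (n k j) (n k i) with hij | hij | hij
  · rw [h3 k i j hij, htw k i j (by rintro rfl; exact lt_irrefl _ hij)]
  · have h4 := congrFun (congrFun (congrFun h k) i) j
    rw [projL_apply, if_neg (by omega), if_pos hij.symm] at h4
    have h5 : ((L k i j - twoC v c k i j) + star (L k j i - twoC v c k j i)) / 2 = 0 := h4
    have h6 : ∀ i j, n k i = n k j → L k i j = lStar P P k i j := fun i j hij => by
      rw [h1, hij, sub_self, zpow_zero, one_mul]
    have h7 : star (twoC v c k j i) = twoC v c k i j := by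
      simp only [twoC, Matrix.smul_apply, smul_eq_mul, star_mul', Matrix.one_apply, eq_comm (a := j)]
      split_ifs <;> simp
    rw [h6 i j hij.symm, h6 j i hij, star_sub, h2, h7] at h5
    linear_combination h5
  · rw [← h2, h3 k j i hij, htw k i j (by rintro rfl; exact lt_irrefl _ hij), star_zero]

end GradedMoment

/-! ### An existence form of the implicit function theorem -/

section ImplicitFunction

/-- The map `(S, x) ↦ (S, f (S, x))` has injective, hence by finite dimension surjective, derivative
at 0, so it sends neighbourhoods of 0 onto neighbourhoods. -/
theorem eventually_exists_eq_zero_of_injective {F : Type*} [NormedAddCommGroup F] [NormedSpace ℝ F]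
    [FiniteDimensional ℝ F] {f : ℝ × F → F} (hf : ContDiffAt ℝ 1 f 0) (h0 : f 0 = 0)
    (hinj : ∀ x : F, HasDerivAt (fun t : ℝ => f (0, t • x)) 0 0 → x = 0) {U : Set F}
    (hU : U ∈ 𝓝 0) : ∀ᶠ S : ℝ in 𝓝 0, ∃ x ∈ U, f (S, x) = 0 := by
  have : CompleteSpace F := FiniteDimensional.complete ℝ F
  set G : ℝ × F → ℝ × F := fun y => (y.1, f y) with hG
  have hG1 : ContDiffAt ℝ 1 G 0 := contDiffAt_fst.prodMk hf
  have hfs := hf.hasStrictFDerivAt one_ne_zero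
  have hs : HasStrictFDerivAt G ((ContinuousLinearMap.fst ℝ ℝ F).prod (fderiv ℝ f 0)) 0 :=
    hasStrictFDerivAt_fst.prodMk hfs
  set D := (ContinuousLinearMap.fst ℝ ℝ F).prod (fderiv ℝ f 0) with hD
  have hDinj : Function.Injective D.toLinearMap := by
    rw [injective_iff_map_eq_zero]
    rintro ⟨s, x⟩ hsx
    have h1 : s = 0 := congrArg Prod.fst hsx
    subst h1
    have h2 : fderiv ℝ f 0 (0, x) = 0 := congrArg Prod.snd hsx
    have hl : HasDerivAt (fun t : ℝ => ((0 : ℝ), t • x)) (0, x) 0 := by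
      have := (hasDerivAt_id (0 : ℝ)).smul_const x
      rw [one_smul] at this
      exact (hasDerivAt_const (0 : ℝ) (0 : ℝ)).prodMk this
    have h3 : HasDerivAt (fun t : ℝ => f (0, t • x)) (fderiv ℝ f 0 (0, x)) 0 := by
      have h4 : HasFDerivAt f (fderiv ℝ f 0) ((0 : ℝ), (0 : ℝ) • x) := by
        rw [zero_smul]; exact hfs.hasFDerivAt
      exact h4.comp_hasDerivAt (0 : ℝ) hl
    rw [h2] at h3
    rw [hinj x h3]
    rfl
  have hsurj : D.range = ⊤ := LinearMap.range_eq_top.2 (LinearMap.injective_iff_surjective.1 hDinj)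
  have hmap := hs.map_nhds_eq_of_surj hsurj
  have h1 : G '' (Set.univ ×ˢ U) ∈ 𝓝 (G 0) := by
    rw [← hmap]
    exact Filter.image_mem_map (prod_mem_nhds Filter.univ_mem hU)
  have h2 : Tendsto (fun S : ℝ => (S, (0 : F))) (𝓝 0) (𝓝 (G 0)) := by
    have h3 : G 0 = ((0 : ℝ), (0 : F)) := by rw [hG]; simp [h0]
    rw [h3]
    exact (Continuous.prodMk_left (0 : F)).tendsto (0 : ℝ)
  filter_upwards [h2 h1] with S hS
  obtain ⟨⟨S', x⟩, ⟨-, hx⟩, hSx⟩ := hS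
  have h3 : S' = S := congrArg Prod.fst hSx
  subst h3
  exact ⟨x, hx, congrArg Prod.snd hSx⟩

end ImplicitFunction

/-! ### Linear and bilinear pieces of the gauge equation -/

section Multilinear

variable {I : Type*} [Fintype I] [Quiver I] [∀ a b : I, Fintype (a ⟶ b)] {v w : I → ℕ}

theorem lStar_add_right (p q q' : RepSpace v w) : lStar p (q + q') = lStar p q + lStar p q' := by
  funext k
  simp only [lStar, Prod.fst_add, Prod.snd_add, Pi.add_apply, Matrix.add_mul, Matrix.mul_add,
    Finset.sum_add_distrib, Finset.sum_sub_distrib]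
  abel

theorem lStar_smul_right (t : ℂ) (p q : RepSpace v w) : lStar p (t • q) = t • lStar p q := by
  funext k
  simp only [lStar, Prod.smul_fst, Prod.smul_snd, Pi.smul_apply, Matrix.smul_mul, Matrix.mul_smul,
    smul_add, smul_sub, Finset.smul_sum]

theorem lStar_add_left (p p' q : RepSpace v w) : lStar (p + p') q = lStar p q + lStar p' q := by
  funext k
  simp only [Pi.add_apply, ← conjTranspose_lStar q, lStar_add_right, Matrix.conjTranspose_add]

theorem lStar_smul_left (t : ℂ) (p q : RepSpace v w) : lStar (t • p) q = star t • lStar p q := by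
  funext k
  simp only [Pi.smul_apply, ← conjTranspose_lStar q, lStar_smul_right, Matrix.conjTranspose_smul]

/-- The pairing `(p, q) ↦ l_p^*(q)` as a real bilinear map. -/
noncomputable def lStarB (v w : I → ℕ) : RepSpace v w →ₗ[ℝ] RepSpace v w →ₗ[ℝ] LieC v :=
  LinearMap.mk₂ ℝ lStar lStar_add_left
    (fun t p q => by
      have := lStar_smul_left (t : ℂ) p q
      rw [Complex.star_def, Complex.conj_ofReal] at this
      exact this)
    lStar_add_right (fun t p q => lStar_smul_right (t : ℂ) p q)

end Multilinear

section Multilinear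

variable {I : Type*} [Quiver I] {v w : I → ℕ}

/-- Left multiplication, the part of `act₂` that is linear in the first argument. -/
noncomputable def leftL (m : RepSpace v w) : LieC v →ₗ[ℝ] RepSpace v w where
  toFun X := ((fun a b e => X b * m.1.1 a b e, fun k => X k * m.1.2 k),
    (fun a b e => X a * m.2.1 a b e, 0))
  map_add' X Y := by
    refine rep_ext (fun a b e => ?_) (fun k => ?_) (fun a b e => ?_) (fun k => ?_) <;>
      simp [Matrix.add_mul]
  map_smul' t X := by
    refine rep_ext (fun a b e => ?_) (fun k => ?_) (fun a b e => ?_) (fun k => ?_) <;>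
      simp

/-- Right multiplication, the part of `act₂` that is linear in the second argument. -/
noncomputable def rightL (m : RepSpace v w) : LieC v →ₗ[ℝ] RepSpace v w where
  toFun X := ((fun a b e => m.1.1 a b e * X a, 0),
    (fun a b e => m.2.1 a b e * X b, fun k => m.2.2 k * X k))
  map_add' X Y := by
    refine rep_ext (fun a b e => ?_) (fun k => ?_) (fun a b e => ?_) (fun k => ?_) <;>
      simp [Matrix.mul_add]
  map_smul' t X := by
    refine rep_ext (fun a b e => ?_) (fun k => ?_) (fun a b e => ?_) (fun k => ?_) <;>
      simp

/-- The part of `act₂` that is bilinear. -/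
noncomputable def crossB (m : RepSpace v w) : LieC v →ₗ[ℝ] LieC v →ₗ[ℝ] RepSpace v w :=
  LinearMap.mk₂ ℝ (fun X Y => ((fun a b e => X b * m.1.1 a b e * Y a, 0),
    (fun a b e => X a * m.2.1 a b e * Y b, 0)))
    (fun X X' Y => by
      refine rep_ext (fun a b e => ?_) (fun k => ?_) (fun a b e => ?_) (fun k => ?_) <;>
        simp [Matrix.add_mul])
    (fun t X Y => by
      refine rep_ext (fun a b e => ?_) (fun k => ?_) (fun a b e => ?_) (fun k => ?_) <;>
        simp)
    (fun X Y Y' => by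
      refine rep_ext (fun a b e => ?_) (fun k => ?_) (fun a b e => ?_) (fun k => ?_) <;>
        simp [Matrix.mul_add])
    (fun t X Y => by
      refine rep_ext (fun a b e => ?_) (fun k => ?_) (fun a b e => ?_) (fun k => ?_) <;>
        simp)

theorem act₂_one_add (X Y : LieC v) (m : RepSpace v w) :
    act₂ (1 + X) (1 + Y) m = m + (leftL m X + rightL m Y) + crossB m X Y := by
  refine rep_ext (fun a b e => ?_) (fun k => ?_) (fun a b e => ?_) (fun k => ?_) <;>
    simp [act₂, leftL, rightL, crossB, Matrix.add_mul, Matrix.mul_add] <;> abel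

theorem leftL_add_rightL_neg (X : LieC v) (m : RepSpace v w) :
    leftL m X + rightL m (-X) = lact X m := by
  refine rep_ext (fun a b e => ?_) (fun k => ?_) (fun a b e => ?_) (fun k => ?_) <;>
    simp [lact, leftL, rightL, sub_eq_add_neg]

/-- The point of `M` with given matrix entries, as a linear map. -/
noncomputable def ofEntryL (v w : I → ℕ) : (Ent v w → ℂ) →ₗ[ℝ] RepSpace v w where
  toFun := ofEntry
  map_add' f g := entry_ext fun s => by simp [entry_add]
  map_smul' t f := entry_ext fun s => by
    rw [entry_ofEntry]
    rcases s with ⟨a, b, e, i, j⟩ | ⟨k, i, j⟩ | ⟨a, b, e, i, j⟩ | ⟨k, i, j⟩ <;> rfl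

/-- The matrix entries, as a linear map. -/
noncomputable def entryL (v w : I → ℕ) : RepSpace v w →ₗ[ℝ] (Ent v w → ℂ) where
  toFun m s := entry m s
  map_add' p q := funext fun s => entry_add p q s
  map_smul' t f := funext fun s => by
    rcases s with ⟨a, b, e, i, j⟩ | ⟨k, i, j⟩ | ⟨a, b, e, i, j⟩ | ⟨k, i, j⟩ <;> rfl

/-- The grading action as a linear map. -/
noncomputable def tauL (n : (k : I) → Fin (v k) → ℤ) (w : I → ℕ) (S : ℝ) :
    RepSpace v w →ₗ[ℝ] RepSpace v w where
  toFun := tau n S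
  map_add' p q := entry_ext fun s => by simp only [entry_tau, entry_add, mul_add]
  map_smul' t p := entry_ext fun s => by
    have h : ∀ q : RepSpace v w, entry (t • q) s = t • entry q s := fun q =>
      congrFun ((entryL v w).map_smul t q) s
    simp only [entry_tau, h, RingHom.id_apply, Complex.real_smul]
    ring

end Multilinear

/-! ### Differentiability of polynomial expressions -/

section Differentiability

open scoped Matrix.Norms.Elementwise

variable {I : Type*} [Fintype I] [Quiver I] [∀ a b : I, Fintype (a ⟶ b)] {v w : I → ℕ}

theorem contDiff_linear_comp {X E F : Type*} [NormedAddCommGroup X] [NormedSpace ℝ X]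
    [NormedAddCommGroup E] [NormedSpace ℝ E] [FiniteDimensional ℝ E]
    [NormedAddCommGroup F] [NormedSpace ℝ F] (L : E →ₗ[ℝ] F) {f : X → E} (hf : ContDiff ℝ 1 f) :
    ContDiff ℝ 1 fun x => L (f x) :=
  (LinearMap.toContinuousLinearMap L).contDiff.comp hf

theorem contDiff_bilinear_comp {X E E' F : Type*} [NormedAddCommGroup X] [NormedSpace ℝ X]
    [NormedAddCommGroup E] [NormedSpace ℝ E] [FiniteDimensional ℝ E]
    [NormedAddCommGroup E'] [NormedSpace ℝ E'] [FiniteDimensional ℝ E']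
    [NormedAddCommGroup F] [NormedSpace ℝ F] [FiniteDimensional ℝ F] (L : E →ₗ[ℝ] E' →ₗ[ℝ] F)
    {f : X → E} {g : X → E'} (hf : ContDiff ℝ 1 f) (hg : ContDiff ℝ 1 g) :
    ContDiff ℝ 1 fun x => L (f x) (g x) :=
  L.toContinuousBilinearMap.isBoundedBilinearMap.contDiff.comp (hf.prodMk hg)

theorem ContDiff.tau {X : Type*} [NormedAddCommGroup X] [NormedSpace ℝ X]
    (n : (k : I) → Fin (v k) → ℤ) {S : X → ℝ} {z : X → RepSpace v w} (hS : ContDiff ℝ 1 S)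
    (hz : ContDiff ℝ 1 z) : ContDiff ℝ 1 fun x => NakajimaQuiver.tau n (S x) (z x) := by
  have h1 : ContDiff ℝ 1 fun x => entryL v w (z x) := contDiff_linear_comp (entryL v w) hz
  have h2 : ContDiff ℝ 1 fun x s => (S x : ℂ) ^ (tdeg n s).toNat * entry (z x) s := by
    rw [contDiff_pi]
    exact fun s => ((Complex.ofRealCLM.contDiff.comp hS).pow _).mul (contDiff_pi.1 h1 s)
  exact contDiff_linear_comp (ofEntryL v w) h2

end Differentiability

/-! ### Injectivity of the linearised equation -/

section Linearization

variable {I : Type*} [Fintype I] [DecidableEq I] [Quiver I] [∀ a b : I, Fintype (a ⟶ b)]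
  {v w : I → ℕ}

/-- The component of degree `d`. -/
def degPart (n : (k : I) → Fin (v k) → ℤ) (d : ℤ) (Y : LieC v) : LieC v :=
  fun k => Matrix.of fun i j => if n k i - n k j = d then Y k i j else 0

theorem degPart_apply (n : (k : I) → Fin (v k) → ℤ) (d : ℤ) (Y : LieC v) (k : I)
    (i j : Fin (v k)) : degPart n d Y k i j = if n k i - n k j = d then Y k i j else 0 := rfl

/-- `projL n D = 0` means that `D` vanishes in positive degree and is anti-Hermitian in degree 0,
while `Y` is Hermitian there; Hermitian and anti-Hermitian matrices are orthogonal for the real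
trace pairing. -/
theorem re_sum_trace_degPart_eq_zero {n : (k : I) → Fin (v k) → ℤ} {Y D : LieC v}
    (hY : projL n Y = Y) (hD : projL n D = 0) {d : ℤ} (hd : 0 ≤ d) :
    (∑ k, ((degPart n d Y k)ᴴ * D k).trace).re = 0 := by
  have hD' : ∀ k i j, projL n D k i j = 0 := fun k i j =>
    congrFun (congrFun (congrFun hD k) i) j
  have hpair : ∀ k i j, star (degPart n d Y k i j) * D k i j +
      degPart n d Y k j i * star (D k j i) = 0 ∨
      (star (degPart n d Y k i j) * D k i j = 0 ∧ degPart n d Y k j i * star (D k j i) = 0) := by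
    intro k i j
    rcases eq_or_lt_of_le hd with h0 | h0
    · left
      subst h0
      simp only [degPart_apply]
      by_cases hij : n k i = n k j
      · have h1 := hD' k i j
        have h2 : projL n Y k j i = Y k j i := by rw [hY]
        rw [projL_apply, if_neg (by omega), if_pos hij] at h1
        rw [projL_apply, if_neg (by omega), if_pos hij.symm] at h2
        have h3 : star (Y k i j) = Y k j i := by linear_combination 2 * h2
        rw [if_pos (by omega), if_pos (by omega), h3]
        linear_combination 2 * Y k j i * h1
      · rw [if_neg (by omega), if_neg (by omega)]; simp
    · right
      have key : ∀ i j, degPart n d Y k i j = 0 ∨ D k i j = 0 := by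
        intro i j
        by_cases hij : n k i - n k j = d
        · right
          have h1 := hD' k i j
          rwa [projL_apply, if_pos (by omega)] at h1
        · left
          rw [degPart_apply, if_neg hij]
      constructor
      · rcases key i j with h | h <;> simp [h]
      · rcases key j i with h | h <;> simp [h]
  have hpair' : ∀ k i j, star (degPart n d Y k i j) * D k i j +
      degPart n d Y k j i * star (D k j i) = 0 := fun k i j => by
    rcases hpair k i j with h | ⟨h, h'⟩
    · exact h
    · rw [h, h', add_zero]
  have h1 : ∀ k, ((degPart n d Y k)ᴴ * D k).trace + star ((degPart n d Y k)ᴴ * D k).trace = 0 := by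
    intro k
    rw [trace_conjTranspose_mul_eq, star_sum,
      ← (Equiv.prodComm (Fin (v k)) (Fin (v k))).sum_comp (fun x => star (_ * _)),
      ← Finset.sum_add_distrib]
    refine Finset.sum_eq_zero fun x _ => ?_
    rw [star_mul', star_star]
    exact hpair' k x.1 x.2
  rw [Complex.re_sum]
  refine Finset.sum_eq_zero fun k _ => ?_
  have h2 := congrArg Complex.re (h1 k)
  simp only [Complex.add_re, Complex.star_def, Complex.conj_re, Complex.zero_re] at h2
  linarith

theorem dot_eq_of_entry_eq {p q q' : RepSpace v w} (h : ∀ s, entry p s = 0 ∨ entry q s = entry q' s) :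
    dot p q = dot p q' := by
  refine Finset.sum_congr rfl fun s _ => ?_
  rcases h s with h | h <;> simp [h]

/-- Pair the linearised equation with the lowest component `Z` of `Y`. Up to degree `d` the vector
`lact Y m` agrees with `q = lact Z p₀`, so one term gives `|q| ^ 2` and the other is nonnegative.
Hence `q = 0`, and infinitesimal freeness gives `Z = 0`. -/
theorem degPart_eq_zero {c : I → ℝ} (hc : IsGeneric v c) {n : (k : I) → Fin (v k) → ℤ}
    {p₀ m : RepSpace v w} (hp₀ : p₀ ∈ level w (central v c) 0) (hm : IsNonneg n m)
    (hpm : ∀ s, entry p₀ s = if tdeg n s = 0 then entry m s else 0) {Y : LieC v}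
    (hY : projL n Y = Y)
    (hD : projL n (lStar (tau n 0 (lact Y m)) m + lStar p₀ (lact Y m)) = 0)
    {d : ℤ} (hd : 0 ≤ d) (hYd : DegGE n d Y) : degPart n d Y = 0 := by
  set Z := degPart n d Y with hZdef
  set δ := lact Y m with hδ
  set q := lact Z p₀ with hq
  have hZ : ∀ k i j, Z k i j = if n k i - n k j = d then Y k i j else 0 := fun k i j => rfl
  have hZ' : ∀ k i j, n k i - n k j ≠ d → Z k i j = 0 := fun k i j h => by rw [hZ, if_neg h]
  have hp0 : ∀ s, tdeg n s ≠ 0 → entry p₀ s = 0 := fun s h => by rw [hpm, if_neg h]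
  have hqd : ∀ s, tdeg n s ≠ d → entry q s = 0 := fun s hs => entry_lact_of_ne hZ' hp0 hs
  have hδq : ∀ s, tdeg n s ≤ d → entry δ s = entry q s := fun s hs =>
    entry_lact_of_le hYd hZ hm hpm hs
  have hP := re_sum_trace_degPart_eq_zero hY hD hd
  simp only [Pi.add_apply, Matrix.mul_add, Matrix.trace_add, Finset.sum_add_distrib] at hP
  rw [sum_trace_lStar _ p₀ δ, ← hZdef, ← hq,
    dot_eq_of_entry_eq (q' := q) fun s => (eq_or_ne (tdeg n s) d).elim
      (fun h => .inr (hδq s h.le)) (fun h => .inl (hqd s h)), Complex.add_re] at hP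
  have hqq : 0 ≤ (dot q q).re := by
    rw [dot_self, Complex.ofReal_re]; positivity
  have hT : 0 ≤ (∑ k, ((Z k)ᴴ * lStar (tau n 0 δ) m k).trace).re := by
    -- For `d = 0`, `tau n 0` sends `δ` to `q` and `Z` is Hermitian, so this term is again `|q| ^
    -- 2`; for `d > 0` it vanishes.
    rcases eq_or_lt_of_le hd with h0 | h0
    · have h1 : tau n 0 δ = q := by
        refine entry_ext fun s => ?_
        rw [entry_tau]
        rcases lt_trichotomy (tdeg n s) 0 with h | h | h
        · rw [hδq s (by omega), hqd s (by omega), mul_zero]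
        · rw [h, hδq s (by omega)]; simp
        · rw [hqd s (by omega), Complex.ofReal_zero, zero_pow (by omega), zero_mul]
      have h2 : ∀ k, (Z k)ᴴ = Z k := by
        intro k
        ext i j
        rw [Matrix.conjTranspose_apply, hZ, hZ]
        by_cases hij : n k i = n k j
        · have h2 : projL n Y k i j = Y k i j := by rw [hY]
          rw [projL_apply, if_neg (by omega), if_pos hij] at h2
          rw [if_pos (by omega), if_pos (by omega)]
          linear_combination 2 * h2
        · rw [if_neg (by omega), if_neg (by omega), star_zero]
      have h3 : ∀ k, ((Z k)ᴴ * lStar q m k).trace = star ((Z k)ᴴ * lStar m q k).trace := by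
        intro k
        rw [← conjTranspose_lStar m q, ← Matrix.trace_conjTranspose, Matrix.conjTranspose_mul,
          Matrix.conjTranspose_conjTranspose, Matrix.trace_mul_comm, h2]
      have h4 : ∀ s, entry q s = 0 ∨ entry (lact Z m) s = entry q s := fun s => by
        rcases eq_or_ne (tdeg n s) d with h | h
        · refine .inr (entry_lact_of_le (d := d) (fun k i j h => hZ' k i j h.ne) (fun k i j => ?_)
            hm hpm h.le)
          rw [hZ]; split_ifs <;> rfl
        · exact .inl (hqd s h)
      have h5 : dot (lact Z m) q = dot q q := by
        refine Finset.sum_congr rfl fun s _ => ?_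
        rcases h4 s with h | h <;> simp [h]
      rw [h1, Finset.sum_congr rfl fun k _ => h3 k, ← star_sum, sum_trace_lStar, h5,
        Complex.star_def, Complex.conj_re]
      exact hqq
    · have h1 : tau n 0 δ = 0 := by
        refine entry_ext fun s => ?_
        rw [entry_tau, entry_zero]
        rcases le_or_gt (tdeg n s) 0 with h | h
        · rw [hδq s (by omega), hqd s (by omega), mul_zero]
        · rw [Complex.ofReal_zero, zero_pow (by omega), zero_mul]
      have h2 : lStar (0 : RepSpace v w) m = 0 := (lStarB v w).map_zero₂ m
      simp [h1, h2]
  have h6 : (dot q q).re = 0 := by linarith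
  have h7 : dot q q = 0 := by
    rw [dot_self] at h6 ⊢
    rw [Complex.ofReal_re] at h6
    rw [h6, Complex.ofReal_zero]
  exact eq_zero_of_lact_eq_zero hc hp₀ (eq_zero_of_dot_self h7)

theorem eq_zero_of_projL_lStar_eq_zero {c : I → ℝ} (hc : IsGeneric v c)
    {n : (k : I) → Fin (v k) → ℤ}
    {p₀ m : RepSpace v w} (hp₀ : p₀ ∈ level w (central v c) 0) (hm : IsNonneg n m)
    (hpm : ∀ s, entry p₀ s = if tdeg n s = 0 then entry m s else 0) {Y : LieC v}
    (hY : projL n Y = Y)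
    (hD : projL n (lStar (tau n 0 (lact Y m)) m + lStar p₀ (lact Y m)) = 0) : Y = 0 := by
  have h : ∀ d : ℕ, DegGE n d Y := by
    intro d
    induction d with
    | zero => rw [← hY]; exact_mod_cast degGE_projL n Y
    | succ d ih =>
      intro k i j hij
      push_cast at hij
      rcases lt_or_eq_of_le (show n k i - n k j ≤ d by omega) with h | h
      · exact ih k i j h
      · have h1 := degPart_eq_zero hc hp₀ hm hpm hY hD (Int.natCast_nonneg d) ih
        have h2 : degPart n d Y k i j = 0 := by rw [h1]; rfl
        rwa [degPart_apply, if_pos h] at h2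
  funext k
  ext i j
  exact h ((n k i - n k j).toNat + 1) k i j (by omega)

end Linearization

/-! ### Solving the gauge equation near the origin -/

section LocalSolution

variable {I : Type*} [Fintype I] [DecidableEq I] [Quiver I] [∀ a b : I, Fintype (a ⟶ b)]
  {v w : I → ℕ}

/-- The point `act₂ (1 + projL n Y) (1 + Y') m`. -/
noncomputable def movedPt (n : (k : I) → Fin (v k) → ℤ) (m : RepSpace v w) (y : LieC v × LieC v) :
    RepSpace v w := act₂ (1 + projL n y.1) (1 + y.2) m

theorem movedPt_eq (n : (k : I) → Fin (v k) → ℤ) (m : RepSpace v w) (y : LieC v × LieC v) :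
    movedPt n m y = m + (leftL m (projL n y.1) + rightL m y.2) + crossB m (projL n y.1) y.2 :=
  act₂_one_add _ _ _

/-- The equation for the gauge transformation: the component `projL` of the real moment map
equation, and the equation `(1 + projL n Y) (1 + Y') = 1`. -/
noncomputable def gaugeEq (n : (k : I) → Fin (v k) → ℤ) (c : I → ℝ) (m : RepSpace v w)
    (y : ℝ × LieC v × LieC v) : LieC v × LieC v :=
  (projL n (lStarB v w (tau n y.1 (movedPt n m y.2)) (movedPt n m y.2) - twoC v c) +
      (y.2.1 - projL n y.2.1),
    projL n y.2.1 + y.2.2 + LinearMap.mul ℝ (LieC v) (projL n y.2.1) y.2.2)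

open scoped Matrix.Norms.Elementwise in
theorem contDiff_gaugeEq (n : (k : I) → Fin (v k) → ℤ) (c : I → ℝ) (m : RepSpace v w) :
    ContDiff ℝ 1 (gaugeEq n c m) := by
  have hY : ContDiff ℝ 1 fun y : ℝ × LieC v × LieC v => y.2.1 := contDiff_fst.comp contDiff_snd
  have hY' : ContDiff ℝ 1 fun y : ℝ × LieC v × LieC v => y.2.2 := contDiff_snd.comp contDiff_snd
  have hS : ContDiff ℝ 1 fun y : ℝ × LieC v × LieC v => y.1 := contDiff_fst
  have hP : ContDiff ℝ 1 fun y : ℝ × LieC v × LieC v => projL n y.2.1 :=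
    contDiff_linear_comp (projL n) hY
  have hz : ContDiff ℝ 1 fun y : ℝ × LieC v × LieC v => movedPt n m y.2 := by
    simp only [movedPt_eq]
    exact (contDiff_const.add ((contDiff_linear_comp (leftL m) hP).add
      (contDiff_linear_comp (rightL m) hY'))).add (contDiff_bilinear_comp (crossB m) hP hY')
  refine ContDiff.prodMk ?_ ?_
  · exact (contDiff_linear_comp (projL n) ((contDiff_bilinear_comp (lStarB v w)
      (ContDiff.tau n hS hz) hz).sub contDiff_const)).add (hY.sub hP)
  · exact (hP.add hY').add (contDiff_bilinear_comp (LinearMap.mul ℝ (LieC v)) hP hY')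

end LocalSolution

section LocalSolution

variable {I : Type*} [Fintype I] [DecidableEq I] [Quiver I] [∀ a b : I, Fintype (a ⟶ b)]
  {v w : I → ℕ}

theorem movedPt_zero (n : (k : I) → Fin (v k) → ℤ) (m : RepSpace v w) : movedPt n m 0 = m := by
  rw [movedPt_eq]
  simp

theorem continuous_movedPt (n : (k : I) → Fin (v k) → ℤ) (m : RepSpace v w) :
    Continuous (movedPt n m) := by
  have h1 : Continuous fun y : LieC v × LieC v => projL n y.1 :=
    (LinearMap.continuous_of_finiteDimensional (projL n)).comp continuous_fst
  have h2 : ∀ k, Continuous fun y : LieC v × LieC v => projL n y.1 k := fun k =>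
    (continuous_apply k).comp h1
  have h3 : ∀ k, Continuous fun y : LieC v × LieC v => y.2 k := fun k =>
    (continuous_apply k).comp continuous_snd
  refine Continuous.prodMk (Continuous.prodMk ?_ ?_) (Continuous.prodMk ?_ ?_)
  · refine continuous_pi fun a => continuous_pi fun b => continuous_pi fun e => ?_
    exact ((continuous_const.add (h2 b)).matrix_mul continuous_const).matrix_mul
      (continuous_const.add (h3 a))
  · exact continuous_pi fun k => (continuous_const.add (h2 k)).matrix_mul continuous_const
  · refine continuous_pi fun a => continuous_pi fun b => continuous_pi fun e => ?_
    exact ((continuous_const.add (h2 a)).matrix_mul continuous_const).matrix_mul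
      (continuous_const.add (h3 b))
  · exact continuous_pi fun k => continuous_const.matrix_mul (continuous_const.add (h3 k))

theorem hasDerivAt_smul_zero {E : Type*} [NormedAddCommGroup E] [NormedSpace ℝ E] (x : E) :
    HasDerivAt (fun t : ℝ => t • x) x 0 := by
  simpa using (hasDerivAt_id (0 : ℝ)).smul_const x

theorem hasDerivAt_sq_smul_zero {E : Type*} [NormedAddCommGroup E] [NormedSpace ℝ E] (x : E) :
    HasDerivAt (fun t : ℝ => (t ^ 2) • x) 0 0 := by
  simpa using ((hasDerivAt_id (0 : ℝ)).pow 2).smul_const x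

open scoped Matrix.Norms.Elementwise in
theorem hasDerivAt_gaugeEq (n : (k : I) → Fin (v k) → ℤ) (c : I → ℝ) (m : RepSpace v w)
    (y : LieC v × LieC v) : HasDerivAt (fun t : ℝ => gaugeEq n c m (0, t • y))
      (projL n (lStar (tau n 0 m) (leftL m (projL n y.1) + rightL m y.2) +
          lStar (tau n 0 (leftL m (projL n y.1) + rightL m y.2)) m) + (y.1 - projL n y.1),
        projL n y.1 + y.2) 0 := by
  set δ := leftL m (projL n y.1) + rightL m y.2 with hδ
  have hzt : ∀ t : ℝ, movedPt n m (t • y) =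
      m + t • δ + (t ^ 2) • crossB m (projL n y.1) y.2 := by
    intro t
    rw [movedPt_eq, Prod.smul_fst, Prod.smul_snd, map_smul, map_smul, map_smul, map_smul,
      LinearMap.map_smul₂, hδ, smul_add, smul_smul, sq]
  have hz : HasDerivAt (fun t : ℝ => movedPt n m (t • y)) δ 0 := by
    have h := ((hasDerivAt_const (0 : ℝ) m).add (hasDerivAt_smul_zero δ)).add
      (hasDerivAt_sq_smul_zero (crossB m (projL n y.1) y.2))
    rw [zero_add, add_zero] at h
    exact h.congr_of_eventuallyEq (Eventually.of_forall hzt)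
  have hz0 : movedPt n m ((0 : ℝ) • y) = m := by rw [zero_smul, movedPt_zero]
  have hτ : HasDerivAt (fun t : ℝ => tau n 0 (movedPt n m (t • y))) (tau n 0 δ) 0 :=
    (LinearMap.toContinuousLinearMap (tauL n w 0)).hasFDerivAt.comp_hasDerivAt (0 : ℝ) hz
  have hL := (lStarB v w).toContinuousBilinearMap.hasDerivAt_of_bilinear
    (fun _ => hτ) (fun _ => hz)
  rw [hz0] at hL
  have hP := (LinearMap.toContinuousLinearMap (projL n)).hasFDerivAt.comp_hasDerivAt (0 : ℝ)
    (hL.sub_const (twoC v c))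
  refine HasDerivAt.prodMk ?_ ?_
  · refine (hP.add (hasDerivAt_smul_zero (y.1 - projL n y.1))).congr_of_eventuallyEq
      (Eventually.of_forall fun t => ?_)
    change _ + (t • y.1 - projL n (t • y.1)) = _ + t • (y.1 - projL n y.1)
    rw [map_smul, smul_sub]
    rfl
  · have h := (hasDerivAt_smul_zero (projL n y.1 + y.2)).add
      (hasDerivAt_sq_smul_zero (LinearMap.mul ℝ (LieC v) (projL n y.1) y.2))
    rw [add_zero] at h
    refine h.congr_of_eventuallyEq (Eventually.of_forall fun t => ?_)
    change projL n (t • y.1) + t • y.2 + LinearMap.mul ℝ (LieC v) (projL n (t • y.1)) (t • y.2) =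
      t • (projL n y.1 + y.2) + (t ^ 2) • LinearMap.mul ℝ (LieC v) (projL n y.1) y.2
    rw [map_smul, map_smul, LinearMap.map_smul₂, smul_add, smul_smul, sq]

/-- Nonnegative degree means block triangular for the order given by `-n`, which inversion
preserves. -/
theorem DegGE.inv {n : (k : I) → Fin (v k) → ℤ} {K : LieC v} (hK : DegGE n 0 K)
    (h : ∀ k, IsUnit (K k)) : DegGE n 0 fun k => (K k)⁻¹ := by
  intro k i j hij
  have h1 : Matrix.BlockTriangular (K k) fun i => - n k i := fun i j h =>
    hK k i j (by have h2 : - n k j < - n k i := h; omega)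
  have := (h k).invertible
  exact Matrix.blockTriangular_inv_of_blockTriangular h1
    (show - n k j < - n k i by omega)

-- The implicit function argument at `S = 0`, where `k = 1` solves the equation because `lStar p₀
-- (p₀ + A) = 2c`. The inverse of `k` is a second unknown, which keeps the system polynomial, and
-- the summand `Y - projL n Y` makes it square.
open scoped Matrix.Norms.Elementwise in
theorem eventually_exists_gauge {c : I → ℝ} (hc : IsGeneric v c) {n : (k : I) → Fin (v k) → ℤ}
    {p₀ A : RepSpace v w} (hp₀ : p₀ ∈ level w (central v c) 0)
    (h0 : ∀ s, tdeg n s ≠ 0 → entry p₀ s = 0) (hA : ∀ s, tdeg n s < 1 → entry A s = 0)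
    (hl : lStar p₀ A = 0) {U : Set (RepSpace v w)} (hU : U ∈ 𝓝 (p₀ + A)) :
    ∀ᶠ S : ℝ in 𝓝 0, ∃ k : GaugeC v, act k (p₀ + A) ∈ U ∧ IsNonneg n (act k (p₀ + A)) ∧
      projL n (lStar (tau n S (act k (p₀ + A))) (act k (p₀ + A)) - twoC v c) = 0 := by
  set m := p₀ + A with hm
  have hmn : IsNonneg n m := fun s hs => by
    rw [hm, entry_add, h0 s hs.ne, hA s (by omega), add_zero]
  have hpm : ∀ s, entry p₀ s = if tdeg n s = 0 then entry m s else 0 := fun s => by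
    split_ifs with h
    · rw [hm, entry_add, hA s (by omega), add_zero]
    · exact h0 s h
  have hτ : tau n 0 m = p₀ := entry_ext fun s => by
    rw [entry_tau, hpm]
    rcases lt_trichotomy (tdeg n s) 0 with h | h | h
    · rw [if_neg h.ne, hmn s h, mul_zero]
    · simp [h]
    · rw [if_neg h.ne', Complex.ofReal_zero, zero_pow (by omega), zero_mul]
  have hf0 : gaugeEq n c m 0 = 0 := by
    change (projL n (lStar (tau n 0 (movedPt n m 0)) (movedPt n m 0) - twoC v c) +
      ((0 : LieC v) - projL n 0), projL n 0 + (0 : LieC v) + projL n 0 * 0) = 0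
    rw [movedPt_zero, hτ, hm, lStar_add_right, hl, add_zero, ((mem_level_iff c p₀).1 hp₀).1]
    simp
  have hinj : ∀ y : LieC v × LieC v,
      HasDerivAt (fun t : ℝ => gaugeEq n c m (0, t • y)) 0 0 → y = 0 := by
    intro y hy
    have h1 := hy.unique (hasDerivAt_gaugeEq n c m y)
    have h2 : projL n y.1 + y.2 = 0 := (congrArg Prod.snd h1).symm
    have h3 := (congrArg Prod.fst h1).symm
    rw [eq_neg_of_add_eq_zero_right h2, leftL_add_rightL_neg, hτ] at h3
    dsimp only [Prod.fst_zero] at h3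
    -- One summand lies in the image of the projection and the other in its kernel, so applying
    -- `projL` shows that both vanish.
    have h4 := congrArg (projL n) h3
    rw [map_add, projL_projL, map_sub (projL n) y.1, projL_projL, sub_self, add_zero, map_zero] at h4
    rw [h4, zero_add, sub_eq_zero] at h3
    rw [← h3, add_comm] at h4
    have h5 := eq_zero_of_projL_lStar_eq_zero hc hp₀ hmn hpm h3.symm h4
    rw [h5, map_zero, zero_add] at h2
    exact Prod.ext h5 h2
  have hV : movedPt n m ⁻¹' U ∈ 𝓝 (0 : LieC v × LieC v) := by
    refine (continuous_movedPt n m).continuousAt.preimage_mem_nhds ?_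
    rwa [movedPt_zero]
  filter_upwards [eventually_exists_eq_zero_of_injective (contDiff_gaugeEq n c m).contDiffAt hf0
    hinj hV] with S hS
  obtain ⟨y, hyU, hy⟩ := hS
  have h1 : projL n (lStar (tau n S (movedPt n m y)) (movedPt n m y) - twoC v c) +
      (y.1 - projL n y.1) = 0 := congrArg Prod.fst hy
  have h2 : projL n y.1 + y.2 + projL n y.1 * y.2 = 0 := congrArg Prod.snd hy
  have h3 := congrArg (projL n) h1
  rw [map_add, projL_projL, map_sub (projL n) y.1, projL_projL, sub_self, add_zero, map_zero] at h3
  have h4 : (1 + projL n y.1) * (1 + y.2) = 1 := by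
    calc (1 + projL n y.1) * (1 + y.2)
        = 1 + (projL n y.1 + y.2 + projL n y.1 * y.2) := by noncomm_ring
      _ = 1 := by rw [h2, add_zero]
  have h5 : ∀ k, (1 + projL n y.1 k) * (1 + y.2 k) = 1 := fun k => congrFun h4 k
  let κ : GaugeC v := fun k =>
    ⟨1 + projL n y.1 k, 1 + y.2 k, h5 k, mul_eq_one_comm.1 (h5 k)⟩
  have h6 : act κ m = movedPt n m y := rfl
  refine ⟨κ, by rw [h6]; exact hyU, ?_, by rw [h6]; exact h3⟩
  -- Both `k` and its inverse have nonnegative degree, so `k` preserves points of nonnegative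
  -- degree.
  have hK : DegGE n 0 (1 + projL n y.1) := fun k i j hij => by
    have h7 : i ≠ j := by rintro rfl; simp at hij
    change (1 : Matrix _ _ ℂ) i j + projL n y.1 k i j = 0
    rw [Matrix.one_apply_ne h7, degGE_projL n y.1 k i j hij, add_zero]
  have hK' : DegGE n 0 (1 + y.2) := by
    have h8 : (1 + y.2) = fun k => ((1 + projL n y.1) k)⁻¹ := funext fun k =>
      (Matrix.inv_eq_right_inv (h5 k)).symm
    rw [h8]
    exact hK.inv fun k => (κ k).isUnit
  exact hmn.act₂ hK hK'

end LocalSolution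

/-! ### The rotated point after removing the one-parameter group -/

section Twist

variable {I : Type*} [Quiver I] {v w : I → ℕ}

/-- Hermitian adjoints `M → M`, exchanging the two summands. -/
def dag (p : RepSpace v w) : RepSpace v w := (daggerBar p.2, dagger p.1)

theorem dag_act {g h : GaugeC v} (hgh : ∀ k, (g k).1ᴴ = ((h k)⁻¹).1) (p : RepSpace v w) :
    dag (act g p) = act h (dag p) := by
  have hgi : ∀ k, ((g k)⁻¹).1ᴴ = (h k).1 := fun k => by
    have h1 : ((h k)⁻¹).1 * ((g k)⁻¹).1ᴴ = 1 := by
      rw [← hgh, ← Matrix.conjTranspose_mul, ← Units.val_mul, inv_mul_cancel, Units.val_one,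
        Matrix.conjTranspose_one]
    calc ((g k)⁻¹).1ᴴ = (h k).1 * (((h k)⁻¹).1 * ((g k)⁻¹).1ᴴ) := by
          rw [← Matrix.mul_assoc, ← Units.val_mul, mul_inv_cancel, Units.val_one, Matrix.one_mul]
      _ = (h k).1 := by rw [h1, Matrix.mul_one]
  refine rep_ext (fun a b e => ?_) (fun k => ?_) (fun a b e => ?_) (fun k => ?_) <;>
    simp only [dag, act, actOmega, actOmegaBar, dagger, daggerBar, Matrix.conjTranspose_mul, hgh,
      hgi, Matrix.mul_assoc]

/-- The point `(x - ħ y₀†, ħ⁻¹ y + x₀†)` for `p = (x₀, y₀)` and `z = (x, y)`. -/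
noncomputable def twist (ħ : ℝ) (p z : RepSpace v w) : RepSpace v w :=
  (z.1 - (ħ : ℂ) • (dag p).1, (ħ : ℂ)⁻¹ • z.2 + (dag p).2)

end Twist

section Twist

variable {I : Type*} [Fintype I] [Quiver I] [∀ a b : I, Fintype (a ⟶ b)] {v w : I → ℕ}

/-- The singular factors cancel: undoing `R ^ n` leaves `z` with coefficients 1 and `ħ⁻¹`, while in
the adjoint terms `R ^ n` occurs twice and combines with the scaling to `tau n (R ^ 2)`. The result
is continuous at `R = 0`. -/
theorem act_powG_inv_scale_hkRotate {n : (k : I) → Fin (v k) → ℤ} {ħ R : ℝ} (hħ : 0 < ħ)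
    (hR : 0 < R) {z : RepSpace v w} (hz : IsNonneg n z) :
    act (powG n (R : ℂ))⁻¹ (scale ((ħ : ℂ) * (R : ℂ))⁻¹ (hkRotate ((ħ : ℂ) * (R : ℂ))
      (act (powG n (R : ℂ)) (scale (R : ℂ) z)))) = twist ħ (tau n (R ^ 2) z) z := by
  have hR0 : (R : ℂ) ≠ 0 := by exact_mod_cast hR.ne'
  have hħ0 : (ħ : ℂ) ≠ 0 := by exact_mod_cast hħ.ne'
  rw [← scale_act_powG_eq_tau_sq hR hz]
  set g := powG n (R : ℂ) with hg
  set Z := scale (R : ℂ) z with hZ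
  set ξ := (ħ : ℂ) * (R : ℂ) with hξ
  have hξ0 : ξ ≠ 0 := mul_ne_zero hħ0 hR0
  have hj : ∀ (h : GaugeC v) (q : RepSpace v w),
      act h (-(ξ • q.1), q.2) = (-(ξ • (act h q).1), (act h q).2) := fun h q => by
    refine rep_ext (fun a b e => ?_) (fun k => ?_) (fun a b e => ?_) (fun k => ?_) <;>
      simp [act, actOmega, actOmegaBar, -Matrix.coe_units_inv]
  have h1 : ∀ P : RepSpace v w, scale ξ⁻¹ (hkRotate ξ P) =
      scale ξ⁻¹ P + (-(ξ • (dag P).1), (dag P).2) := fun P => by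
    refine Prod.ext ?_ ?_
    · change P.1 - ξ • daggerBar P.2 = P.1 + -(ξ • daggerBar P.2)
      exact sub_eq_add_neg _ _
    · change ξ⁻¹ • (P.2 + ξ • dagger P.1) = ξ⁻¹ • P.2 + dagger P.1
      rw [smul_add, inv_smul_smul₀ hξ0]
  have hgg : ∀ k, (g k).1ᴴ = (((g⁻¹) k)⁻¹).1 := fun k => by
    rw [Pi.inv_apply, inv_inv]
    exact conjTranspose_powG n hR k
  have h2 : act g⁻¹ (dag (act g Z)) = dag (act g (act g Z)) := (dag_act hgg _).symm
  rw [h1, act_add, act_scale, act_inv_act, hj, h2, hZ, scale_scale, ← hZ]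
  have hs : (ξ⁻¹ * R) = (ħ : ℂ)⁻¹ := by rw [hξ]; field_simp
  rw [hs]
  refine Prod.ext ?_ ?_
  · change z.1 + -(ξ • daggerBar (act g (act g Z)).2) =
      z.1 - (ħ : ℂ) • daggerBar ((R : ℂ) • (act g (act g Z)).2)
    have h3 : ∀ y : MOmegaBar v w, daggerBar ((R : ℂ) • y) = (R : ℂ) • daggerBar y := fun y => by
      refine Prod.ext ?_ ?_
      · funext a b e
        simp [daggerBar, Matrix.conjTranspose_smul]
      · funext k
        simp [daggerBar, Matrix.conjTranspose_smul]
    rw [h3, smul_smul, sub_eq_add_neg]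
  · rfl

theorem continuous_dag {X : Type*} [TopologicalSpace X] {f : X → RepSpace v w} (hf : Continuous f) :
    Continuous fun x => dag (f x) := by
  refine Continuous.prodMk (Continuous.prodMk ?_ ?_) (Continuous.prodMk ?_ ?_)
  · refine continuous_pi fun a => continuous_pi fun b => continuous_pi fun e => ?_
    exact Continuous.matrix_conjTranspose (by fun_prop)
  · exact continuous_pi fun k => Continuous.matrix_conjTranspose (by fun_prop)
  · refine continuous_pi fun a => continuous_pi fun b => continuous_pi fun e => ?_
    exact Continuous.matrix_conjTranspose (by fun_prop)
  · exact continuous_pi fun k => Continuous.matrix_conjTranspose (by fun_prop)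

theorem continuous_twist {X : Type*} [TopologicalSpace X] (ħ : ℝ) {f g : X → RepSpace v w}
    (hf : Continuous f) (hg : Continuous g) : Continuous fun x => twist ħ (f x) (g x) := by
  have h := continuous_dag hf
  have h1 : Continuous fun x => (ħ : ℂ) • (dag (f x)).1 := h.fst.const_smul (ħ : ℂ)
  have h2 : Continuous fun x => (ħ : ℂ)⁻¹ • (g x).2 := hg.snd.const_smul (ħ : ℂ)⁻¹
  exact Continuous.prodMk (hg.fst.sub h1) (h2.add h.snd)

open scoped Matrix.Norms.Elementwise in
theorem continuous_tau (n : (k : I) → Fin (v k) → ℤ) :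
    Continuous fun y : ℝ × RepSpace v w => tau n y.1 y.2 :=
  (ContDiff.tau n contDiff_fst contDiff_snd).continuous

end Twist

/-! ### Existence and formula for the conformal limit -/

section Limit

variable {I : Type*} [Fintype I] [DecidableEq I] [Quiver I] [∀ a b : I, Fintype (a ⟶ b)]
  {v w : I → ℕ}

theorem eventually_exists_mem_level {c : I → ℝ} (hc : IsGeneric v c) {ħ : ℝ} (hħ : 0 < ħ)
    {n : (k : I) → Fin (v k) → ℤ} {p₀ A : RepSpace v w} (hp₀ : p₀ ∈ level w (central v c) 0)
    (h0 : ∀ s, tdeg n s ≠ 0 → entry p₀ s = 0) (hA : ∀ s, tdeg n s < 1 → entry A s = 0)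
    (hl : lStar p₀ A = 0) (hμ : muC (p₀ + A) = 0) {U : Set (RepSpace v w)}
    (hU : U ∈ 𝓝 (twist ħ p₀ (p₀ + A))) :
    ∀ᶠ R : ℝ in 𝓝[>] 0, ∃ a : GaugeC v,
      act a (scale (R : ℂ) (p₀ + A)) ∈ level w (central v c) 0 ∧ ∃ d : GaugeC v,
        act d (scale ((ħ : ℂ) * (R : ℂ))⁻¹
          (hkRotate ((ħ : ℂ) * (R : ℂ)) (act a (scale (R : ℂ) (p₀ + A))))) ∈ U := by
  set m := p₀ + A with hm
  have hτ : tau n 0 m = p₀ := entry_ext fun s => by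
    rw [entry_tau, hm, entry_add]
    rcases lt_trichotomy (tdeg n s) 0 with h | h | h
    · rw [h0 s h.ne, hA s (by omega), add_zero, mul_zero]
    · rw [hA s (by omega)]; simp [h]
    · rw [h0 s h.ne', Complex.ofReal_zero, zero_pow (by omega), zero_mul]
  have hcont : Continuous fun y : ℝ × RepSpace v w => twist ħ (tau n y.1 y.2) y.2 :=
    continuous_twist ħ (continuous_tau n) continuous_snd
  have h1 : (fun y : ℝ × RepSpace v w => twist ħ (tau n y.1 y.2) y.2) ⁻¹' U ∈
      𝓝 ((0 : ℝ), m) := by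
    refine hcont.continuousAt.preimage_mem_nhds ?_
    rwa [hτ]
  obtain ⟨O, hO, U', hU', hOU⟩ := mem_nhds_prod_iff.1 h1
  have h2 := (eventually_exists_gauge hc hp₀ h0 hA hl hU').and (show ∀ᶠ S : ℝ in 𝓝 0, S ∈ O from hO)
  have h3 : Tendsto (fun R : ℝ => R ^ 2) (𝓝[>] 0) (𝓝 0) := by
    refine Tendsto.mono_left ?_ nhdsWithin_le_nhds
    have := (continuous_pow 2 (M := ℝ)).tendsto 0
    simpa using this
  filter_upwards [h3.eventually h2, self_mem_nhdsWithin] with R hR hR0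
  obtain ⟨⟨k, hkU, hkn, hk⟩, hRO⟩ := hR
  have h4 : act (powG n (R : ℂ) * k) (scale (R : ℂ) m) =
      act (powG n (R : ℂ)) (scale (R : ℂ) (act k m)) := by rw [act_mul, act_scale]
  refine ⟨powG n (R : ℂ) * k, ?_, (powG n (R : ℂ))⁻¹, ?_⟩
  · rw [h4]
    refine (mem_level_iff c _).2 ⟨lStar_eq_twoC_of_projL hR0 hkn hk, muC_act_eq_zero _ ?_⟩
    rw [muC_scale, muC_act_eq_zero k hμ, smul_zero]
  · rw [h4, act_powG_inv_scale_hkRotate hħ hR0 hkn]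
    exact hOU (Set.mk_mem_prod hRO hkU)

/-- The complex level is closed, and the twist is a limit of rotated points lying on it. -/
theorem muC_twist {c : I → ℝ} (hc : IsGeneric v c) {ħ : ℝ} (hħ : 0 < ħ)
    {n : (k : I) → Fin (v k) → ℤ} {p₀ A : RepSpace v w} (hp₀ : p₀ ∈ level w (central v c) 0)
    (h0 : ∀ s, tdeg n s ≠ 0 → entry p₀ s = 0) (hA : ∀ s, tdeg n s < 1 → entry A s = 0)
    (hl : lStar p₀ A = 0) (hμ : muC (p₀ + A) = 0) :
    muC (twist ħ p₀ (p₀ + A)) = twoC v c := by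
  have hcl : IsClosed {q : RepSpace v w | muC q = twoC v c} :=
    isClosed_eq continuous_muC continuous_const
  refine hcl.closure_subset (mem_closure_iff_nhds.2 fun U hU => ?_)
  obtain ⟨R, ⟨a, ha, d, hd⟩, hR⟩ :=
    ((eventually_exists_mem_level hc hħ hp₀ h0 hA hl hμ hU).and self_mem_nhdsWithin).exists
  refine ⟨_, hd, muC_act_eq_twoC d ?_⟩
  have h1 := muC_scale_hkRotate ha (mul_pos hħ hR).ne'
  push_cast at h1
  exact h1

theorem exists_conformalLimit {c : I → ℝ} (hc : IsGeneric v c) {ħ : ℝ} (hħ : 0 < ħ)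
    {n : (k : I) → Fin (v k) → ℤ} {p₀ A : RepSpace v w} (hp₀ : p₀ ∈ level w (central v c) 0)
    (h0 : ∀ s, tdeg n s ≠ 0 → entry p₀ s = 0) (hA : ∀ s, tdeg n s < 1 → entry A s = 0)
    (hl : lStar p₀ A = 0) (hμ : muC (p₀ + A) = 0) :
    ∃ (b : GaugeC v) (r : TargetLevel v w c), act b (twist ħ p₀ (p₀ + A)) = r.1 ∧
      ∀ q, IsConformalLimit c ħ (p₀ + A) q ↔ q = toTarget r := by
  have h := muC_twist hc hħ hp₀ h0 hA hl hμ
  obtain ⟨b, r, hbr⟩ := exists_target hc h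
  exact ⟨b, r, hbr, isConformalLimit_iff hc hħ h hbr fun U hU =>
    eventually_exists_mem_level hc hħ hp₀ h0 hA hl hμ hU⟩

end Limit

/-! ### Degrees of the slice and its rescaling -/

section Slice

variable {I : Type*} [Fintype I] [Quiver I] [∀ a b : I, Fintype (a ⟶ b)] {v w : I → ℕ}

theorem entry_smul (t : ℂ) (m : RepSpace v w) (s : Ent v w) : entry (t • m) s = t * entry m s := by
  rcases s with ⟨a, b, e, i, j⟩ | ⟨k, i, j⟩ | ⟨a, b, e, i, j⟩ | ⟨k, i, j⟩ <;> rfl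

theorem act_smul (g : GaugeC v) (t : ℂ) (p : RepSpace v w) : act g (t • p) = t • act g p := by
  refine rep_ext (fun a b e => ?_) (fun k => ?_) (fun a b e => ?_) (fun k => ?_) <;>
    simp [act, actOmega, actOmegaBar, -Matrix.coe_units_inv]

/-- One test value suffices: `exp i` is not a root of unity, so its powers separate weights. -/
theorem entry_act_eq_zero_of_weight {g : ℂ → GaugeC v} {V : GaugeC v} {n : (k : I) → Fin (v k) → ℤ}
    (hg : ∀ t : ℂ, t ≠ 0 → g t = V⁻¹ * powG n t * V) {q : RepSpace v w} {d : ℤ}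
    (h : ∀ t : ℂ, ‖t‖ = 1 → act (g t) q = t ^ d • q) {s : Ent v w} (hs : wt n s ≠ d) :
    entry (act V q) s = 0 := by
  set t := Complex.exp Complex.I with ht
  have ht0 : t ≠ 0 := Complex.exp_ne_zero _
  have ht1 : ‖t‖ = 1 := by
    have := Complex.norm_exp_ofReal_mul_I 1
    simpa [ht] using this
  have h1 : act (powG n t) (act V q) = t ^ d • act V q := by
    rw [← act_smul, ← h t ht1, hg t ht0, mul_assoc, act_mul V⁻¹, act_act_inv, act_mul]
  have h2 := congrArg (fun p => entry p s) h1
  simp only [entry_act_powG n ht0, entry_smul] at h2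
  by_contra h3
  have h4 := mul_right_cancel₀ h3 h2
  have h5 : t ^ (wt n s - d) = 1 := by
    rw [zpow_sub₀ ht0, h4, div_self (zpow_ne_zero _ ht0)]
  rw [ht, ← Complex.exp_int_mul, mul_comm] at h5
  obtain ⟨z, hz⟩ := exp_I_mul_eq_one (x := ((wt n s - d : ℤ) : ℝ)) (by push_cast at h5 ⊢; exact h5)
  exact hs (sub_eq_zero.1 (int_eq_zero_of_eq_mul_two_pi hz))

/-- The bounds 1 on `M_Ω` and 0 on `M_Ω̄` both become degree at least 1, since the scaling adds 1 on
`M_Ω̄`. -/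
theorem entry_act_eq_zero_of_mem_bbSlice {p₀ : RepSpace v w} {g : ℂ → GaugeC v} {V : GaugeC v}
    {n : (k : I) → Fin (v k) → ℤ} (hg : ∀ t : ℂ, t ≠ 0 → g t = V⁻¹ * powG n t * V)
    {A : RepSpace v w} (hA : A ∈ bbSlice p₀ g) {s : Ent v w} (hs : tdeg n s < 1) :
    entry (act V A) s = 0 := by
  have key₁ : ∀ x ∈ omegaGE g w 1, entry (act V ((x, 0) : RepSpace v w)) s = 0 := by
    intro x hx
    induction hx using Submodule.span_induction with
    | mem x hx =>
      obtain ⟨m, hm, hx⟩ := hx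
      have h1 : ∀ t : ℂ, ‖t‖ = 1 → act (g t) ((x, 0) : RepSpace v w) = t ^ m • (x, 0) := by
        intro t ht
        have h2 : actOmegaBar (g t) (0 : MOmegaBar v w) = 0 := congrArg Prod.snd (act_zero (g t))
        rw [Prod.smul_mk, smul_zero]
        exact Prod.ext (hx t ht) h2
      refine entry_act_eq_zero_of_weight hg h1 ?_
      have : 0 ≤ barDeg s := by
        rcases s with ⟨a, b, e, i, j⟩ | ⟨k, i, j⟩ | ⟨a, b, e, i, j⟩ | ⟨k, i, j⟩ <;> simp [barDeg]
      rw [tdeg] at hs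
      omega
    | zero =>
      have : act V ((0, 0) : RepSpace v w) = 0 := act_zero V
      rw [this, entry_zero]
    | add x y _ _ hx hy =>
      have : ((x + y, 0) : RepSpace v w) = (x, 0) + (y, 0) := by simp
      rw [this, act_add, entry_add, hx, hy, add_zero]
    | smul t x _ hx =>
      have : ((t • x, 0) : RepSpace v w) = t • (x, 0) := by simp
      rw [this, act_smul, entry_smul, hx, mul_zero]
  have key₂ : ∀ y ∈ omegaBarGE g w 0, entry (act V ((0, y) : RepSpace v w)) s = 0 := by
    intro y hy
    induction hy using Submodule.span_induction with
    | mem y hy =>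
      obtain ⟨m, hm, hy⟩ := hy
      have h1 : ∀ t : ℂ, ‖t‖ = 1 → act (g t) ((0, y) : RepSpace v w) = t ^ m • (0, y) := by
        intro t ht
        have h2 : actOmega (g t) (0 : MOmega v w) = 0 := congrArg Prod.fst (act_zero (g t))
        rw [Prod.smul_mk, smul_zero]
        exact Prod.ext h2 (hy t ht)
      rcases eq_or_ne (barDeg s) 1 with h | h
      · refine entry_act_eq_zero_of_weight hg h1 ?_
        rw [tdeg] at hs
        omega
      · have h2 : act V ((0, y) : RepSpace v w) = (0, (act V ((0, y) : RepSpace v w)).2) :=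
          Prod.ext (show actOmega V (0 : MOmega v w) = 0 from
            congrArg Prod.fst (act_zero V)) rfl
        rw [h2]
        rcases s with ⟨a, b, e, i, j⟩ | ⟨k, i, j⟩ | ⟨a, b, e, i, j⟩ | ⟨k, i, j⟩
        · rfl
        · rfl
        · exact absurd rfl h
        · exact absurd rfl h
    | zero =>
      have : act V ((0, 0) : RepSpace v w) = 0 := act_zero V
      rw [this, entry_zero]
    | add x y _ _ hx hy =>
      have : ((0, x + y) : RepSpace v w) = (0, x) + (0, y) := by simp
      rw [this, act_add, entry_add, hx, hy, add_zero]
    | smul t x _ hx =>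
      have : ((0, t • x) : RepSpace v w) = t • (0, x) := by simp
      rw [this, act_smul, entry_smul, hx, mul_zero]
  have h3 : A = (A.1, 0) + (0, A.2) := by simp
  rw [h3, act_add, entry_add, key₁ _ hA.1, key₂ _ hA.2.1, add_zero]

theorem act_powG_scale_of_homogeneous {n : (k : I) → Fin (v k) → ℤ} {p : RepSpace v w}
    (h0 : ∀ s, tdeg n s ≠ 0 → entry p s = 0) {t : ℂ} (ht : t ≠ 0) :
    act (powG n t) (scale t p) = p := by
  refine entry_ext fun s => ?_
  rw [entry_act_powG n ht, entry_scale, ← mul_assoc, ← zpow_add₀ ht, ← tdeg]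
  rcases eq_or_ne (tdeg n s) 0 with h | h
  · rw [h, zpow_zero, one_mul]
  · rw [h0 s h, mul_zero]

theorem tau_of_homogeneous {n : (k : I) → Fin (v k) → ℤ} {p : RepSpace v w}
    (h0 : ∀ s, tdeg n s ≠ 0 → entry p s = 0) (S : ℝ) : tau n S p = p := by
  refine entry_ext fun s => ?_
  rw [entry_tau]
  rcases eq_or_ne (tdeg n s) 0 with h | h
  · simp [h]
  · rw [h0 s h, mul_zero]

/-- As `p₀` is fixed, `p₀ + A_R` equals `R ^ n · (R · (p₀ + A))`. Removing `R ^ n` and taking out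
the scaling by `R` leaves the adjoint of `p₀` with the factor `R⁻¹` in both components. -/
theorem act_powG_inv_twist {n : (k : I) → Fin (v k) → ℤ} {p₀ A : RepSpace v w} (ħ : ℝ)
    (h0 : ∀ s, tdeg n s ≠ 0 → entry p₀ s = 0) {R : ℝ} (hR : 0 < R) :
    act (powG n (R : ℂ))⁻¹ (twist ħ p₀ (p₀ + act (powG n (R : ℂ)) (scale (R : ℂ) A))) =
      scale (R : ℂ) ((p₀ + A).1 - ((R⁻¹ : ℝ) : ℂ) • (ħ : ℂ) • (dag p₀).1,
        (ħ : ℂ)⁻¹ • (p₀ + A).2 + ((R⁻¹ : ℝ) : ℂ) • (dag p₀).2) := by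
  have hR0 : (R : ℂ) ≠ 0 := by exact_mod_cast hR.ne'
  set g := powG n (R : ℂ) with hg
  have h1 : p₀ + act g (scale (R : ℂ) A) = act g (scale (R : ℂ) (p₀ + A)) := by
    rw [scale_add, act_add, hg, act_powG_scale_of_homogeneous h0 hR0]
  have h2 : act g p₀ = scale (R : ℂ)⁻¹ p₀ := by
    have := congrArg (scale (R : ℂ)⁻¹) (act_powG_scale_of_homogeneous h0 hR0)
    rwa [← act_scale, scale_scale, inv_mul_cancel₀ hR0, scale_one] at this
  have hgg : ∀ k, (g k).1ᴴ = (((g⁻¹) k)⁻¹).1 := fun k => by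
    rw [Pi.inv_apply, inv_inv]
    exact conjTranspose_powG n hR k
  have h3 : act g⁻¹ (dag p₀) = dag (scale (R : ℂ)⁻¹ p₀) := by rw [← h2, dag_act hgg]
  have hj : ∀ (h : GaugeC v) (z q : RepSpace v w),
      act h (z.1 - (ħ : ℂ) • q.1, (ħ : ℂ)⁻¹ • z.2 + q.2) =
        ((act h z).1 - (ħ : ℂ) • (act h q).1, (ħ : ℂ)⁻¹ • (act h z).2 + (act h q).2) :=
    fun h z q => by
      refine rep_ext (fun a b e => ?_) (fun k => ?_) (fun a b e => ?_) (fun k => ?_) <;>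
        simp [act, actOmega, actOmegaBar, Matrix.mul_sub, Matrix.sub_mul, Matrix.mul_add,
          Matrix.add_mul, -Matrix.coe_units_inv]
  rw [twist, h1, hj, act_inv_act, h3]
  have h4 : dag (scale (R : ℂ)⁻¹ p₀) = (((R⁻¹ : ℝ) : ℂ) • (dag p₀).1, (dag p₀).2) := by
    refine rep_ext (fun a b e => ?_) (fun k => ?_) (fun a b e => ?_) (fun k => ?_) <;>
      simp [dag, scale, daggerBar, dagger, Matrix.conjTranspose_smul]
  rw [h4]
  refine Prod.ext ?_ ?_
  · change (p₀ + A).1 - (ħ : ℂ) • ((R⁻¹ : ℝ) : ℂ) • (dag p₀).1 = _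
    rw [smul_comm]
    rfl
  · change (ħ : ℂ)⁻¹ • (R : ℂ) • (p₀ + A).2 + (dag p₀).2 =
      (R : ℂ) • ((ħ : ℂ)⁻¹ • (p₀ + A).2 + ((R⁻¹ : ℝ) : ℂ) • (dag p₀).2)
    rw [smul_add, smul_comm, Complex.ofReal_inv, smul_inv_smul₀ hR0]

end Slice

/-! ### Conformal limits along a rescaled line -/

section Limit

variable {I : Type*} [Fintype I] [DecidableEq I] [Quiver I] [∀ a b : I, Fintype (a ⟶ b)]
  {v w : I → ℕ}

/-- The conformal limits of the rescalings of a point of the slice: a representative of the limit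
for `R` lies in the orbit of `R · u_R`, where `u_R` converges to `ħ⁻¹ · (p₀ + A)` up to a gauge
transformation. -/
theorem exists_conformalLimit_rescale {c : I → ℝ} (hc : IsGeneric v c) {ħ : ℝ} (hħ : 0 < ħ)
    {p₀ : RepSpace v w} (hp₀ : p₀ ∈ level w (central v c) 0) {g : ℂ → GaugeC v}
    (hg : IsFixedBy p₀ g) {A : RepSpace v w} (hA : A ∈ bbSlice p₀ g) :
    ∃ (V : GaugeC v) (q : RepSpace v w), ∀ R : ℝ, 0 < R →
      ∃ (b : GaugeC v) (r : TargetLevel v w c),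
        act b (scale (R : ℂ) ((act V (p₀ + A)).1 - ((R⁻¹ : ℝ) : ℂ) • (ħ : ℂ) • q.1,
          (ħ : ℂ)⁻¹ • (act V (p₀ + A)).2 + ((R⁻¹ : ℝ) : ℂ) • q.2)) = r.1 ∧
        ∀ x, IsConformalLimit c ħ (p₀ + rescale g R A) x ↔ x = toTarget r := by
  obtain ⟨V, n, hV, hgV, h0⟩ := exists_weights hc hp₀ hg
  refine ⟨V, dag (act V p₀), fun R hR => ?_⟩
  have hR0 : (R : ℂ) ≠ 0 := by exact_mod_cast hR.ne'
  have hA1 : ∀ s, tdeg n s < 1 → entry (act V A) s = 0 := fun s hs =>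
    entry_act_eq_zero_of_mem_bbSlice hgV hA hs
  have h0' : ∀ s, tdeg n s ≠ 0 → entry (act V p₀) s = 0 := h0
  have hp := act_mem_level hV hp₀
  obtain ⟨-, -, hμ, hl⟩ := hA
  set A' := act (powG n (R : ℂ)) (scale (R : ℂ) (act V A)) with hA'
  have hA2 : ∀ s, tdeg n s < 1 → entry A' s = 0 := fun s hs => by
    rw [hA', entry_act_powG n hR0, entry_scale, hA1 s hs, mul_zero, mul_zero]
  have hl2 : lStar (act V p₀) A' = 0 := by
    have h1 := lStar_act_powG hR (z := act V p₀) (fun s hs => h0' s hs.ne) (act V A)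
    rw [act_powG_scale_of_homogeneous h0' hR0, tau_of_homogeneous h0'] at h1
    funext k
    rw [h1, lStar_act_unitary hV, hl]
    simp
  have hμ2 : muC (act V p₀ + A') = 0 := by
    have h1 : act V p₀ + A' = act (powG n (R : ℂ)) (scale (R : ℂ) (act V (p₀ + A))) := by
      rw [act_add, scale_add, act_add, act_powG_scale_of_homogeneous h0' hR0]
    rw [h1]
    refine muC_act_eq_zero _ ?_
    rw [muC_scale, muC_act_eq_zero V hμ, smul_zero]
  obtain ⟨b, r, hbr, hr⟩ := exists_conformalLimit hc hħ hp h0' hA2 hl2 hμ2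
  refine ⟨b * powG n (R : ℂ), r, ?_, fun x => ?_⟩
  · rw [act_add, ← act_powG_inv_twist ħ h0' hR, act_mul, act_act_inv, hbr]
  · rw [← hr x]
    -- In the frame `V` the family `g` is `R ^ n`; a conformal limit depends only on the complex
    -- gauge orbit, so the frame may be changed.
    have h1 : p₀ + rescale g R A = act V⁻¹ (act V p₀ + A') := by
      rw [act_add, act_inv_act, rescale, hgV _ hR0, mul_assoc, act_mul, act_mul, act_scale V]
    rw [h1, isConformalLimit_act]

end Limit

/-! ### Invariant polynomials of positive degree -/

section Invariants

variable {I : Type*} [Fintype I] [Quiver I] [∀ a b : I, Fintype (a ⟶ b)] {v w : I → ℕ}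

open Polynomial in
/-- The decomposition of a polynomial function by the degree in the second summand. -/
theorem exists_polynomial_scale {f : RepSpace v w → ℂ} (hf : f ∈ polyFun v w) :
    ∃ F : RepSpace v w → ℂ[X], (∀ k, Continuous fun q => (F q).coeff k) ∧
      ∀ q t, (F q).eval t = f (scale t q) := by
  induction hf using Algebra.adjoin_induction with
  | mem f hf =>
    obtain ⟨l, rfl⟩ := hf
    have hl : Continuous l := LinearMap.continuous_of_finiteDimensional l
    have h1 : Continuous fun q : RepSpace v w => l (q.1, 0) :=
      hl.comp (continuous_fst.prodMk continuous_const)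
    have h2 : Continuous fun q : RepSpace v w => l (0, q.2) :=
      hl.comp (continuous_const.prodMk continuous_snd)
    refine ⟨fun q => C (l (q.1, 0)) + C (l (0, q.2)) * X, fun k => ?_, fun q t => ?_⟩
    · simp only [coeff_add, coeff_C_mul]
      refine Continuous.add ?_ (h2.mul continuous_const)
      simp only [coeff_C]
      split_ifs
      · exact h1
      · exact continuous_const
    · have h3 : scale t q = (q.1, 0) + t • (0, q.2) := by simp [scale]
      change _ = l (scale t q)
      rw [h3, map_add, map_smul, smul_eq_mul, mul_comm t]
      simp only [eval_add, eval_mul, eval_C, eval_X]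
  | algebraMap r =>
    exact ⟨fun _ => C r, fun k => continuous_const, fun q t => by simp⟩
  | add f g _ _ hf hg =>
    obtain ⟨F, hF, hF'⟩ := hf
    obtain ⟨G, hG, hG'⟩ := hg
    refine ⟨fun q => F q + G q, fun k => ?_, fun q t => ?_⟩
    · simp only [coeff_add]
      exact (hF k).add (hG k)
    · rw [eval_add, hF', hG', Pi.add_apply]
  | mul f g _ _ hf hg =>
    obtain ⟨F, hF, hF'⟩ := hf
    obtain ⟨G, hG, hG'⟩ := hg
    refine ⟨fun q => F q * G q, fun k => ?_, fun q t => ?_⟩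
    · simp only [coeff_mul]
      exact continuous_finsetSum _ fun x _ => (hF _).mul (hG _)
    · rw [eval_mul, hF', hG', Pi.mul_apply]

/-- A quiver without oriented cycles has a strictly increasing height function. -/
theorem exists_height (hacyclic : ∀ (a : I) (γ : Quiver.Path a a), γ = Quiver.Path.nil) :
    ∃ ht : I → ℕ, ∀ a b : I, (a ⟶ b) → ht a < ht b := by
  -- The height of `b` counts the starting points of paths of positive length ending at `b`. For an
  -- arrow from `a` to `b` the set grows strictly: by acyclicity `a` itself is new.
  refine ⟨fun b => {a | ∃ (c : I) (_ : Quiver.Path a c), Nonempty (c ⟶ b)}.ncard, fun a b e => ?_⟩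
  refine Set.ncard_lt_ncard ⟨?_, fun h => ?_⟩ (Set.toFinite _)
  · rintro x ⟨c, γ, ⟨e'⟩⟩
    exact ⟨a, γ.cons e', ⟨e⟩⟩
  · obtain ⟨c, γ, ⟨e'⟩⟩ := h (show a ∈ _ from ⟨a, Quiver.Path.nil, ⟨e⟩⟩)
    have := hacyclic a (γ.cons e')
    cases this

/-- The one-parameter group with exponents given by the height contracts `M_Ω` to 0 inside each
orbit, so a continuous invariant is constant there. -/
theorem apply_scale_zero (hacyclic : ∀ (a : I) (γ : Quiver.Path a a), γ = Quiver.Path.nil)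
    {f : RepSpace v w → ℂ} (hf : Continuous f)
    (hinv : ∀ (g : GaugeC v) (q : RepSpace v w), f (act g q) = f q) (m : RepSpace v w) :
    f (scale 0 m) = f 0 := by
  obtain ⟨ht, hht⟩ := exists_height hacyclic
  -- The shift by 1 gives the maps `i_k` positive weight also at vertices of height 0.
  set n : (k : I) → Fin (v k) → ℤ := fun k _ => (ht k : ℤ) + 1 with hn
  set q := scale 0 m with hq
  have hs : ∀ s, tdeg n s ≤ 0 → entry q s = 0 := by
    intro s hs
    rcases s with ⟨a, b, e, i, j⟩ | ⟨k, i, j⟩ | ⟨a, b, e, i, j⟩ | ⟨k, i, j⟩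
    · have := hht a b e
      simp only [tdeg, wt, barDeg, hn] at hs
      omega
    · simp only [tdeg, wt, barDeg, hn] at hs
      omega
    · rw [hq, entry_scale]; simp [barDeg]
    · rw [hq, entry_scale]; simp [barDeg]
  have h1 : ∀ R : ℝ, 0 < R → f (tau n R q) = f q := by
    intro R hR
    rw [← act_powG_scale_eq_tau hR (fun s h => hs s h.le), hinv, hq, scale_scale, mul_zero]
  have h2 : tau n 0 q = 0 := by
    refine entry_ext fun s => ?_
    rw [entry_tau, entry_zero]
    rcases le_or_gt (tdeg n s) 0 with h | h
    · rw [hs s h, mul_zero]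
    · rw [Complex.ofReal_zero, zero_pow (by omega), zero_mul]
  have h3 : Tendsto (fun R : ℝ => f (tau n R q)) (𝓝[>] 0) (𝓝 (f 0)) := by
    rw [← h2]
    exact ((hf.comp ((continuous_tau n).comp (Continuous.prodMk_left q))).tendsto 0).mono_left
      nhdsWithin_le_nhds
  refine tendsto_nhds_unique (tendsto_const_nhds.congr' ?_) h3
  filter_upwards [self_mem_nhdsWithin] with R hR
  exact (h1 R hR).symm

/-- A point that is not nilpotent is detected by an invariant of positive degree in the second
summand. -/
theorem exists_homogeneous_invariant
    (hacyclic : ∀ (a : I) (γ : Quiver.Path a a), γ = Quiver.Path.nil) {m : RepSpace v w}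
    (hm : ¬ IsNilpotentRep m) :
    ∃ (φ : RepSpace v w → ℂ) (d : ℕ), d ≠ 0 ∧ Continuous φ ∧ φ m ≠ 0 ∧
      (∀ (g : GaugeC v) (q : RepSpace v w), φ (act g q) = φ q) ∧
      ∀ (t : ℂ) (q : RepSpace v w), φ (scale t q) = t ^ d * φ q := by
  simp only [IsNilpotentRep, not_forall] at hm
  obtain ⟨f, hf, hinv, hne⟩ := hm
  obtain ⟨F, hF, hF'⟩ := exists_polynomial_scale hf
  have hfc : Continuous f := by
    have h1 : (polyFun v w : Set (RepSpace v w → ℂ)) ⊆ {f | Continuous f} := by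
      intro f hf
      induction hf using Algebra.adjoin_induction with
      | mem f hf =>
        obtain ⟨l, rfl⟩ := hf
        exact LinearMap.continuous_of_finiteDimensional l
      | algebraMap r => exact continuous_const
      | add f g _ _ hf hg => exact Continuous.add hf hg
      | mul f g _ _ hf hg => exact Continuous.mul hf hg
    exact h1 hf
  -- The gauge action commutes with the scaling, so each coefficient of `f (scale t q)` in `t` is
  -- again invariant, and homogeneous.
  have hFinv : ∀ g q, F (act g q) = F q := fun g q => Polynomial.funext fun t => by
    rw [hF', hF', ← act_scale, hinv]
  have hFscale : ∀ t q, F (scale t q) = (F q).comp (Polynomial.C t * Polynomial.X) := fun t q =>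
    Polynomial.funext fun s => by
      rw [hF', scale_scale, Polynomial.eval_comp, hF', Polynomial.eval_mul, Polynomial.eval_C,
        Polynomial.eval_X, mul_comm]
  -- If only the constant coefficient survived at `m`, then `f m = f (scale 0 m) = f 0`.
  have hex : ∃ d, d ≠ 0 ∧ (F m).coeff d ≠ 0 := by
    by_contra! hall
    refine hne ?_
    have h2 : F m = Polynomial.C ((F m).coeff 0) := by
      ext d
      rw [Polynomial.coeff_C]
      split_ifs with h
      · rw [h]
      · exact hall d h
    have h3 : f m = f (scale 0 m) := by
      have h4 := hF' m 1
      have h5 := hF' m 0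
      rw [h2, Polynomial.eval_C] at h4 h5
      rw [← h5, h4, scale_one]
    rw [h3, apply_scale_zero hacyclic hfc hinv]
  obtain ⟨d, hd, hdm⟩ := hex
  refine ⟨fun q => (F q).coeff d, d, hd, hF d, hdm, fun g q => by simp only [hFinv], fun t q => ?_⟩
  simp only [hFscale, Polynomial.comp_C_mul_X_coeff]
  ring

end Invariants

end NakajimaQuiver

theorem mainTheorem3 {I : Type*} [Fintype I] [DecidableEq I] [Quiver I]
    [∀ a b : I, Fintype (a ⟶ b)]
    (hacyclic : ∀ (a : I) (γ : Quiver.Path a a), γ = Quiver.Path.nil)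
    (v w : I → ℕ) (c : I → ℝ) (hc : IsGeneric v c)
    (p₀ : RepSpace v w) (hp₀ : p₀ ∈ level w (central v c) 0)
    (g : ℂ → GaugeC v) (hg : IsFixedBy p₀ g)
    (A : RepSpace v w) (hA : A ∈ bbSlice p₀ g) (hnil : ¬ IsNilpotentRep (p₀ + A))
    (ħ : ℝ) (hħ : 0 < ħ) :
    ∃ CL : ℝ → TargetVariety v w c,
      (∀ R : ℝ, 0 < R → ∀ q : TargetVariety v w c,
        IsConformalLimit c ħ (p₀ + rescale g R A) q ↔ q = CL R) ∧
      ∀ K : Set (TargetVariety v w c), IsCompact K → ∀ᶠ R in atTop, CL R ∉ K := by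
  obtain ⟨V, p, h⟩ := exists_conformalLimit_rescale hc hħ hp₀ hg hA
  obtain ⟨φ, d, hd, hφ, hφm, hφinv, hφscale⟩ := exists_homogeneous_invariant hacyclic hnil
  have hħ0 : (ħ : ℂ)⁻¹ ≠ 0 := inv_ne_zero (by exact_mod_cast hħ.ne')
  choose b r hbr hr using h
  classical
  let CL : ℝ → TargetVariety v w c := fun R =>
    if hR : 0 < R then toTarget (r R hR) else toTarget (r 1 one_pos)
  have hCL : ∀ R (hR : 0 < R), CL R = toTarget (r R hR) := fun R hR => dif_pos hR
  refine ⟨CL, fun R hR q => by rw [hCL R hR]; exact hr R hR q, fun K hK => ?_⟩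
  -- the invariant descends to a continuous function on the target
  let Φ : TargetVariety v w c → ℂ := Quotient.lift (fun x : TargetLevel v w c => φ x.1) (by
    rintro x y ⟨u, -, hu⟩
    change φ x.1 = φ y.1
    rw [← hu, hφinv])
  have hΦ : Continuous Φ := Continuous.quotient_lift (hφ.comp continuous_subtype_val) _
  have hΦr : ∀ x : TargetLevel v w c, Φ (toTarget x) = φ x.1 := fun x => rfl
  obtain ⟨C, hC⟩ := (hK.image hΦ).isBounded.exists_norm_le
  set m := act V (p₀ + A) with hm
  -- Here `ρ` stands for `R⁻¹`, so that the behaviour at infinity becomes continuity at `ρ = 0`.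
  let u : ℝ → RepSpace v w := fun ρ =>
    (m.1 - (ρ : ℂ) • (ħ : ℂ) • p.1, (ħ : ℂ)⁻¹ • m.2 + (ρ : ℂ) • p.2)
  have hu : Continuous u := by
    have h1 : ∀ x : MOmega v w, Continuous fun ρ : ℝ => (ρ : ℂ) • x := fun x =>
      Complex.continuous_ofReal.smul continuous_const
    have h2 : ∀ x : MOmegaBar v w, Continuous fun ρ : ℝ => (ρ : ℂ) • x := fun x =>
      Complex.continuous_ofReal.smul continuous_const
    exact (continuous_const.sub (h1 _)).prodMk (continuous_const.add (h2 _))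
  have hu0 : u 0 = scale (ħ : ℂ)⁻¹ m := by simp [u, scale]
  have hne : φ (u 0) ≠ 0 := by
    rw [hu0, hφscale, hm, hφinv]
    exact mul_ne_zero (pow_ne_zero _ hħ0) hφm
  have hlim : Tendsto (fun R : ℝ => ‖φ (u R⁻¹)‖) atTop (𝓝 ‖φ (u 0)‖) :=
    ((hφ.comp hu).norm.tendsto 0).comp tendsto_inv_atTop_zero
  -- By homogeneity `R ^ d * ‖φ (u R⁻¹)‖` is the absolute value of `Φ` at the conformal limit; it
  -- exceeds the bound `C` on `K` for large `R`.
  have hgrow : Tendsto (fun R : ℝ => R ^ d * ‖φ (u R⁻¹)‖) atTop atTop :=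
    (tendsto_pow_atTop hd).atTop_mul_pos (norm_pos_iff.2 hne) hlim
  filter_upwards [hgrow.eventually_gt_atTop C, eventually_gt_atTop 0] with R hR hR0 hmem
  have h1 := hC _ (Set.mem_image_of_mem Φ hmem)
  rw [hCL R hR0, hΦr, ← hbr R hR0, hφinv, hφscale, norm_mul, norm_pow, Complex.norm_real,
    Real.norm_of_nonneg hR0.le] at h1
  exact absurd h1 (not_le.2 hR)
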